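/- **Setting.** Let $k\ge 1$, let $D\subset\mathbb R^k$ be open and bounded, $0<\alpha<1$, $0<\beta\le 1$, $T>0$. Let $$\mathcal L v=-\sum_{i=1}^k\partial_i\Big(\sum_{j=1}^k a_{ij}\,\partial_j v\Big)+b\,v$$ with $a_{ij}=a_{ji}\in C^1(\overline D)$, $b\in C(\overline D)$, $b\ge 0$, and $\sum_{i,j} a_{ij}(x)\xi_i\xi_j\ge L_0|\xi|^2$ on $\overline D$ for some $L_0>0$, and let $\mathcal H$ be the boundary operator $\mathcal Hv=v$ or $\mathcal Hv=\partial v/\partial n+\kappa v$ with $\kappa>0$ ($n$ the outer unit normal; the conormal derivative $\sum_{i,j}a_{ij}n_i\partial_jv$ is allowed in place of $\partial v/\partial n$; in these two cases $\partial D$ is of class $C^1$). Let $e_1,e_2,\dots$ be an orthonormal basis of the real space $L^2(D)$ of functions $e_j\in H^2(D)$ with $\mathcal He_j=0$ on $\partial D$ and $\mathcal Le_j=m_je_j$, where $0<m_1\le m_2\le\cdots\to\infty$. For $\gamma\ge 0$ put $\mathbf V_\gamma=\{v\in L^2(D):\|v\|_{\mathbf V_\gamma}^2=\sum_j m_j^{2\gamma}(v,e_j)^2<\infty\}$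 and let $\mathbf V_{-\gamma}$ be its dual space; $g\in L^2(D)$ is identified with $v\mapsto (g,v)$ in $\mathbf V_{-\gamma}$, and $\mathbf V_{-\gamma}\subset \mathbf V_{-\delta}$ by restriction for $\gamma\le\delta$. For a Banach space $B$, $C^\rho((0,T];B)$ is the space of continuous $v:(0,T]\to B$ with $\|v\|_{C^\rho((0,T];B)}=\sup_{0<t\le T}t^\rho\|v(t)\|_B<\infty$, and $C^s([0,T];B)$ is the space of $s$-Hölder continuous functions on $[0,T]$. Let $E_{a,b}(z)=\sum_{n\ge 0}z^n/\Gamma(an+b)$ and $$\mathcal O_1(t)F=\sum_j\int_0^t (F(\tau),e_j)\,(t-\tau)^{\alpha-1}E_{\alpha,\alpha}\big(-m_j^\beta(t-\tau)^\alpha\big)\,d\tau\;e_j,\qquad \mathcal O_2(t)v=\sum_j (v,e_j)\frac{E_{\alpha,1}(-m_j^\beta t^\alpha)}{E_{\alpha,1}(-m_j^\beta T^\alpha)}\,e_j,$$ $\mathcal O_3(t)F=-\mathcal O_2(t)\mathcal O_1(T)F$. A *mild solution* of the final value problem ${}^cD_t^\alpha u=-\mathcal L^\beta u+F$ in $(0,T)\times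 D$, $\mathcal Hu=0$ on $(0,T)\times\partial D$, $u(T)=\varphi$, is a function $u$ in $L^{a}(0,T;L^{b}(D))$ for some $a,b\ge 1$ with $u(t)=\mathcal O_1(t)F+\mathcal O_2(t)\varphi+\mathcal O_3(t)F$ for almost every $t\in(0,T)$. The *Caputo derivative* of $v\in C([0,T];B)$ is ${}^cD_t^\alpha v=D_t\,I_t^{1-\alpha}(v-v(0))$, where $I_t^{a}w(t)=\frac1{\Gamma(a)}\int_0^t(t-\tau)^{a-1}w(\tau)\,d\tau$; that is, ${}^cD^\alpha_tv$ is the Bochner integrable function on $(0,T)$ whose primitive vanishing at $0$ is $I_t^{1-\alpha}(v-v(0))$ (it equals $I_t^{1-\alpha}D_tv$ when $v$ is absolutely continuous with integrable derivative). Let real numbers satisfy - $0<p,q<1$, $p+q=1$; $\ 0<s<\min(\alpha q,1-\alpha q)$; - $0<p'\le p-\frac s\alpha$, $q'=1-p'$, $0<r\le\frac{1-\alpha q'}{\alpha q'}$; - $0\le\widehat q\le\min(p,q,\frac s\alpha)$, $\widehat p=1-\widehat q$, $0<\widehat r\le\frac{1-\alpha}{\alpha}$. **Theorem 3.2.** (a)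 There is a constant $C_3>0$, independent of $\varphi$ and $F$, such that for all $\varphi\in\mathbf V_{\beta(p+\widehat q)}$ and $F\in L^{\frac1{\alpha q-s}+\widehat r}(0,T;L^2(D))$ the final value problem has a mild solution $u$, unique up to equality for almost every $t$, with $$u\in L^{\frac1{\alpha q'}-r}(0,T;\mathbf V_{\beta(p-p')})\cap C^{\alpha q}((0,T];L^2(D))\cap C^s([0,T];\mathbf V_{-\beta q'}),\quad u(T)=\varphi,$$ whose Caputo derivative exists (for $u$ as an element of $C([0,T];\mathbf V_{-\beta q'})$), belongs to $L^{\frac1\alpha-\widehat r}(0,T;\mathbf V_{-\beta(q-\widehat q)})$ and satisfies $$\|{}^cD_t^\alpha u\|_{L^{\frac1\alpha-\widehat r}(0,T;\mathbf V_{-\beta(q-\widehat q)})}\le C_3\|F\|_{L^{\frac1{\alpha q-s}+\widehat r}(0,T;L^2(D))}+C_3\|\varphi\|_{\mathbf V_{\beta(p+\widehat q)}}.$$ (b) There is a constant $C_4>0$, independent of $\varphi$ and $F$, such that if moreover $F\in C^\alpha((0,T];\mathbf V_{-\beta q})$, then the problem has a unique mild solution $u$ with all the properties in (a), and in addition ${}^cD_t^\alpha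 u\in C^\alpha((0,T];\mathbf V_{-\beta q})$ and $$\|{}^cD_t^\alpha u\|_{L^{\frac1\alpha-\widehat r}(0,T;\mathbf V_{-\beta(q-\widehat q)})}+\|{}^cD_t^\alpha u\|_{C^\alpha((0,T];\mathbf V_{-\beta q})}\le C_4\|\varphi\|_{\mathbf V_{\beta(p+\widehat q)}}+C_4\|F\|_{L^{\frac1{\alpha q-s}+\widehat r}(0,T;L^2(D))}+C_4\|F\|_{C^\alpha((0,T];\mathbf V_{-\beta q})}.$$ -/

import Mathlib

open MeasureTheory Set Filter Topology
open scoped ENNReal InnerProductSpace Distributions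

noncomputable section

namespace FinalValue

/-- Euclidean space of dimension `k`. -/
abbrev Euc (k : ℕ) := EuclideanSpace ℝ (Fin k)

/-- The `i`-th partial derivative of `f` at `x` (used for differentiable functions). -/
def partialD {k : ℕ} (i : Fin k) (f : Euc k → ℝ) (x : Euc k) : ℝ :=
  fderiv ℝ f x (EuclideanSpace.single i 1)

/-- The real Hilbert space `L²(D)`. -/
abbrev L2 {k : ℕ} (D : TopologicalSpace.Opens (Euc k)) :=
  Lp ℝ 2 ((volume : Measure (Euc k)).restrict (D : Set (Euc k)))

/-! ### Elliptic operators, Sobolev functions and boundary conditions -/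

/-- `f ∈ C¹(closure D)`: `f` is continuously differentiable in `D`, and `f` and its derivative
extend continuously to the closure. -/
def IsC1OnClosure {k : ℕ} (D : TopologicalSpace.Opens (Euc k)) (f : Euc k → ℝ) : Prop :=
  ContinuousOn f (closure (D : Set (Euc k))) ∧
    ∃ f' : Euc k → (Euc k →L[ℝ] ℝ), ContinuousOn f' (closure (D : Set (Euc k))) ∧
      ∀ x ∈ D, HasFDerivAt f (f' x) x

/-- The coefficients of a symmetric uniformly elliptic operator
`𝓛 v = - ∑ i, ∂ᵢ (∑ j, aᵢⱼ ∂ⱼ v) + b v` on `D`. -/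
structure EllipticOperator {k : ℕ} (D : TopologicalSpace.Opens (Euc k)) where
  a : Fin k → Fin k → Euc k → ℝ
  b : Euc k → ℝ
  a_C1 : ∀ i j, IsC1OnClosure D (a i j)
  b_cont : ContinuousOn b (closure (D : Set (Euc k)))
  b_nonneg : ∀ x ∈ closure (D : Set (Euc k)), 0 ≤ b x
  a_symm : ∀ i j, ∀ x ∈ closure (D : Set (Euc k)), a i j x = a j i x
  elliptic : ∃ c : ℝ, 0 < c ∧ ∀ x ∈ closure (D : Set (Euc k)), ∀ ξ : Fin k → ℝ,
    c * ∑ i, ξ i ^ 2 ≤ ∑ i, ∑ j, ξ i * a i j x * ξ j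

/-- `g` is the weak `i`-th partial derivative of `f` in `D`. -/
def IsWeakPartial {k : ℕ} (D : TopologicalSpace.Opens (Euc k)) (i : Fin k) (f g : L2 D) : Prop :=
  ∀ ψ : 𝓓(D, ℝ), ∫ x in (D : Set (Euc k)), f x * partialD i ψ x =
    - ∫ x in (D : Set (Euc k)), g x * ψ x

/-- An element of the Sobolev space `H²(D)` together with its weak derivatives. -/
structure H2Function {k : ℕ} (D : TopologicalSpace.Opens (Euc k)) where
  val : L2 D
  grad : Fin k → L2 D
  hess : Fin k → Fin k → L2 D
  weak_grad : ∀ i, IsWeakPartial D i val (grad i)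
  weak_hess : ∀ i j, IsWeakPartial D j (grad i) (hess i j)

/-- `𝓛 v = f` for `v ∈ H²(D)`, `f ∈ L²(D)`, the divergence being taken in the weak sense. -/
def EllipticOperator.MapsTo {k : ℕ} {D : TopologicalSpace.Opens (Euc k)} (L : EllipticOperator D)
    (v : H2Function D) (f : L2 D) : Prop :=
  ∀ ψ : 𝓓(D, ℝ),
    ∫ x in (D : Set (Euc k)),
        ((∑ i, (∑ j, L.a i j x * v.grad j x) * partialD i ψ x) + L.b x * v.val x * ψ x) =
      ∫ x in (D : Set (Euc k)), f x * ψ x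

/-- Zero Dirichlet trace: `v` is a limit in `H¹(D)` of test functions. -/
def ZeroTrace {k : ℕ} {D : TopologicalSpace.Opens (Euc k)} (v : H2Function D) : Prop :=
  ∃ ψ : ℕ → 𝓓(D, ℝ),
    Tendsto (fun n => eLpNorm (fun x => ψ n x - v.val x) 2
      (volume.restrict (D : Set (Euc k)))) atTop (𝓝 0) ∧
    ∀ i, Tendsto (fun n => eLpNorm (fun x => partialD i (ψ n) x - v.grad i x) 2
      (volume.restrict (D : Set (Euc k)))) atTop (𝓝 0)

/-- `ν` is the outer unit normal field on the boundary of `D`, which is of class `C¹`: near each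
boundary point, `D` is the sublevel set of a `C¹` function with nonzero gradient there. -/
def IsOuterNormal {k : ℕ} (D : TopologicalSpace.Opens (Euc k)) (ν : Euc k → Euc k) : Prop :=
  ∀ x ∈ frontier (D : Set (Euc k)), ∃ (U : Set (Euc k)) (ρ : Euc k → ℝ),
    IsOpen U ∧ x ∈ U ∧ ContDiffOn ℝ 1 ρ U ∧
      (∀ y ∈ U, y ∈ D ↔ ρ y < 0) ∧ (∀ y ∈ U, y ∈ frontier (D : Set (Euc k)) ↔ ρ y = 0) ∧
      gradient ρ x ≠ 0 ∧ ν x = ‖gradient ρ x‖⁻¹ • gradient ρ x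

/-- `∂v/∂η + κ v = 0` on the boundary of `D`, in the sense of traces: `v` is a limit in `H²(D)` of
smooth functions `w n` for which `∂(w n)/∂η + κ (w n)` tends to zero in `L²` of the boundary
(with respect to the surface measure). -/
def ZeroRobinTrace {k : ℕ} {D : TopologicalSpace.Opens (Euc k)} (η : Euc k → Euc k) (κ : ℝ)
    (v : H2Function D) : Prop :=
  ∃ w : ℕ → Euc k → ℝ, (∀ n, ContDiff ℝ ((⊤ : ℕ∞) : WithTop ℕ∞) (w n)) ∧
    Tendsto (fun n => eLpNorm (fun x => w n x - v.val x) 2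
      (volume.restrict (D : Set (Euc k)))) atTop (𝓝 0) ∧
    (∀ i, Tendsto (fun n => eLpNorm (fun x => partialD i (w n) x - v.grad i x) 2
      (volume.restrict (D : Set (Euc k)))) atTop (𝓝 0)) ∧
    (∀ i j, Tendsto (fun n => eLpNorm
      (fun x => partialD j (partialD i (w n)) x - v.hess i j x) 2
      (volume.restrict (D : Set (Euc k)))) atTop (𝓝 0)) ∧
    Tendsto (fun n => eLpNorm (fun x => fderiv ℝ (w n) x (η x) + κ * w n x) 2
      ((Measure.hausdorffMeasure ((k : ℝ) - 1)).restrict (frontier (D : Set (Euc k)))))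
      atTop (𝓝 0)

/-- The boundary operators `v` and `∂v/∂n + κ v`; for variable coefficients, where symmetry of the
operator calls for the conormal derivative `∑ i j, aᵢⱼ nᵢ ∂ⱼ v`, that version is covered too. -/
inductive BoundaryCondition
  | dirichlet
  | robin (κ : ℝ)
  | conormalRobin (κ : ℝ)

/-- `v` satisfies the homogeneous boundary condition. -/
def BoundaryCondition.Holds {k : ℕ} {D : TopologicalSpace.Opens (Euc k)} (L : EllipticOperator D)
    (v : H2Function D) : BoundaryCondition → Prop
  | .dirichlet => ZeroTrace v
  | .robin κ => 0 < κ ∧ ∃ ν, IsOuterNormal D ν ∧ ZeroRobinTrace ν κ v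
  | .conormalRobin κ => 0 < κ ∧ ∃ ν, IsOuterNormal D ν ∧
      ZeroRobinTrace (fun x => WithLp.toLp 2 (fun i => ∑ j, L.a i j x * ν x j)) κ v

/-- The spectrum `0 < m 0 ≤ m 1 ≤ ⋯ → ∞` and an orthonormal basis `e` of `L²(D)` formed by
eigenfunctions of `𝓛` in `H²(D)` which satisfy the boundary condition. -/
structure EigenSystem {k : ℕ} {D : TopologicalSpace.Opens (Euc k)} (L : EllipticOperator D)
    (bc : BoundaryCondition) where
  e : HilbertBasis ℕ ℝ (L2 D)
  m : ℕ → ℝ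
  m_pos : 0 < m 0
  m_mono : Monotone m
  m_tendsto : Tendsto m atTop atTop
  eigen : ∀ j, ∃ v : H2Function D, v.val = e j ∧ bc.Holds L v ∧ L.MapsTo v (m j • e j)

/-! ### The scale `V_γ` and its dual -/

namespace EigenSystem

variable {k : ℕ} {D : TopologicalSpace.Opens (Euc k)} {L : EllipticOperator D}
  {bc : BoundaryCondition} (S : EigenSystem L bc)

theorem m_pos_all (j : ℕ) : 0 < S.m j := S.m_pos.trans_le (S.m_mono (Nat.zero_le j))

/-- The coefficients `m_j ^ γ (v, e_j)` of `𝓛 ^ γ v`. -/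
def coef (γ : ℝ) (v : L2 D) (j : ℕ) : ℝ := S.m j ^ γ * ⟪S.e j, v⟫_ℝ

theorem coef_add (γ : ℝ) (v w : L2 D) : S.coef γ (v + w) = S.coef γ v + S.coef γ w := by
  funext j
  simp only [coef, inner_add_right, Pi.add_apply]
  ring

theorem coef_smul (γ c : ℝ) (v : L2 D) : S.coef γ (c • v) = c • S.coef γ v := by
  funext j
  simp only [coef, inner_smul_right, Pi.smul_apply, smul_eq_mul]
  ring

theorem memlp_iff (f : ℕ → ℝ) : Memℓp f 2 ↔ Summable fun j => f j ^ 2 := by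
  rw [memℓp_gen_iff (by norm_num)]
  simp

/-- The domain of `𝓛 ^ γ`: all `v ∈ L²(D)` with `∑ m_j ^ (2 γ) (v, e_j) ^ 2 < ∞`. -/
def domain (γ : ℝ) : Submodule ℝ (L2 D) where
  carrier := {v | Summable fun j => S.coef γ v j ^ 2}
  zero_mem' := by simp [coef, summable_zero]
  add_mem' := by
    intro v w hv hw
    simp only [mem_ofPred_eq, ← memlp_iff] at hv hw ⊢
    rw [coef_add]
    exact hv.add hw
  smul_mem' := by
    intro c v hv
    simp only [mem_ofPred_eq, ← memlp_iff] at hv ⊢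
    rw [coef_smul]
    exact hv.const_smul c

/-- The space `V_γ` (for `0 ≤ γ`), the domain of `𝓛 ^ γ` with its graph norm `‖𝓛 ^ γ v‖`. -/
def V (γ : ℝ) : Type := S.domain γ

instance (γ : ℝ) : AddCommGroup (S.V γ) := inferInstanceAs (AddCommGroup (S.domain γ))
instance (γ : ℝ) : Module ℝ (S.V γ) := inferInstanceAs (Module ℝ (S.domain γ))

/-- An element of `V_γ` as an element of `L²(D)`. -/
def val {γ : ℝ} : S.V γ →ₗ[ℝ] L2 D := (S.domain γ).subtype

/-- An element of the domain of `𝓛 ^ γ` as an element of `V_γ`. -/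
def mkV {γ : ℝ} (v : L2 D) (h : v ∈ S.domain γ) : S.V γ := (⟨v, h⟩ : S.domain γ)

theorem val_mkV {γ : ℝ} (v : L2 D) (h : v ∈ S.domain γ) : S.val (S.mkV v h) = v := rfl

theorem val_mem {γ : ℝ} (v : S.V γ) : S.val v ∈ S.domain γ := Subtype.property v

theorem val_injective {γ : ℝ} : Function.Injective (S.val (γ := γ)) := Subtype.val_injective

/-- The fractional power `𝓛 ^ γ : V_γ → L²(D)`, `v ↦ ∑ m_j ^ γ (v, e_j) e_j`. -/
def fracPow (γ : ℝ) : S.V γ →ₗ[ℝ] L2 D where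
  toFun v := S.e.repr.symm ⟨S.coef γ (S.val v), (memlp_iff _).2 (S.val_mem v)⟩
  map_add' v w := by
    rw [← map_add]
    congr 1
    ext j
    exact congrFun (S.coef_add γ (S.val v) (S.val w)) j
  map_smul' c v := by
    rw [RingHom.id_apply, ← map_smul]
    congr 1
    ext j
    exact congrFun (S.coef_smul γ c (S.val v)) j

theorem hasSum_fracPow {γ : ℝ} (v : S.V γ) :
    HasSum (fun j => (S.m j ^ γ * ⟪S.e j, S.val v⟫_ℝ) • S.e j) (S.fracPow γ v) :=
  S.e.hasSum_repr_symm ⟨S.coef γ (S.val v), (memlp_iff _).2 (S.val_mem v)⟩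

theorem inner_fracPow {γ : ℝ} (v : S.V γ) (j : ℕ) :
    ⟪S.e j, S.fracPow γ v⟫_ℝ = S.m j ^ γ * ⟪S.e j, S.val v⟫_ℝ := by
  rw [← HilbertBasis.repr_apply_apply]
  simp [fracPow, coef]

theorem fracPow_injective (γ : ℝ) : Function.Injective (S.fracPow γ) := by
  intro v w h
  apply S.val_injective
  apply S.e.repr.injective
  ext j
  have h1 := S.inner_fracPow v j
  rw [h, S.inner_fracPow w j] at h1
  have h2 : (S.m j ^ γ) ≠ 0 := (Real.rpow_pos_of_pos (S.m_pos_all j) γ).ne'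
  simpa [HilbertBasis.repr_apply_apply] using (mul_left_cancel₀ h2 h1).symm

instance (γ : ℝ) : NormedAddCommGroup (S.V γ) :=
  NormedAddCommGroup.induced (S.V γ) (L2 D) (S.fracPow γ) (S.fracPow_injective γ)

instance (γ : ℝ) : NormedSpace ℝ (S.V γ) :=
  NormedSpace.induced ℝ (S.V γ) (L2 D) (S.fracPow γ)

theorem norm_def {γ : ℝ} (v : S.V γ) : ‖v‖ = ‖S.fracPow γ v‖ := rfl

/-- The space `V_{-γ}`, the dual of `V_γ`. -/
abbrev VDual (γ : ℝ) := StrongDual ℝ (S.V γ)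

theorem norm_le_of_inner_le {v w : L2 D} {C : ℝ} (hC : 0 ≤ C)
    (h : ∀ j, |⟪S.e j, v⟫_ℝ| ≤ C * |⟪S.e j, w⟫_ℝ|) : ‖v‖ ≤ C * ‖w‖ := by
  have hv := S.e.hasSum_inner_mul_inner v v
  have hw := (S.e.hasSum_inner_mul_inner w w).mul_left (C ^ 2)
  have hle := hasSum_le (fun j => ?_) hv hw
  · rw [real_inner_self_eq_norm_sq, real_inner_self_eq_norm_sq, ← mul_pow] at hle
    exact (pow_le_pow_iff_left₀ (norm_nonneg _) (by positivity) two_ne_zero).1 hle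
  · have h1 := pow_le_pow_left₀ (abs_nonneg _) (h j) 2
    rw [mul_pow, sq_abs, sq_abs] at h1
    rw [real_inner_comm (S.e j) v, real_inner_comm (S.e j) w]
    nlinarith

theorem rpow_le {γ δ : ℝ} (h : γ ≤ δ) (j : ℕ) : S.m j ^ γ ≤ S.m 0 ^ (γ - δ) * S.m j ^ δ := by
  have h1 : S.m j ^ γ = S.m j ^ (γ - δ) * S.m j ^ δ := by
    rw [← Real.rpow_add (S.m_pos_all j)]
    ring_nf
  rw [h1]
  exact mul_le_mul_of_nonneg_right (Real.rpow_le_rpow_of_nonpos S.m_pos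
    (S.m_mono (Nat.zero_le j)) (by linarith)) (Real.rpow_nonneg (S.m_pos_all j).le _)

theorem domain_anti {γ δ : ℝ} (h : γ ≤ δ) : S.domain δ ≤ S.domain γ := by
  intro v hv
  refine Summable.of_nonneg_of_le (fun j => sq_nonneg _) (fun j => ?_)
    ((show Summable fun j => S.coef δ v j ^ 2 from hv).mul_left ((S.m 0 ^ (γ - δ)) ^ 2))
  have h2 : (S.m 0 ^ (γ - δ)) ^ 2 * S.coef δ v j ^ 2 =
      (S.m 0 ^ (γ - δ) * S.m j ^ δ) ^ 2 * ⟪S.e j, v⟫_ℝ ^ 2 := by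
    simp only [coef]
    ring
  rw [h2, coef, mul_pow]
  exact mul_le_mul_of_nonneg_right (pow_le_pow_left₀ (Real.rpow_nonneg (S.m_pos_all j).le _)
    (S.rpow_le h j) 2) (sq_nonneg _)

/-- The inclusion `V_δ ⊆ V_γ` for `γ ≤ δ`, as a linear map. -/
def inclusionLin {γ δ : ℝ} (h : γ ≤ δ) : S.V δ →ₗ[ℝ] S.V γ where
  toFun v := S.mkV (S.val v) (S.domain_anti h (S.val_mem v))
  map_add' v w := S.val_injective (by
    rw [map_add S.val (S.mkV _ _), val_mkV, val_mkV, val_mkV, map_add])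
  map_smul' c v := S.val_injective (by
    rw [RingHom.id_apply, map_smul S.val c (S.mkV _ _), val_mkV, val_mkV, map_smul])

theorem val_inclusionLin {γ δ : ℝ} (h : γ ≤ δ) (v : S.V δ) :
    S.val (S.inclusionLin h v) = S.val v := S.val_mkV _ _

/-- The continuous inclusion `V_δ ⊆ V_γ` for `γ ≤ δ`. -/
def inclusion {γ δ : ℝ} (h : γ ≤ δ) : S.V δ →L[ℝ] S.V γ :=
  LinearMap.mkContinuous (S.inclusionLin h)
    (S.m 0 ^ (γ - δ)) (by
      intro v
      rw [norm_def, norm_def]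
      refine S.norm_le_of_inner_le (Real.rpow_nonneg S.m_pos.le _) (fun j => ?_)
      rw [inner_fracPow, inner_fracPow, val_inclusionLin, abs_mul, abs_mul, ← mul_assoc,
        abs_of_pos (Real.rpow_pos_of_pos (S.m_pos_all j) _),
        abs_of_pos (Real.rpow_pos_of_pos (S.m_pos_all j) _)]
      exact mul_le_mul_of_nonneg_right (S.rpow_le h j) (abs_nonneg _))

theorem val_inclusion {γ δ : ℝ} (h : γ ≤ δ) (v : S.V δ) : S.val (S.inclusion h v) = S.val v :=
  S.val_inclusionLin h v

/-- The continuous inclusion `V_γ ⊆ L²(D)` for `0 ≤ γ`. -/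
def toL2 {γ : ℝ} (h : 0 ≤ γ) : S.V γ →L[ℝ] L2 D :=
  LinearMap.mkContinuous S.val (S.m 0 ^ (0 - γ)) (by
    intro v
    rw [norm_def]
    refine S.norm_le_of_inner_le (Real.rpow_nonneg S.m_pos.le _) (fun j => ?_)
    rw [inner_fracPow, abs_mul, ← mul_assoc,
      abs_of_pos (Real.rpow_pos_of_pos (S.m_pos_all j) _)]
    have := S.rpow_le h j
    rw [Real.rpow_zero] at this
    exact le_mul_of_one_le_left (abs_nonneg _) this)

/-- The embedding `L²(D) → V_{-γ}`, given by `(g, v)_{-γ, γ} = (g, v)`. -/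
def embed {γ : ℝ} (h : 0 ≤ γ) (g : L2 D) : S.VDual γ := (innerSL ℝ g).comp (S.toL2 h)

theorem embed_apply {γ : ℝ} (h : 0 ≤ γ) (g : L2 D) (v : S.V γ) :
    S.embed h g v = ⟪g, S.val v⟫_ℝ := rfl

/-- The embedding `V_{-γ} → V_{-δ}` for `γ ≤ δ`. -/
def restrict {γ δ : ℝ} (h : γ ≤ δ) (f : S.VDual γ) : S.VDual δ := f.comp (S.inclusion h)

end EigenSystem

/-! ### Spaces of functions of time and the Caputo derivative -/

/-- Lebesgue measure on `(0, T)`. -/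
def timeMeasure (T : ℝ) : Measure ℝ := volume.restrict (Ioo 0 T)

/-- The norm `sup_{0 < t ≤ T} t ^ ρ ‖v t‖`, as an extended nonnegative number. -/
def weightedSup {X : Type*} [NormedAddCommGroup X] (ρ T : ℝ) (v : ℝ → X) : ℝ≥0∞ :=
  ⨆ t ∈ Ioc (0 : ℝ) T, ENNReal.ofReal (t ^ ρ) * ‖v t‖ₑ

/-- `v ∈ C^ρ((0, T]; X)`: `v` is continuous on `(0, T]` and `sup t ^ ρ ‖v t‖ < ∞`. -/
def MemWeightedC {X : Type*} [NormedAddCommGroup X] (ρ T : ℝ) (v : ℝ → X) : Prop :=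
  ContinuousOn v (Ioc 0 T) ∧ weightedSup ρ T v < ∞

/-- `v ∈ C^θ([0, T]; X)`: `v` is Hölder continuous on `[0, T]` with exponent `θ`. -/
def MemHolder {X : Type*} [NormedAddCommGroup X] (θ T : ℝ) (v : ℝ → X) : Prop :=
  ContinuousOn v (Icc 0 T) ∧ ∃ K : ℝ, ∀ t₁ t₂, 0 ≤ t₁ → t₁ < t₂ → t₂ ≤ T →
    ‖v t₂ - v t₁‖ ≤ K * (t₂ - t₁) ^ θ

/-- The fractional integral `(g_a ⋆ v)(t)`, where `g_a(t) = t ^ (a - 1) / Γ(a)`. -/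
def fracIntegral {X : Type*} [NormedAddCommGroup X] [NormedSpace ℝ X] (a : ℝ) (v : ℝ → X)
    (t : ℝ) : X :=
  (Real.Gamma a)⁻¹ • ∫ τ in (0 : ℝ)..t, (t - τ) ^ (a - 1) • v τ

/-- `w` is the Caputo derivative of order `α` on `(0, T)` of `v ∈ C([0, T]; X)`. The time
derivative is weak and the order of the operations is the usual one for functions which are not
absolutely continuous: `w = D_t I^(1 - α) (v - v(0))`, that is, `I^(1 - α) (v - v(0))` is
the primitive of the integrable function `w`. It is `I^(1 - α) D_t v` if `v` is absolutely
continuous. -/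
def HasCaputoDeriv {X : Type*} [NormedAddCommGroup X] [NormedSpace ℝ X] (α T : ℝ)
    (v w : ℝ → X) : Prop :=
  ContinuousOn v (Icc 0 T) ∧ Integrable w (timeMeasure T) ∧
    ∀ t ∈ Icc (0 : ℝ) T, fracIntegral (1 - α) (fun τ => v τ - v 0) t = ∫ τ in (0 : ℝ)..t, w τ

/-- The Mittag-Leffler function `E_{a,b}` on the real line, `∑ z ^ n / Γ(a n + b)`, `n ≥ 0`. -/
def mittagLeffler (a b z : ℝ) : ℝ := ∑' n : ℕ, z ^ n / Real.Gamma (a * n + b)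

namespace EigenSystem

variable {k : ℕ} {D : TopologicalSpace.Opens (Euc k)} {L : EllipticOperator D}
  {bc : BoundaryCondition} (S : EigenSystem L bc)

/-- `u ∈ L^P(0, T; V_γ)` for a function `u` with values in `L²(D)`. -/
def MemLpV (γ P T : ℝ) (u : ℝ → L2 D) : Prop :=
  ∃ w : ℝ → S.V γ, MemLp w (ENNReal.ofReal P) (timeMeasure T) ∧
    ∀ᵐ t ∂timeMeasure T, S.val (w t) = u t

/-- `u ∈ C^θ([0, T]; V_{-δ})` for a function `u` on `(0, T]` with values in `L²(D)`; the value at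
time `0` is the limit in `V_{-δ}`. -/
def MemHolderDual (δ θ T : ℝ) (u : ℝ → L2 D) : Prop :=
  ∃ (hδ : 0 ≤ δ) (U : ℝ → S.VDual δ),
    (∀ t ∈ Ioc 0 T, U t = S.embed hδ (u t)) ∧ MemHolder θ T U

/-- `W : (0, T) → V_{-γ}` is the Caputo derivative of order `α` of `u : (0, T] → L²(D)`, where `u`
extends to a continuous function from `[0, T]` to the larger space `V_{-δ}`, `γ ≤ δ`. -/
def IsCaputoDeriv (α T δ : ℝ) {γ : ℝ} (u : ℝ → L2 D) (W : ℝ → S.VDual γ) : Prop :=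
  ∃ (hδ : 0 ≤ δ) (hγδ : γ ≤ δ) (U : ℝ → S.VDual δ),
    (∀ t ∈ Ioc 0 T, U t = S.embed hδ (u t)) ∧
      HasCaputoDeriv α T U (fun t => S.restrict hγδ (W t))

/-- `G : (0, T] → V_{-γ}` is a representative of `F : (0, T) → L²(D)`. -/
def Represents (T : ℝ) {γ : ℝ} (F : ℝ → L2 D) (G : ℝ → S.VDual γ) : Prop :=
  ∃ hγ : 0 ≤ γ, ∀ᵐ t ∂timeMeasure T, G t = S.embed hγ (F t)

/-- `W₂ : (0, T] → V_{-δ}` is a representative of `W : (0, T) → V_{-γ}`, `γ ≤ δ`. -/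
def RepresentsDual (T : ℝ) {γ δ : ℝ} (W : ℝ → S.VDual γ) (W₂ : ℝ → S.VDual δ) : Prop :=
  ∃ hγδ : γ ≤ δ, ∀ᵐ t ∂timeMeasure T, W₂ t = S.restrict hγδ (W t)

/-! ### Mild solutions -/

/-- `E_{α,1}(-m_j ^ β t ^ α)`. -/
def relax (α β : ℝ) (j : ℕ) (t : ℝ) : ℝ := mittagLeffler α 1 (-(S.m j ^ β * t ^ α))

/-- `t ^ (α - 1) E_{α,α}(-m_j ^ β t ^ α)`. -/
def kernel (α β : ℝ) (j : ℕ) (t : ℝ) : ℝ :=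
  t ^ (α - 1) * mittagLeffler α α (-(S.m j ^ β * t ^ α))

/-- `w = O₁(t) F`: the coefficients of `w` are the convolutions of `(F, e_j)` with the kernels. -/
def IsO1 (α β : ℝ) (F : ℝ → L2 D) (t : ℝ) (w : L2 D) : Prop :=
  (∀ j, IntervalIntegrable (fun τ => ⟪S.e j, F τ⟫_ℝ * S.kernel α β j (t - τ)) volume 0 t) ∧
    HasSum (fun j => (∫ τ in (0 : ℝ)..t, ⟪S.e j, F τ⟫_ℝ * S.kernel α β j (t - τ)) • S.e j) w

/-- `w = O₂(t) v`. -/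
def IsO2 (α β T : ℝ) (v : L2 D) (t : ℝ) (w : L2 D) : Prop :=
  HasSum (fun j => (⟪S.e j, v⟫_ℝ * (S.relax α β j t / S.relax α β j T)) • S.e j) w

/-- `x = O₁(t) F + O₂(t) φ + O₃(t) F`, where `O₃(t) = - O₂(t) O₁(T)`. -/
def MildFormula (α β T : ℝ) (φ : L2 D) (F : ℝ → L2 D) (t : ℝ) (x : L2 D) : Prop :=
  ∃ w₁ w₂ w₃ z : L2 D, S.IsO1 α β F t w₁ ∧ S.IsO2 α β T φ t w₂ ∧
    S.IsO1 α β F T z ∧ S.IsO2 α β T z t w₃ ∧ x = w₁ + w₂ - w₃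

/-- `u` is a mild solution: it belongs to `L^a(0, T; L^b(D))` for some `a, b ≥ 1` and satisfies the
mild formula at almost every time. -/
def IsMildSolution (α β T : ℝ) (φ : L2 D) (F u : ℝ → L2 D) : Prop :=
  (∃ (a b : ℝ≥0∞) (_ : 1 ≤ a) (_ : Fact (1 ≤ b))
      (w : ℝ → Lp ℝ b ((volume : Measure (Euc k)).restrict (D : Set (Euc k)))),
      MemLp w a (timeMeasure T) ∧ ∀ᵐ t ∂timeMeasure T,
        (w t : Euc k → ℝ) =ᵐ[volume.restrict (D : Set (Euc k))] (u t : Euc k → ℝ)) ∧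
    ∀ᵐ t ∂timeMeasure T, S.MildFormula α β T φ F t (u t)

/-- `u` is a mild solution with final value `φ`, unique up to equality almost everywhere. -/
def IsUniqueMildSolution (α β T : ℝ) (φ : L2 D) (F u : ℝ → L2 D) : Prop :=
  S.IsMildSolution α β T φ F u ∧ u T = φ ∧
    ∀ v : ℝ → L2 D, S.IsMildSolution α β T φ F v → v =ᵐ[timeMeasure T] u

end EigenSystem

end FinalValue

end

open FinalValue

/-! In the eigenbasis the problem decouples. With λ_j = m_j^β, let R_j(t) = E_{α,1}(-λ_j t^α) be the
relaxation function and k_j(t) = t^(α-1) E_{α,α}(-λ_j t^α) the resolvent kernel. The solution has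
coefficients u_j(t) = (k_j * F_j)(t) + (R_j(t)/R_j(T)) (φ_j - (k_j * F_j)(T)). The mild formula
fixes these coefficients, so uniqueness is immediate, and everything else is an estimate uniform in
j.

Three scalar bounds carry the proof. The kernel satisfies λ^θ k(t) ≤ C t^(α(1-θ)-1) for 0 ≤ θ ≤ 1
(`rpow_mul_resolvent_le`); with Hölder's inequality in time this bounds the source part, for F in
L^P with 1/P < αq - s, with weight λ^(p+s/α). The relaxation function satisfies λ^σ R(t) ≤ C t^(-ασ)
for 0 ≤ σ ≤ 1 (`rpow_mul_relaxation_le`). Finally 1/R(T) ≤ Cλ (`inv_relaxation_le`): going back from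
time T costs exactly one power of 𝓛^β. Hence u(t) with weight λ^θ is bounded by t^(-ασ) whenever θ +
1 - σ ≤ p + q̂ (`exists_norm_solCoef_le`), and most of the asserted bounds are choices of the pair
(θ, σ). Hölder continuity uses instead |R(t₂) - R(t₁)| ≤ C λ^(s/α) (t₂ - t₁)^s and the Volterra
equation of the source part.

The facts about R and k come from their power series, through g_a * g_b = g_{a+b} for g_a(t) =
t^(a-1)/Γ(a). Convolving termwise gives g_{1-α} * k = R, λ(1 * k) = 1 - R and λ(g_α * k) = g_α - k.
Positivity follows from identities expressing tR(t) and tk(t) as convolutions of R and k with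
nonnegative constants, by looking at a first zero. Monotonicity and both sides of the decay estimate
then result from comparing integrals.

The same identities show, coefficient by coefficient, that I^(1-α)(u - u(0)) is the primitive of F -
𝓛^β u (`fracIntegral_solCoef`), so the Caputo derivative is F - 𝓛^β u. In V_{-β(q-q̂)} the term 𝓛^β
u is u with weight λ^(p+q̂), which leaves no room (σ = 1): it is of size t^(-α), hence in L^Q for αQ
< 1. In V_{-βq} the weight is λ^p, and the same singularity t^(-α) together with continuity gives
part (b). -/

namespace FinalValue

/-! ### Riemann–Liouville kernels and their convolutions -/

/-- The kernel `t ^ (a - 1) / Γ(a)` of the Riemann–Liouville integral of order `a`. -/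
noncomputable def rl (a t : ℝ) : ℝ := t ^ (a - 1) / Real.Gamma a

theorem rl_pos {a t : ℝ} (ha : 0 < a) (ht : 0 < t) : 0 < rl a t :=
  div_pos (Real.rpow_pos_of_pos ht _) (Real.Gamma_pos_of_pos ha)

theorem rl_nonneg {a t : ℝ} (ha : 0 < a) (ht : 0 ≤ t) : 0 ≤ rl a t :=
  div_nonneg (Real.rpow_nonneg ht _) (Real.Gamma_pos_of_pos ha).le

theorem rl_one (t : ℝ) : rl 1 t = 1 := by simp [rl]

theorem mul_rl {a t : ℝ} (ha : 0 < a) (ht : 0 < t) : t * rl a t = a * rl (a + 1) t := by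
  have h1 : Real.Gamma a ≠ 0 := (Real.Gamma_pos_of_pos ha).ne'
  rw [rl, rl, Real.Gamma_add_one ha.ne', add_sub_cancel_right, Real.rpow_sub_one ht.ne']
  field_simp

theorem integrableOn_rl {a t : ℝ} (ha : 0 < a) (ht : 0 ≤ t) :
    IntegrableOn (rl a) (Ioc 0 t) :=
  (intervalIntegrable_iff_integrableOn_Ioc_of_le ht).1
    ((intervalIntegral.intervalIntegrable_rpow' (by linarith)).div_const _)

theorem integral_rl {a t : ℝ} (ha : 0 < a) :
    ∫ τ in (0 : ℝ)..t, rl a τ = rl (a + 1) t := by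
  have h1 : Real.Gamma a ≠ 0 := (Real.Gamma_pos_of_pos ha).ne'
  simp only [rl]
  rw [intervalIntegral.integral_div, integral_rpow (Or.inl (by linarith)), sub_add_cancel,
    Real.zero_rpow ha.ne', Real.Gamma_add_one ha.ne', add_sub_cancel_right, sub_zero]
  field_simp

/-- This is the scaled Beta integral, transported from its complex version; both bases are
nonnegative on the interval, so complex and real powers agree. -/
theorem integral_rpow_mul_rpow {a b t : ℝ} (ha : 0 < a) (hb : 0 < b) (ht : 0 < t) :
    ∫ τ in (0 : ℝ)..t, (t - τ) ^ (a - 1) * τ ^ (b - 1) =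
      t ^ (a + b - 1) * (Real.Gamma a * Real.Gamma b / Real.Gamma (a + b)) := by
  have h1 := Complex.betaIntegral_scaled b a ht
  rw [Complex.betaIntegral_eq_Gamma_mul_div _ _ (by simpa) (by simpa)] at h1
  have h2 : ∫ x in (0 : ℝ)..t, (x : ℂ) ^ ((b : ℂ) - 1) * ((t : ℂ) - x) ^ ((a : ℂ) - 1) =
      ((∫ τ in (0 : ℝ)..t, (t - τ) ^ (a - 1) * τ ^ (b - 1) : ℝ) : ℂ) := by
    rw [← intervalIntegral.integral_ofReal]
    refine intervalIntegral.integral_congr fun x hx => ?_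
    rw [uIcc_of_le ht.le] at hx
    have h3 : 0 ≤ t - x := by linarith [hx.2]
    push_cast [Complex.ofReal_cpow hx.1, Complex.ofReal_cpow h3]
    ring
  rw [h2] at h1
  have h4 : ((t : ℂ) ^ ((b : ℂ) + a - 1)) = ((t ^ (a + b - 1) : ℝ) : ℂ) := by
    rw [Complex.ofReal_cpow ht.le]
    push_cast
    ring_nf
  rw [h4, ← Complex.ofReal_add, Complex.Gamma_ofReal, Complex.Gamma_ofReal,
    Complex.Gamma_ofReal] at h1
  have h5 : (∫ τ in (0 : ℝ)..t, (t - τ) ^ (a - 1) * τ ^ (b - 1)) =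
      t ^ (a + b - 1) * (Real.Gamma b * Real.Gamma a / Real.Gamma (b + a)) := by
    exact_mod_cast h1
  rw [h5, add_comm b a]
  ring

theorem integral_rl_mul_rl {a b t : ℝ} (ha : 0 < a) (hb : 0 < b) (ht : 0 < t) :
    ∫ τ in (0 : ℝ)..t, rl a (t - τ) * rl b τ = rl (a + b) t := by
  have h1 : Real.Gamma a ≠ 0 := (Real.Gamma_pos_of_pos ha).ne'
  have h2 : Real.Gamma b ≠ 0 := (Real.Gamma_pos_of_pos hb).ne'
  have h3 : Real.Gamma (a + b) ≠ 0 := (Real.Gamma_pos_of_pos (by positivity)).ne'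
  have h4 : ∀ τ, rl a (t - τ) * rl b τ =
      (t - τ) ^ (a - 1) * τ ^ (b - 1) * (Real.Gamma a * Real.Gamma b)⁻¹ := by
    intro τ
    simp only [rl]
    field_simp
  simp_rw [h4]
  rw [intervalIntegral.integral_mul_const, integral_rpow_mul_rpow ha hb ht, rl]
  field_simp

/-- A non-integrable function has Bochner integral zero, whereas this integral is known to be
positive. -/
theorem integrable_rl_mul_rl {a b t : ℝ} (ha : 0 < a) (hb : 0 < b) (ht : 0 < t) :
    IntegrableOn (fun τ => rl a (t - τ) * rl b τ) (Ioc 0 t) := by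
  by_contra h
  have h1 := integral_rl_mul_rl ha hb ht
  rw [intervalIntegral.integral_of_le ht.le, integral_undef h] at h1
  exact (rl_pos (add_pos ha hb) ht).ne h1

/-- The convolution of two series of powers may be computed termwise. -/
theorem hasSum_convolution {ι κ : Type*} [Countable ι] [Countable κ] {c a : ι → ℝ} {d b : κ → ℝ}
    (ha : ∀ i, 0 < a i) (hb : ∀ j, 0 < b j) {t : ℝ} (ht : 0 < t) {f g : ℝ → ℝ}
    (hf : ∀ τ ∈ Ioo 0 t, HasSum (fun i => c i * rl (a i) τ) (f τ))
    (hg : ∀ τ ∈ Ioo 0 t, HasSum (fun j => d j * rl (b j) τ) (g τ))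
    (hs : Summable fun x : ι × κ => |c x.1 * d x.2| * rl (a x.1 + b x.2) t) :
    HasSum (fun x : ι × κ => c x.1 * d x.2 * rl (a x.1 + b x.2) t)
      (∫ τ in (0 : ℝ)..t, f (t - τ) * g τ) := by
  have key : ∀ x : ι × κ, ∀ τ, c x.1 * rl (a x.1) (t - τ) * (d x.2 * rl (b x.2) τ) =
      c x.1 * d x.2 * (rl (a x.1) (t - τ) * rl (b x.2) τ) := fun x τ => by ring
  -- Fubini for series: the kernels are nonnegative, so the integral of the norm of each term is
  -- again given by the semigroup law, and `hs` is exactly the summability needed.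
  have h1 := hasSum_integral_of_summable_integral_norm (μ := volume.restrict (Ioc 0 t))
    (F := fun x : ι × κ => fun τ => c x.1 * rl (a x.1) (t - τ) * (d x.2 * rl (b x.2) τ)) ?_ ?_
  · have h2 : ∫ τ in Ioc 0 t, ∑' x : ι × κ,
        c x.1 * rl (a x.1) (t - τ) * (d x.2 * rl (b x.2) τ) =
        ∫ τ in (0 : ℝ)..t, f (t - τ) * g τ := by
      rw [intervalIntegral.integral_of_le ht.le, integral_Ioc_eq_integral_Ioo,
        integral_Ioc_eq_integral_Ioo]
      refine setIntegral_congr_fun measurableSet_Ioo fun τ hτ => ?_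
      have h3 := hf (t - τ) ⟨by linarith [hτ.2], by linarith [hτ.1]⟩
      have h4 := hg τ hτ
      exact (h3.mul h4 (summable_mul_of_summable_norm h3.summable.norm h4.summable.norm)).tsum_eq
    rw [h2] at h1
    have h5 : (fun x : ι × κ => c x.1 * d x.2 * rl (a x.1 + b x.2) t) = fun x : ι × κ =>
        ∫ τ in Ioc 0 t, c x.1 * rl (a x.1) (t - τ) * (d x.2 * rl (b x.2) τ) := by
      funext x
      simp_rw [key]
      rw [integral_const_mul, ← intervalIntegral.integral_of_le ht.le,
        integral_rl_mul_rl (ha _) (hb _) ht]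
    rw [h5]
    exact h1
  · intro x
    refine Integrable.congr ?_ (.of_forall fun τ => (key x τ).symm)
    exact (integrable_rl_mul_rl (ha _) (hb _) ht).const_mul _
  · convert hs using 2 with x
    rw [← integral_rl_mul_rl (ha x.1) (hb x.2) ht, intervalIntegral.integral_of_le ht.le,
      ← integral_const_mul]
    refine setIntegral_congr_fun measurableSet_Ioc fun τ hτ => ?_
    simp only [key, norm_mul, Real.norm_eq_abs, abs_mul]
    rw [abs_of_nonneg (rl_nonneg (ha x.1) (by linarith [hτ.2] : 0 ≤ t - τ)),
      abs_of_nonneg (rl_nonneg (hb x.2) hτ.1.le)]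

/-! ### Growth of Γ and convergence of Mittag-Leffler series -/

/-- Only the part of the Gamma integral over (M, M+1] is kept. As M is free, Γ(an + b) outgrows
every geometric sequence. -/
theorem rpow_mul_exp_le_Gamma {M x : ℝ} (hM : 1 ≤ M) (hx : 1 ≤ x) :
    M ^ (x - 1) * Real.exp (-(M + 1)) ≤ Real.Gamma x := by
  rw [Real.Gamma_eq_integral (by linarith)]
  have hint := Real.GammaIntegral_convergent (s := x) (by linarith)
  have hsub : Ioc M (M + 1) ⊆ Ioi 0 := fun y hy => lt_trans (by linarith) hy.1
  calc M ^ (x - 1) * Real.exp (-(M + 1))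
      = ∫ _ in Ioc M (M + 1), M ^ (x - 1) * Real.exp (-(M + 1)) := by
        simp
    _ ≤ ∫ y in Ioc M (M + 1), Real.exp (-y) * y ^ (x - 1) := by
        refine setIntegral_mono_on (integrableOn_const (by simp)) (hint.mono_set hsub)
          measurableSet_Ioc fun y hy => ?_
        rw [mul_comm]
        have : 0 < M := by linarith
        exact mul_le_mul (Real.exp_le_exp.2 (by linarith [hy.2]))
          (Real.rpow_le_rpow this.le hy.1.le (by linarith)) (by positivity) (by positivity)
    _ ≤ _ := by
        refine setIntegral_mono_set hint ?_ (LE.le.eventuallyLE hsub)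
        refine (ae_restrict_mem measurableSet_Ioi).mono fun y hy => ?_
        have : (0 : ℝ) < y := hy
        simp only [Pi.zero_apply]
        positivity

/-- The Mittag-Leffler series, even with an additional linear factor, converges absolutely. -/
theorem summable_mul_pow_div_Gamma {a b : ℝ} (ha : 0 < a) (hb : 0 < b) {z : ℝ} (hz : 0 ≤ z) :
    Summable fun n : ℕ => ((n : ℝ) + 1) * z ^ n / Real.Gamma (a * n + b) := by
  -- M is taken so large that z/M^a < 1; the lower bound for Γ then compares the series with (n+1)
  -- r^n. The linear factor is carried because the convolution of two such series has n+1 equal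
  -- terms in degree n.
  obtain ⟨M, hM1, hM⟩ : ∃ M : ℝ, 1 ≤ M ∧ 2 * (z + 1) ≤ M ^ a := by
    have h1 := tendsto_rpow_atTop ha
    exact ((eventually_ge_atTop 1).and (h1.eventually_ge_atTop _)).exists
  have hM0 : 0 < M := by linarith
  set r := z / M ^ a with hr
  have hr0 : 0 ≤ r := by positivity
  have hr1 : r < 1 := by
    rw [hr, div_lt_one (by positivity)]
    linarith
  have hgeo : Summable fun n : ℕ => ((n : ℝ) + 1) * r ^ n := by
    have h2 := (summable_pow_mul_geometric_of_norm_lt_one 1 (r := r)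
      (by rwa [Real.norm_of_nonneg hr0])).add (summable_geometric_of_lt_one hr0 hr1)
    refine h2.congr fun n => ?_
    ring
  have hgeo2 := hgeo.mul_left (Real.exp (M + 1) * M ^ (1 - b))
  refine Summable.of_norm_bounded_eventually_nat hgeo2 ?_
  -- For these n one has an + b ≥ 1, the range where the lower bound for Γ is available.
  filter_upwards [eventually_ge_atTop (⌈1 / a⌉₊)] with n hn
  have hx : 1 ≤ a * n + b := by
    have h3 : 1 / a ≤ n := (Nat.le_ceil _).trans (by exact_mod_cast hn)
    rw [div_le_iff₀ ha] at h3
    nlinarith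
  have hG := rpow_mul_exp_le_Gamma hM1 hx
  have hG0 : 0 < Real.Gamma (a * n + b) := Real.Gamma_pos_of_pos (by linarith)
  rw [Real.norm_of_nonneg (by positivity), div_le_iff₀ hG0]
  have h5 : M ^ (a * n + b - 1) = (M ^ a) ^ n / M ^ (1 - b) := by
    rw [← Real.rpow_natCast, ← Real.rpow_mul hM0.le, ← Real.rpow_sub hM0]
    ring_nf
  have hMb : 0 < M ^ (1 - b) := by positivity
  have hMa : 0 < M ^ a := by positivity
  calc ((n : ℝ) + 1) * z ^ n
      = Real.exp (M + 1) * M ^ (1 - b) * (((n : ℝ) + 1) * r ^ n) *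
          (M ^ (a * n + b - 1) * Real.exp (-(M + 1))) := by
        rw [h5, hr, div_pow, Real.exp_neg]
        field_simp
    _ ≤ _ := by gcongr

theorem summable_pow_div_Gamma {a b : ℝ} (ha : 0 < a) (hb : 0 < b) (z : ℝ) :
    Summable fun n : ℕ => z ^ n / Real.Gamma (a * n + b) := by
  refine Summable.of_norm_bounded (summable_mul_pow_div_Gamma ha hb (abs_nonneg z)) fun n => ?_
  have hG0 : 0 < Real.Gamma (a * n + b) := Real.Gamma_pos_of_pos (by positivity)
  rw [norm_div, norm_pow, Real.norm_eq_abs, Real.norm_of_nonneg hG0.le]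
  gcongr
  have : (0 : ℝ) ≤ n := by positivity
  exact le_mul_of_one_le_left (by positivity) (by linarith)

theorem continuous_mittagLeffler {a b : ℝ} (ha : 0 < a) (hb : 0 < b) :
    Continuous (mittagLeffler a b) := by
  rw [continuous_iff_continuousAt]
  intro z
  have h : ContinuousOn (mittagLeffler a b) (Metric.ball 0 (|z| + 1)) := by
    refine continuousOn_tsum (u := fun n : ℕ => (|z| + 1) ^ n / Real.Gamma (a * n + b))
      (fun n => by fun_prop) (summable_pow_div_Gamma ha hb _) fun n y hy => ?_
    have hG0 : 0 < Real.Gamma (a * n + b) := Real.Gamma_pos_of_pos (by positivity)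
    rw [norm_div, norm_pow, Real.norm_of_nonneg hG0.le]
    rw [mem_ball_zero_iff] at hy
    gcongr
  exact h.continuousAt (Metric.isOpen_ball.mem_nhds (by simp))

theorem mittagLeffler_zero {a b : ℝ} : mittagLeffler a b 0 = (Real.Gamma b)⁻¹ := by
  rw [mittagLeffler, tsum_eq_single 0 (fun n hn => by simp [hn])]
  simp

/-! ### Relaxation function and resolvent kernel: convolution identities -/

/-- The relaxation function `E_{α,1}(-ℓ t ^ α)`. -/
noncomputable def relaxation (α l t : ℝ) : ℝ := mittagLeffler α 1 (-(l * t ^ α))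

/-- The kernel `t ^ (α - 1) E_{α,α}(-ℓ t ^ α)`. -/
noncomputable def resolvent (α l t : ℝ) : ℝ := t ^ (α - 1) * mittagLeffler α α (-(l * t ^ α))

section MittagLeffler

variable {α l t : ℝ}

theorem rl_mul_add (n : ℕ) (b : ℝ) (ht : 0 < t) :
    rl (α * n + b) t = t ^ (b - 1) * ((t ^ α) ^ n / Real.Gamma (α * n + b)) := by
  rw [rl, ← Real.rpow_natCast, ← Real.rpow_mul ht.le, ← mul_div_assoc, ← Real.rpow_add ht]
  ring_nf

theorem summable_mul_pow_mul_rl (hα : 0 < α) {b : ℝ} (hb : 0 < b) (hl : 0 ≤ l) (ht : 0 < t) :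
    Summable fun n : ℕ => ((n : ℝ) + 1) * l ^ n * rl (α * n + b) t := by
  refine ((summable_mul_pow_div_Gamma hα hb (z := l * t ^ α) (by positivity)).mul_left
    (t ^ (b - 1))).congr fun n => ?_
  rw [rl_mul_add n b ht, mul_pow]
  ring

theorem hasSum_pow_mul_rl (hα : 0 < α) {b : ℝ} (hb : 0 < b) (ht : 0 < t) :
    HasSum (fun n : ℕ => (-l) ^ n * rl (α * n + b) t)
      (t ^ (b - 1) * mittagLeffler α b (-(l * t ^ α))) := by
  refine ((summable_pow_div_Gamma hα hb (-(l * t ^ α))).hasSum.mul_left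
    (t ^ (b - 1))).congr_fun ?_
  intro n
  rw [rl_mul_add n b ht, ← neg_mul, mul_pow]
  ring

theorem hasSum_relaxation (hα : 0 < α) (ht : 0 < t) :
    HasSum (fun n : ℕ => (-l) ^ n * rl (α * n + 1) t) (relaxation α l t) := by
  simpa [relaxation] using hasSum_pow_mul_rl (l := l) hα one_pos ht

theorem hasSum_resolvent (hα : 0 < α) (ht : 0 < t) :
    HasSum (fun n : ℕ => (-l) ^ n * rl (α * n + α) t) (resolvent α l t) :=
  hasSum_pow_mul_rl hα hα ht

theorem continuous_relaxation (hα : 0 < α) : Continuous (relaxation α l) :=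
  (continuous_mittagLeffler hα one_pos).comp
    (continuous_const.mul (Real.continuous_rpow_const hα.le)).neg

theorem relaxation_zero (hα : 0 < α) : relaxation α l 0 = 1 := by
  simp [relaxation, Real.zero_rpow hα.ne', mittagLeffler_zero]

theorem continuous_mittagLeffler_rpow (hα : 0 < α) :
    Continuous fun t : ℝ => mittagLeffler α α (-(l * t ^ α)) :=
  (continuous_mittagLeffler hα hα).comp
    (continuous_const.mul (Real.continuous_rpow_const hα.le)).neg

theorem measurable_resolvent (hα : 0 < α) : Measurable (resolvent α l) :=
  (measurable_id.pow_const _).mul (continuous_mittagLeffler_rpow hα).measurable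

theorem intervalIntegrable_resolvent (hα : 0 < α) :
    IntervalIntegrable (resolvent α l) volume 0 t :=
  (intervalIntegral.intervalIntegrable_rpow' (by linarith)).mul_continuousOn
    (continuous_mittagLeffler_rpow hα).continuousOn

/-- Fractional integration of a Mittag-Leffler series. -/
theorem hasSum_integral_rl_mul (hα : 0 < α) (hl : 0 ≤ l) {b c : ℝ} (hb : 0 < b) (hc : 0 < c)
    (ht : 0 < t) {g : ℝ → ℝ}
    (hg : ∀ τ ∈ Ioo 0 t, HasSum (fun n : ℕ => (-l) ^ n * rl (α * n + b) τ) (g τ)) :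
    HasSum (fun n : ℕ => (-l) ^ n * rl (α * n + (b + c)) t)
      (∫ τ in (0 : ℝ)..t, rl c (t - τ) * g τ) := by
  -- A single power is treated as a series with one term, indexed by `Unit`.
  have h := hasSum_convolution (ι := Unit) (κ := ℕ) (c := fun _ => 1) (a := fun _ => c)
    (d := fun n => (-l) ^ n) (b := fun n => α * n + b) (fun _ => hc) (fun n => by positivity) ht
    (f := rl c) (fun τ _ => by simp) hg ?_
  · rw [← (Equiv.punitProd.{0} ℕ).symm.hasSum_iff] at h
    refine h.congr_fun fun n => ?_
    simp only [Function.comp_apply, Equiv.punitProd_symm_apply, one_mul]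
    ring_nf
  · rw [← (Equiv.punitProd.{0} ℕ).symm.summable_iff]
    refine (summable_mul_pow_mul_rl hα (by positivity : 0 < b + c) hl ht).of_nonneg_of_le
      (fun n => ?_) (fun n => ?_)
    · exact mul_nonneg (abs_nonneg _) (rl_nonneg (by positivity) ht.le)
    · simp only [Function.comp_apply, Equiv.punitProd_symm_apply, one_mul, abs_pow, abs_neg,
        abs_of_nonneg hl]
      rw [show c + (α * n + b) = α * n + (b + c) by ring]
      refine mul_le_mul_of_nonneg_right ?_ (rl_nonneg (by positivity) ht.le)
      exact le_mul_of_one_le_left (by positivity) (by linarith [Nat.cast_nonneg (α := ℝ) n])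

theorem integral_rl_mul_resolvent (hα : 0 < α) (hl : 0 ≤ l) {c : ℝ} (hc : 0 < c) (ht : 0 < t) :
    HasSum (fun n : ℕ => (-l) ^ n * rl (α * n + (α + c)) t)
      (∫ τ in (0 : ℝ)..t, rl c (t - τ) * resolvent α l τ) :=
  hasSum_integral_rl_mul hα hl hα hc ht fun _ hτ => hasSum_resolvent hα hτ.1

/-- The integral equation of the relaxation function. -/
theorem integral_rl_mul_relaxation (hα : 0 < α) (hl : 0 ≤ l) (ht : 0 < t) :
    l * ∫ τ in (0 : ℝ)..t, rl α (t - τ) * relaxation α l τ = 1 - relaxation α l t := by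
  have h1 := (hasSum_integral_rl_mul hα hl one_pos hα ht
    (fun τ hτ => hasSum_relaxation (l := l) hα hτ.1)).mul_left (-l)
  -- Multiplying the integrated series by -l raises its index by one, so it is the relaxation series
  -- without its term n = 0, which is 1. The next two identities use the same shift.
  have h2 := (hasSum_nat_add_iff' 1).2 (hasSum_relaxation (l := l) hα ht)
  have h3 := h1.unique (h2.congr_fun fun n => ?_)
  · simp [rl_one] at h3
    linarith
  · push_cast
    rw [pow_succ]
    ring_nf

/-- The resolvent equation `g_α * k = (g_α - k) / ℓ`. -/
theorem integral_rl_self_mul_resolvent (hα : 0 < α) (hl : 0 ≤ l) (ht : 0 < t) :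
    l * ∫ τ in (0 : ℝ)..t, rl α (t - τ) * resolvent α l τ = rl α t - resolvent α l t := by
  have h1 := (integral_rl_mul_resolvent hα hl hα ht).mul_left (-l)
  have h2 := (hasSum_nat_add_iff' 1).2 (hasSum_resolvent (l := l) hα ht)
  have h3 := h1.unique (h2.congr_fun fun n => ?_)
  · simp at h3
    linarith
  · push_cast
    rw [pow_succ]
    ring_nf

/-- The primitive of the kernel. -/
theorem mul_integral_resolvent (hα : 0 < α) (hl : 0 ≤ l) (ht : 0 ≤ t) :
    l * ∫ τ in (0 : ℝ)..t, resolvent α l τ = 1 - relaxation α l t := by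
  rcases ht.eq_or_lt with rfl | ht
  · simp [relaxation_zero hα]
  have h1 := (integral_rl_mul_resolvent hα hl one_pos ht).mul_left (-l)
  have h2 := (hasSum_nat_add_iff' 1).2 (hasSum_relaxation (l := l) hα ht)
  have h3 := h1.unique (h2.congr_fun fun n => ?_)
  · simp [rl_one] at h3
    linarith
  · push_cast
    rw [pow_succ]
    ring_nf

/-- The fractional integral of order `1 - α` of the kernel. -/
theorem integral_rl_one_sub_mul_resolvent (hα : 0 < α) (hα' : α < 1) (hl : 0 ≤ l) (ht : 0 < t) :
    ∫ τ in (0 : ℝ)..t, rl (1 - α) (t - τ) * resolvent α l τ = relaxation α l t := by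
  have h1 := integral_rl_mul_resolvent hα hl (sub_pos.2 hα') ht
  rw [add_sub_cancel] at h1
  exact h1.unique (hasSum_relaxation hα ht)

/-- Convolution of the relaxation function with a function of the same type. -/
theorem integral_relaxation_mul (hα : 0 < α) (hl : 0 ≤ l) {b : ℝ} (hb : 0 < b) (ht : 0 < t)
    {g : ℝ → ℝ} (hg : ∀ τ ∈ Ioo 0 t, HasSum (fun n : ℕ => (-l) ^ n * rl (α * n + b) τ) (g τ)) :
    HasSum (fun n : ℕ => ((n : ℝ) + 1) * ((-l) ^ n * rl (α * n + (b + 1)) t))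
      (∫ τ in (0 : ℝ)..t, relaxation α l (t - τ) * g τ) := by
  have key : ∀ (n : ℕ) (x : ℕ × ℕ), x ∈ Finset.HasAntidiagonal.antidiagonal n →
      α * x.1 + 1 + (α * x.2 + b) = α * n + (b + 1) := by
    intro n x hx
    rw [← Finset.HasAntidiagonal.mem_antidiagonal.1 hx]
    push_cast
    ring
  have h := hasSum_convolution (ι := ℕ) (κ := ℕ) (c := fun n => (-l) ^ n)
    (a := fun n => α * n + 1) (d := fun n => (-l) ^ n) (b := fun n => α * n + b)
    (fun _ => by positivity) (fun n => by positivity) ht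
    (fun τ hτ => hasSum_relaxation hα hτ.1) hg ?_
  · rw [← Finset.HasAntidiagonal.sigmaAntidiagonalEquivProd.hasSum_iff] at h
    refine (h.sigma fun n => hasSum_fintype _).congr_fun fun n => ?_
    rw [Finset.univ_eq_attach]
    refine Eq.trans ?_ (Finset.sum_attach (Finset.HasAntidiagonal.antidiagonal n)
      (fun x : ℕ × ℕ => (-l) ^ x.1 * (-l) ^ x.2 * rl (α * x.1 + 1 + (α * x.2 + b)) t)).symm
    rw [Finset.sum_congr rfl (g := fun _ => (-l) ^ n * rl (α * n + (b + 1)) t)]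
    · simp
    · intro x hx
      rw [key n x hx, ← pow_add, Finset.HasAntidiagonal.mem_antidiagonal.1 hx]
  · rw [← Finset.HasAntidiagonal.sigmaAntidiagonalEquivProd.summable_iff]
    refine (summable_sigma_of_nonneg fun x => ?_).2 ⟨fun n => (hasSum_fintype _).summable, ?_⟩
    · exact mul_nonneg (abs_nonneg _) (rl_nonneg (by positivity) ht.le)
    refine (summable_mul_pow_mul_rl hα (by positivity : 0 < b + 1) hl ht).congr fun n => ?_
    rw [tsum_fintype, Finset.univ_eq_attach]
    refine Eq.trans ?_ (Finset.sum_attach (Finset.HasAntidiagonal.antidiagonal n)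
      (fun x : ℕ × ℕ => |(-l) ^ x.1 * (-l) ^ x.2| * rl (α * x.1 + 1 + (α * x.2 + b)) t)).symm
    rw [Finset.sum_congr rfl (g := fun _ => l ^ n * rl (α * n + (b + 1)) t)]
    · simp
      ring
    · intro x hx
      rw [key n x hx, ← pow_add, Finset.HasAntidiagonal.mem_antidiagonal.1 hx, abs_pow,
        abs_neg, abs_of_nonneg hl]

/-- Multiplication by t turns g_{αn+1} into (αn+1) g_{αn+2}, and αn+1 = (1-α) + α(n+1): the first
summand is the convolution of R with 1, the second that of R with itself. For α ≤ 1 the coefficients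
are nonnegative, so R(t) is expressed by earlier values with nonnegative weights; this is what
yields positivity. -/
theorem mul_relaxation_eq (hα : 0 < α) (hl : 0 ≤ l) (ht : 0 < t) :
    t * relaxation α l t =
      ∫ τ in (0 : ℝ)..t, ((1 - α) + α * relaxation α l (t - τ)) * relaxation α l τ := by
  have h0 : IntervalIntegrable (fun τ => relaxation α l τ) volume 0 t :=
    (continuous_relaxation hα).intervalIntegrable _ _
  have h1 := integral_relaxation_mul hα hl one_pos ht
    (fun τ hτ => hasSum_relaxation (l := l) hα hτ.1)
  have h2 := hasSum_integral_rl_mul hα hl one_pos one_pos ht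
    (fun τ hτ => hasSum_relaxation (l := l) hα hτ.1)
  have h3 := (h2.mul_left (1 - α)).add (h1.mul_left α)
  have h4 := (hasSum_relaxation (l := l) hα ht).mul_left t
  have h5 := h4.unique (h3.congr_fun fun n => ?_)
  · rw [h5]
    simp only [rl_one, one_mul]
    rw [← intervalIntegral.integral_const_mul, ← intervalIntegral.integral_const_mul,
      ← intervalIntegral.integral_add (h0.const_mul _)]
    · congr 1
      funext τ
      ring
    · refine Continuous.intervalIntegrable ?_ _ _
      have := continuous_relaxation (l := l) hα
      fun_prop
  · have h6 := mul_rl (a := α * n + 1) (t := t) (by positivity) ht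
    rw [show α * n + ((1 : ℝ) + 1) = α * n + 1 + 1 by ring]
    linear_combination (-l) ^ n * h6

/-- Same mechanism; here the factor produced by t is α(n+1), so the convolution with R alone
suffices. -/
theorem mul_resolvent_eq (hα : 0 < α) (hl : 0 ≤ l) (ht : 0 < t) :
    t * resolvent α l t = α * ∫ τ in (0 : ℝ)..t, relaxation α l (t - τ) * resolvent α l τ := by
  have h1 := (integral_relaxation_mul hα hl hα ht
    (fun τ hτ => hasSum_resolvent (l := l) hα hτ.1)).mul_left α
  refine ((hasSum_resolvent (l := l) hα ht).mul_left t).unique (h1.congr_fun fun n => ?_)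
  have h6 := mul_rl (a := α * n + α) (t := t) (by positivity) ht
  rw [← add_assoc]
  linear_combination (-l) ^ n * h6

end MittagLeffler

/-! ### Positivity, monotonicity and decay of Mittag-Leffler functions -/

/-- The set where f ≤ 0 is closed in [0, ∞); if nonempty it has a least point, which is not 0 and
before which f is positive, contradicting `h`. -/
theorem pos_of_forall_first_zero {f : ℝ → ℝ} (hf : Continuous f) (h0 : 0 < f 0)
    (h : ∀ t, 0 < t → (∀ τ ∈ Ico 0 t, 0 < f τ) → 0 < f t) {t : ℝ} (ht : 0 ≤ t) : 0 < f t := by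
  by_contra hcon
  set Z : Set ℝ := {x | 0 ≤ x ∧ f x ≤ 0} with hZ
  have hclosed : IsClosed Z :=
    (isClosed_le continuous_const continuous_id).inter (isClosed_le hf continuous_const)
  have hne : Z.Nonempty := ⟨t, ht, not_lt.1 hcon⟩
  have hbdd : BddBelow Z := ⟨0, fun x hx => hx.1⟩
  have hmem := hclosed.csInf_mem hne hbdd
  have hpos : 0 < sInf Z := by
    rcases hmem.1.eq_or_lt with h1 | h1
    · have := hmem.2
      rw [← h1] at this
      linarith
    · exact h1
  have := h _ hpos fun τ hτ => by
    by_contra h2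
    exact absurd (csInf_le hbdd (⟨hτ.1, not_lt.1 h2⟩ : τ ∈ Z)) (not_le.2 hτ.2)
  linarith [hmem.2]

section MittagLefflerBounds

variable {α l t : ℝ}

/-- At a first zero t, the Volterra identity for tR(t) would give zero as the integral of a positive
function, since τ and t - τ both lie in (0, t). -/
theorem relaxation_pos (hα : 0 < α) (hα' : α ≤ 1) (hl : 0 ≤ l) (ht : 0 ≤ t) :
    0 < relaxation α l t := by
  refine pos_of_forall_first_zero (continuous_relaxation hα)
    (by rw [relaxation_zero hα]; exact one_pos) (fun t ht h => ?_) ht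
  have h1 := mul_relaxation_eq hα hl ht
  have h2 : 0 < ∫ τ in (0 : ℝ)..t,
      ((1 - α) + α * relaxation α l (t - τ)) * relaxation α l τ := by
    refine intervalIntegral.intervalIntegral_pos_of_pos_on ?_ (fun τ hτ => ?_) ht
    · refine Continuous.intervalIntegrable ?_ _ _
      have := continuous_relaxation (l := l) hα
      fun_prop
    · have h3 := h τ ⟨hτ.1.le, hτ.2⟩
      have h4 := h (t - τ) ⟨by linarith [hτ.2], by linarith [hτ.1]⟩
      have : 0 ≤ 1 - α := by linarith
      positivity
  rw [← h1] at h2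
  exact pos_of_mul_pos_right h2 ht.le

theorem resolvent_pos (hα : 0 < α) (hα' : α ≤ 1) (hl : 0 ≤ l) (ht : 0 < t) :
    0 < resolvent α l t := by
  refine mul_pos (Real.rpow_pos_of_pos ht _) ?_
  -- The factor t^(α-1) is singular at 0, so the first-zero argument is run on the continuous
  -- factor, whose value at 0 is 1/Γ(α).
  refine pos_of_forall_first_zero (f := fun t => mittagLeffler α α (-(l * t ^ α)))
    (continuous_mittagLeffler_rpow hα) ?_ (fun t ht h => ?_) ht.le
  · simp only [Real.zero_rpow hα.ne', mul_zero, neg_zero, mittagLeffler_zero]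
    exact inv_pos.2 (Real.Gamma_pos_of_pos hα)
  have h1 := mul_resolvent_eq hα hl ht
  have h2 : 0 < ∫ τ in (0 : ℝ)..t, relaxation α l (t - τ) * resolvent α l τ := by
    refine intervalIntegral.intervalIntegral_pos_of_pos_on ?_ (fun τ hτ => ?_) ht
    · refine (intervalIntegrable_resolvent hα).continuousOn_mul ?_
      have := continuous_relaxation (l := l) hα
      fun_prop
    · exact mul_pos (relaxation_pos hα hα' hl (by linarith [hτ.2]))
        (mul_pos (Real.rpow_pos_of_pos hτ.1 _) (h τ ⟨hτ.1.le, hτ.2⟩))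
  have h3 : 0 < t * resolvent α l t := by
    rw [h1]
    positivity
  exact pos_of_mul_pos_right (pos_of_mul_pos_right h3 ht.le) (Real.rpow_nonneg ht.le _)

theorem relaxation_sub {t₁ t₂ : ℝ} (hα : 0 < α) (hl : 0 ≤ l) (h₁ : 0 ≤ t₁) (h₂ : t₁ ≤ t₂) :
    relaxation α l t₁ - relaxation α l t₂ = l * ∫ τ in t₁..t₂, resolvent α l τ := by
  have e1 := mul_integral_resolvent hα hl h₁
  have e2 := mul_integral_resolvent hα hl (h₁.trans h₂)
  rw [← intervalIntegral.integral_interval_sub_left (intervalIntegrable_resolvent hα)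
    (intervalIntegrable_resolvent hα)]
  linarith

theorem relaxation_anti {t₁ t₂ : ℝ} (hα : 0 < α) (hα' : α ≤ 1) (hl : 0 ≤ l) (h₁ : 0 ≤ t₁)
    (h₂ : t₁ ≤ t₂) : relaxation α l t₂ ≤ relaxation α l t₁ := by
  rw [← sub_nonneg, relaxation_sub hα hl h₁ h₂]
  refine mul_nonneg hl ?_
  rw [intervalIntegral.integral_of_le h₂]
  exact setIntegral_nonneg measurableSet_Ioc fun τ hτ =>
    (resolvent_pos hα hα' hl (h₁.trans_lt hτ.1)).le

theorem relaxation_le_one (hα : 0 < α) (hα' : α ≤ 1) (hl : 0 ≤ l) (ht : 0 ≤ t) :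
    relaxation α l t ≤ 1 := by
  simpa [relaxation_zero hα] using relaxation_anti hα hα' hl le_rfl ht

theorem intervalIntegrable_rl_sub {a : ℝ} (ha : 0 < a) (ht : 0 ≤ t) :
    IntervalIntegrable (fun τ => rl a (t - τ)) volume 0 t := by
  have h := ((intervalIntegrable_iff_integrableOn_Ioc_of_le ht).2
    (integrableOn_rl ha ht)).comp_sub_left t
  simpa using h.symm

theorem integral_rl_sub {a : ℝ} (ha : 0 < a) :
    ∫ τ in (0 : ℝ)..t, rl a (t - τ) = rl (a + 1) t := by
  rw [intervalIntegral.integral_comp_sub_left (fun τ => rl a τ), sub_self, sub_zero,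
    integral_rl ha]

/-- In l (g_α * R) = 1 - R the function R is decreasing; replacing R(τ) by R(t) leaves l R(t)
t^α/Γ(α+1) ≤ 1. -/
theorem relaxation_mul_le (hα : 0 < α) (hα' : α ≤ 1) (hl : 0 ≤ l) (ht : 0 < t) :
    relaxation α l t * (l * t ^ α) ≤ Real.Gamma (α + 1) := by
  have h1 := integral_rl_mul_relaxation hα hl ht
  have h2 : ∫ τ in (0 : ℝ)..t, rl α (t - τ) * relaxation α l t ≤
      ∫ τ in (0 : ℝ)..t, rl α (t - τ) * relaxation α l τ := by
    refine intervalIntegral.integral_mono_on ht.le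
      ((intervalIntegrable_rl_sub hα ht.le).mul_const _)
      ((intervalIntegrable_rl_sub hα ht.le).mul_continuousOn
        (continuous_relaxation hα).continuousOn) fun τ hτ => ?_
    exact mul_le_mul_of_nonneg_left (relaxation_anti hα hα' hl hτ.1 hτ.2)
      (rl_nonneg hα (by linarith [hτ.2]))
  rw [intervalIntegral.integral_mul_const, integral_rl_sub hα] at h2
  have h3 := mul_le_mul_of_nonneg_left h2 hl
  rw [h1, rl, add_sub_cancel_right] at h3
  have h4 := relaxation_pos hα hα' hl ht.le
  have h5 : 0 < Real.Gamma (α + 1) := Real.Gamma_pos_of_pos (by linarith)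
  have h6 : relaxation α l t * (l * t ^ α) =
      l * (t ^ α / Real.Gamma (α + 1) * relaxation α l t) * Real.Gamma (α + 1) := by
    field_simp
  rw [h6]
  exact (mul_le_mul_of_nonneg_right h3 h5.le).trans (by nlinarith)

/-- The lower bound that controls the backward problem. In R = g_{1-α} * k the kernel g_{1-α} is
decreasing, so R(t) ≥ g_{1-α}(t) ∫k, and l∫k = 1 - R(t). -/
theorem one_le_relaxation_mul (hα : 0 < α) (hα' : α < 1) (hl : 0 ≤ l) (ht : 0 < t) :
    1 ≤ relaxation α l t * (1 + Real.Gamma (1 - α) * (l * t ^ α)) := by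
  have hα1 : 0 < 1 - α := by linarith
  have h1 := integral_rl_one_sub_mul_resolvent hα hα' hl ht
  have hR := relaxation_pos hα hα'.le hl ht.le
  have hint : IntervalIntegrable (fun τ => rl (1 - α) (t - τ) * resolvent α l τ) volume 0 t := by
    by_contra h
    rw [intervalIntegral.integral_undef h] at h1
    exact hR.ne h1
  have h2 : ∫ τ in (0 : ℝ)..t, rl (1 - α) t * resolvent α l τ ≤ relaxation α l t := by
    rw [← h1]
    refine intervalIntegral.integral_mono_on_of_le_Ioo ht.le
      ((intervalIntegrable_resolvent hα).const_mul _) hint fun τ hτ => ?_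
    refine mul_le_mul_of_nonneg_right ?_ (resolvent_pos hα hα'.le hl hτ.1).le
    refine div_le_div_of_nonneg_right ?_ (Real.Gamma_pos_of_pos hα1).le
    exact Real.rpow_le_rpow_of_nonpos (by linarith [hτ.2]) (by linarith [hτ.1]) (by linarith)
  rw [intervalIntegral.integral_const_mul] at h2
  have h3 := mul_integral_resolvent hα hl ht.le
  have h4 := mul_le_mul_of_nonneg_left h2 hl
  rw [mul_left_comm, h3, rl, sub_sub_cancel_left, Real.rpow_neg ht.le] at h4
  have hta : 0 < t ^ α := Real.rpow_pos_of_pos ht _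
  have hG := Real.Gamma_pos_of_pos hα1
  have h5 : 1 - relaxation α l t ≤ l * relaxation α l t * (Real.Gamma (1 - α) * t ^ α) := by
    rw [← div_le_iff₀ (by positivity)]
    refine le_trans (le_of_eq ?_) h4
    field_simp
  linarith

theorem resolvent_le_rl (hα : 0 < α) (hα' : α ≤ 1) (hl : 0 ≤ l) (ht : 0 < t) :
    resolvent α l t ≤ rl α t := by
  have h1 := integral_rl_self_mul_resolvent hα hl ht
  have h2 : 0 ≤ ∫ τ in (0 : ℝ)..t, rl α (t - τ) * resolvent α l τ := by
    rw [intervalIntegral.integral_of_le ht.le]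
    exact setIntegral_nonneg measurableSet_Ioc fun τ hτ => mul_nonneg
      (rl_nonneg hα (by linarith [hτ.2])) (resolvent_pos hα hα' hl hτ.1).le
  have := mul_nonneg hl h2
  linarith

/-- In t k = α (R * k) bound R by 1; then l∫k = 1 - R ≤ 1. -/
theorem mul_resolvent_le (hα : 0 < α) (hα' : α ≤ 1) (hl : 0 ≤ l) (ht : 0 < t) :
    l * resolvent α l t ≤ α / t := by
  have h1 := mul_resolvent_eq hα hl ht
  have h2 : ∫ τ in (0 : ℝ)..t, relaxation α l (t - τ) * resolvent α l τ ≤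
      ∫ τ in (0 : ℝ)..t, resolvent α l τ := by
    refine intervalIntegral.integral_mono_on_of_le_Ioo ht.le
      ((intervalIntegrable_resolvent hα).continuousOn_mul ?_) (intervalIntegrable_resolvent hα)
      fun τ hτ => ?_
    · have := continuous_relaxation (l := l) hα
      fun_prop
    · exact mul_le_of_le_one_left (resolvent_pos hα hα' hl hτ.1).le
        (relaxation_le_one hα hα' hl (by linarith [hτ.2]))
  have h3 := mul_integral_resolvent hα hl ht.le
  have h4 := relaxation_pos hα hα' hl ht.le
  rw [le_div_iff₀ ht]
  calc l * resolvent α l t * t = α * (l * ∫ τ in (0 : ℝ)..t,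
        relaxation α l (t - τ) * resolvent α l τ) := by
        rw [mul_assoc, mul_comm _ t, h1]
        ring
    _ ≤ α * (l * ∫ τ in (0 : ℝ)..t, resolvent α l τ) := by gcongr
    _ ≤ α * 1 := by
        rw [h3]
        gcongr
        linarith
    _ = α := mul_one α

/-- Interpolated decay of the kernel. -/
theorem rpow_mul_resolvent_le (hα : 0 < α) (hα' : α ≤ 1) (hl : 0 < l) (ht : 0 < t) {θ : ℝ}
    (h0 : 0 ≤ θ) (h1 : θ ≤ 1) :
    l ^ θ * resolvent α l t ≤ ((Real.Gamma α)⁻¹ + α) * t ^ (α * (1 - θ) - 1) := by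
  have hk := resolvent_pos hα hα' hl.le ht
  have hG := Real.Gamma_pos_of_pos hα
  have e1 : l ^ θ * resolvent α l t = resolvent α l t ^ (1 - θ) * (l * resolvent α l t) ^ θ := by
    rw [Real.mul_rpow hl.le hk.le, mul_left_comm, ← Real.rpow_add hk, sub_add_cancel,
      Real.rpow_one]
  rw [e1]
  set C := (Real.Gamma α)⁻¹ + α with hC
  have hC0 : 0 < C := by positivity
  have b1 : resolvent α l t ≤ C * t ^ (α - 1) := by
    refine (resolvent_le_rl hα hα' hl.le ht).trans ?_
    rw [rl, div_eq_inv_mul]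
    gcongr
    linarith
  have b2 : l * resolvent α l t ≤ C * t ^ (-1 : ℝ) := by
    refine (mul_resolvent_le hα hα' hl.le ht).trans ?_
    rw [Real.rpow_neg_one, div_eq_mul_inv]
    gcongr
    linarith [inv_pos.2 hG]
  calc resolvent α l t ^ (1 - θ) * (l * resolvent α l t) ^ θ
      ≤ (C * t ^ (α - 1)) ^ (1 - θ) * (C * t ^ (-1 : ℝ)) ^ θ := by
        have : 0 ≤ 1 - θ := by linarith
        gcongr
    _ = C * t ^ (α * (1 - θ) - 1) := by
        rw [Real.mul_rpow hC0.le (by positivity), Real.mul_rpow hC0.le (by positivity),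
          mul_mul_mul_comm, ← Real.rpow_add hC0, sub_add_cancel, Real.rpow_one,
          ← Real.rpow_mul ht.le, ← Real.rpow_mul ht.le, ← Real.rpow_add ht]
        ring_nf

/-- Interpolated decay of the relaxation function. -/
theorem rpow_mul_relaxation_le (hα : 0 < α) (hα' : α ≤ 1) (hl : 0 < l) (ht : 0 < t) {σ : ℝ}
    (h0 : 0 ≤ σ) (h1 : σ ≤ 1) :
    l ^ σ * relaxation α l t ≤ (1 + Real.Gamma (α + 1)) * t ^ (-(α * σ)) := by
  have hR := relaxation_pos hα hα' hl.le ht.le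
  have hR1 := relaxation_le_one hα hα' hl.le ht.le
  have hG : 0 < Real.Gamma (α + 1) := Real.Gamma_pos_of_pos (by linarith)
  have hb : l * relaxation α l t ≤ (1 + Real.Gamma (α + 1)) * t ^ (-α) := by
    have := relaxation_mul_le hα hα' hl.le ht
    have hta : 0 < t ^ α := Real.rpow_pos_of_pos ht _
    rw [Real.rpow_neg ht.le, ← div_eq_mul_inv, le_div_iff₀ hta]
    linarith
  have e1 : l ^ σ * relaxation α l t =
      relaxation α l t ^ (1 - σ) * (l * relaxation α l t) ^ σ := by
    rw [Real.mul_rpow hl.le hR.le, mul_left_comm, ← Real.rpow_add hR, sub_add_cancel,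
      Real.rpow_one]
  rw [e1]
  calc relaxation α l t ^ (1 - σ) * (l * relaxation α l t) ^ σ
      ≤ 1 * ((1 + Real.Gamma (α + 1)) * t ^ (-α)) ^ σ := by
        gcongr
        exact Real.rpow_le_one hR.le hR1 (by linarith)
    _ = (1 + Real.Gamma (α + 1)) ^ σ * t ^ (-(α * σ)) := by
        rw [one_mul, Real.mul_rpow (by positivity) (by positivity), ← Real.rpow_mul ht.le]
        ring_nf
    _ ≤ (1 + Real.Gamma (α + 1)) ^ (1 : ℝ) * t ^ (-(α * σ)) := by
        gcongr
        linarith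
    _ = _ := by rw [Real.rpow_one]

/-- Inverting the evolution up to the final time costs one power of the eigenvalue. The hypothesis
l₀ ≤ l lets the additive constant 1 be absorbed into a multiple of l. -/
theorem inv_relaxation_le (hα : 0 < α) (hα' : α < 1) {l₀ T : ℝ} (hl₀ : 0 < l₀) (hl : l₀ ≤ l)
    (hT : 0 < T) : (relaxation α l T)⁻¹ ≤ (l₀⁻¹ + Real.Gamma (1 - α) * T ^ α) * l := by
  have hl' : 0 < l := hl₀.trans_le hl
  have hR := relaxation_pos hα hα'.le hl'.le hT.le
  have h1 := one_le_relaxation_mul hα hα' hl'.le hT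
  rw [inv_le_iff_one_le_mul₀ hR]
  refine h1.trans ?_
  rw [mul_comm _ (relaxation α l T)]
  gcongr
  have h2 : 1 ≤ l₀⁻¹ * l := by
    rw [inv_mul_eq_div, one_le_div hl₀]
    exact hl
  linarith

/-- Hölder continuity of the relaxation function. -/
theorem abs_relaxation_sub_le (hα : 0 < α) (hα' : α ≤ 1) (hl : 0 < l) {s t₁ t₂ : ℝ} (hs : 0 < s)
    (hsα : s ≤ α) (h₁ : 0 ≤ t₁) (h₂ : t₁ ≤ t₂) :
    |relaxation α l t₂ - relaxation α l t₁| ≤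
      ((Real.Gamma α)⁻¹ + α) / s * l ^ (s / α) * (t₂ - t₁) ^ s := by
  have hG := Real.Gamma_pos_of_pos hα
  rw [abs_sub_comm, abs_of_nonneg (sub_nonneg.2 (relaxation_anti hα hα' hl.le h₁ h₂)),
    relaxation_sub hα hl.le h₁ h₂]
  set C := (Real.Gamma α)⁻¹ + α with hC
  have hC0 : 0 < C := by positivity
  have hI : ∫ τ in t₁..t₂, resolvent α l τ ≤
      ∫ τ in t₁..t₂, C * l ^ (s / α - 1) * τ ^ (s - 1) := by
    refine intervalIntegral.integral_mono_on_of_le_Ioo h₂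
      ((intervalIntegrable_resolvent hα).symm.trans (intervalIntegrable_resolvent hα))
      ((intervalIntegral.intervalIntegrable_rpow' (by linarith)).const_mul _) fun τ hτ => ?_
    have hτ0 : 0 < τ := h₁.trans_lt hτ.1
    -- With θ = 1 - s/α the interpolated bound has the time power τ^(s-1). Its integral is (t₂^s -
    -- t₁^s)/s, and subadditivity of x^s gives (t₂ - t₁)^s.
    have h3 := rpow_mul_resolvent_le hα hα' hl hτ0 (θ := 1 - s / α)
      (by rw [sub_nonneg, div_le_one hα]; exact hsα) (by linarith [div_pos hs hα])
    rw [sub_sub_cancel, mul_div_cancel₀ _ hα.ne'] at h3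
    have h4 : l ^ (s / α - 1) * l ^ (1 - s / α) = 1 := by
      rw [← Real.rpow_add hl]
      simp
    have hp : 0 < l ^ (s / α - 1) := by positivity
    calc resolvent α l τ = l ^ (s / α - 1) * (l ^ (1 - s / α) * resolvent α l τ) := by
          rw [← mul_assoc, h4, one_mul]
      _ ≤ l ^ (s / α - 1) * (C * τ ^ (s - 1)) := by gcongr
      _ = _ := by ring
  rw [intervalIntegral.integral_const_mul, integral_rpow (Or.inl (by linarith)),
    sub_add_cancel] at hI
  have h5 : t₂ ^ s - t₁ ^ s ≤ (t₂ - t₁) ^ s := by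
    have := Real.rpow_add_le_add_rpow h₁ (sub_nonneg.2 h₂) hs.le (hsα.trans hα')
    rw [add_sub_cancel] at this
    linarith
  calc l * ∫ τ in t₁..t₂, resolvent α l τ
      ≤ l * (C * l ^ (s / α - 1) * ((t₂ ^ s - t₁ ^ s) / s)) := by gcongr
    _ ≤ l * (C * l ^ (s / α - 1) * ((t₂ - t₁) ^ s / s)) := by gcongr
    _ = C / s * (l * l ^ (s / α - 1)) * (t₂ - t₁) ^ s := by ring
    _ = _ := by
        rw [mul_comm l, ← Real.rpow_add_one hl.ne', sub_add_cancel]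

end MittagLefflerBounds

/-! ### Hölder's inequality for weakly singular kernels -/

section WeaklySingularIntegrals

variable {E : Type*} [NormedAddCommGroup E] {P Q T : ℝ} {X : ℝ → E}

theorem restrict_Ioo_le_timeMeasure {a b : ℝ} (ha : 0 ≤ a) (hb : b ≤ T) :
    volume.restrict (Ioo a b) ≤ timeMeasure T :=
  Measure.restrict_mono_set _ (Ioo_subset_Ioo ha hb)

theorem integral_mul_norm_le (hPQ : P.HolderConjugate Q) {a b : ℝ} (ha : 0 ≤ a) (hb : b ≤ T)
    (hX : MemLp X (ENNReal.ofReal P) (timeMeasure T)) {w : ℝ → ℝ}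
    (hw0 : ∀ τ ∈ Ioo a b, 0 ≤ w τ) (hwm : AEStronglyMeasurable w (volume.restrict (Ioo a b)))
    (hwi : IntegrableOn (fun τ => w τ ^ Q) (Ioo a b)) :
    IntegrableOn (fun τ => w τ * ‖X τ‖) (Ioo a b) ∧
      ∫ τ in Ioo a b, w τ * ‖X τ‖ ≤ (∫ τ in Ioo a b, w τ ^ Q) ^ (1 / Q) *
        (eLpNorm X (ENNReal.ofReal P) (timeMeasure T)).toReal := by
  have hP0 : 0 < P := hPQ.pos
  have hQ0 : 0 < Q := hPQ.symm.pos
  have hX' := (hX.mono_measure (restrict_Ioo_le_timeMeasure ha hb)).norm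
  have hw0' : ∀ᵐ τ ∂volume.restrict (Ioo a b), 0 ≤ w τ :=
    (ae_restrict_mem measurableSet_Ioo).mono hw0
  have hw : MemLp w (ENNReal.ofReal Q) (volume.restrict (Ioo a b)) := by
    rw [← integrable_norm_rpow_iff hwm (by simpa using hQ0) ENNReal.ofReal_ne_top,
      ENNReal.toReal_ofReal hQ0.le]
    refine Integrable.congr hwi (hw0'.mono fun τ hτ => ?_)
    simp only [Real.norm_of_nonneg hτ]
  constructor
  · have := hPQ.symm.ennrealOfReal
    exact hw.integrable_mul hX'
  · refine (integral_mul_le_Lp_mul_Lq_of_nonneg hPQ.symm hw0'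
      (.of_forall fun τ => norm_nonneg _) hw hX').trans ?_
    refine mul_le_mul_of_nonneg_left ?_ (by
      refine Real.rpow_nonneg ?_ _
      exact setIntegral_nonneg measurableSet_Ioo fun τ hτ => Real.rpow_nonneg (hw0 τ hτ) _)
    have h1 := eLpNorm_mono_measure (p := ENNReal.ofReal P) X (restrict_Ioo_le_timeMeasure ha hb)
    rw [← eLpNorm_norm, hX'.eLpNorm_eq_integral_rpow_norm (by simpa using hP0)
      ENNReal.ofReal_ne_top, ENNReal.toReal_ofReal hP0.le] at h1
    simp only [norm_norm] at h1
    rw [one_div]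
    exact (ENNReal.ofReal_le_iff_le_toReal hX.2.ne).1 h1

/-- The constant in the estimates of weakly singular integrals. -/
noncomputable def singularConst (P d : ℝ) : ℝ :=
  ((P.conjExponent * (d - 1 / P))⁻¹) ^ (1 / P.conjExponent)

variable {d : ℝ}

theorem singularConst_nonneg (hP : 1 < P) (hd : 1 / P < d) : 0 ≤ singularConst P d := by
  have := (Real.HolderConjugate.conjExponent hP).symm.pos
  have : 0 < d - 1 / P := by linarith
  unfold singularConst
  positivity

/-- With Q the conjugate exponent, the kernel power (b - τ)^((d-1)Q) is integrable exactly when this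
quantity is positive, that is, when d > 1/P. -/
theorem conjExponent_mul_sub_one (hP : 1 < P) :
    (d - 1) * P.conjExponent + 1 = P.conjExponent * (d - 1 / P) := by
  have h := Real.HolderConjugate.conjExponent hP
  have hQ := h.symm.pos
  have h1 := h.inv_add_inv_eq_one
  have h2 : P.conjExponent * P.conjExponent⁻¹ = 1 := mul_inv_cancel₀ hQ.ne'
  rw [one_div]
  linear_combination P.conjExponent * h1 - h2

theorem singularConst_bound (hP : 1 < P) (hd : 1 / P < d) {h I : ℝ} (hh : 0 ≤ h) (hI0 : 0 ≤ I)
    (hI : I ≤ h ^ ((d - 1) * P.conjExponent + 1) / ((d - 1) * P.conjExponent + 1)) :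
    I ^ (1 / P.conjExponent) ≤ singularConst P d * h ^ (d - 1 / P) := by
  have hQ := (Real.HolderConjugate.conjExponent hP).symm.pos
  have hc : 0 < d - 1 / P := by linarith
  rw [conjExponent_mul_sub_one hP] at hI
  calc I ^ (1 / P.conjExponent)
      ≤ (h ^ (P.conjExponent * (d - 1 / P)) / (P.conjExponent * (d - 1 / P))) ^
          (1 / P.conjExponent) := Real.rpow_le_rpow hI0 hI (by positivity)
    _ = singularConst P d * h ^ (d - 1 / P) := by
      rw [div_eq_inv_mul, Real.mul_rpow (by positivity) (by positivity), ← Real.rpow_mul hh,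
        singularConst]
      congr 2
      field_simp

theorem rpow_rpow_conj (x : ℝ) (hx : 0 ≤ x) :
    (x ^ (d - 1)) ^ P.conjExponent = x ^ ((d - 1) * P.conjExponent) :=
  (Real.rpow_mul hx _ _).symm

theorem intervalIntegrable_sub_rpow {a b c e : ℝ} (hc : -1 < c) :
    IntervalIntegrable (fun τ : ℝ => (e - τ) ^ c) volume a b := by
  have h := (intervalIntegral.intervalIntegrable_rpow' (a := e - a) (b := e - b) hc).comp_sub_left e
  simpa using h

theorem integral_sub_rpow {a b c e : ℝ} (hc : -1 < c) :
    ∫ τ in a..b, (e - τ) ^ c = ((e - a) ^ (c + 1) - (e - b) ^ (c + 1)) / (c + 1) := by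
  rw [intervalIntegral.integral_comp_sub_left (fun τ => τ ^ c), integral_rpow (Or.inl hc)]

theorem measurable_sub_rpow (e c : ℝ) : Measurable fun τ : ℝ => (e - τ) ^ c :=
  (measurable_const.sub measurable_id).pow_const _

/-- Hölder's inequality for a weakly singular kernel, near the singularity. -/
theorem integral_sub_rpow_mul_norm_le (hP : 1 < P) (hd : 1 / P < d) {a b : ℝ} (ha : 0 ≤ a)
    (hab : a ≤ b) (hb : b ≤ T) (hX : MemLp X (ENNReal.ofReal P) (timeMeasure T)) :
    IntegrableOn (fun τ => (b - τ) ^ (d - 1) * ‖X τ‖) (Ioo a b) ∧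
      ∫ τ in Ioo a b, (b - τ) ^ (d - 1) * ‖X τ‖ ≤ singularConst P d * (b - a) ^ (d - 1 / P) *
        (eLpNorm X (ENNReal.ofReal P) (timeMeasure T)).toReal := by
  have hPQ := Real.HolderConjugate.conjExponent hP
  have hQ := hPQ.symm.pos
  have hc : 0 < (d - 1) * P.conjExponent + 1 := by
    rw [conjExponent_mul_sub_one hP]
    exact mul_pos hQ (by linarith)
  have hw0 : ∀ τ ∈ Ioo a b, 0 ≤ (b - τ) ^ (d - 1) := fun τ hτ =>
    Real.rpow_nonneg (by linarith [hτ.2]) _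
  have e1 : ∀ τ ∈ Ioo a b, ((b - τ) ^ (d - 1)) ^ P.conjExponent =
      (b - τ) ^ ((d - 1) * P.conjExponent) := fun τ hτ => rpow_rpow_conj _ (by linarith [hτ.2])
  have hint : IntegrableOn (fun τ => ((b - τ) ^ (d - 1)) ^ P.conjExponent) (Ioo a b) := by
    refine IntegrableOn.congr_fun ?_ (fun τ hτ => (e1 τ hτ).symm) measurableSet_Ioo
    exact ((intervalIntegrable_iff_integrableOn_Ioc_of_le hab).1
      (intervalIntegrable_sub_rpow (by linarith))).mono_set Ioo_subset_Ioc_self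
  have h := integral_mul_norm_le hPQ ha hb hX hw0
    (measurable_sub_rpow b (d - 1)).aestronglyMeasurable hint
  refine ⟨h.1, h.2.trans (mul_le_mul_of_nonneg_right ?_ ENNReal.toReal_nonneg)⟩
  refine singularConst_bound hP hd (by linarith)
    (setIntegral_nonneg measurableSet_Ioo fun τ hτ => Real.rpow_nonneg (hw0 τ hτ) _) ?_
  rw [setIntegral_congr_fun measurableSet_Ioo e1, ← integral_Ioc_eq_integral_Ioo,
    ← intervalIntegral.integral_of_le hab, integral_sub_rpow (by linarith), sub_self,
    Real.zero_rpow hc.ne', sub_zero]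

/-- Hölder's inequality for the increment of a weakly singular kernel. -/
theorem integral_sub_rpow_sub_mul_norm_le (hP : 1 < P) (hd : 1 / P < d) (hd1 : d ≤ 1) {a b : ℝ}
    (ha : 0 ≤ a) (hab : a ≤ b) (hb : b ≤ T) (hX : MemLp X (ENNReal.ofReal P) (timeMeasure T)) :
    ∫ τ in Ioo 0 a, ((a - τ) ^ (d - 1) - (b - τ) ^ (d - 1)) * ‖X τ‖ ≤
      singularConst P d * (b - a) ^ (d - 1 / P) *
        (eLpNorm X (ENNReal.ofReal P) (timeMeasure T)).toReal := by
  have hPQ := Real.HolderConjugate.conjExponent hP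
  have hQ := hPQ.symm.pos
  have hQ1 := hPQ.symm.lt
  have hc : 0 < (d - 1) * P.conjExponent + 1 := by
    rw [conjExponent_mul_sub_one hP]
    exact mul_pos hQ (by linarith)
  set c := (d - 1) * P.conjExponent with hcdef
  have hw0 : ∀ τ ∈ Ioo 0 a, 0 ≤ (a - τ) ^ (d - 1) - (b - τ) ^ (d - 1) := fun τ hτ =>
    sub_nonneg.2 (Real.rpow_le_rpow_of_nonpos (by linarith [hτ.2]) (by linarith) (by linarith))
  -- Superadditivity of x^Q for Q ≥ 1: (x - y)^Q ≤ x^Q - y^Q when x ≥ y ≥ 0. The right-hand side can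
  -- be integrated explicitly.
  have hle : ∀ τ ∈ Ioo 0 a, ((a - τ) ^ (d - 1) - (b - τ) ^ (d - 1)) ^ P.conjExponent ≤
      (a - τ) ^ c - (b - τ) ^ c := by
    intro τ hτ
    have h1 : 0 ≤ a - τ := by linarith [hτ.2]
    have h2 : 0 ≤ b - τ := by linarith [hτ.2]
    have h3 := Real.add_rpow_le_rpow_add (hw0 τ hτ) (Real.rpow_nonneg h2 (d - 1)) hQ1.le
    rw [sub_add_cancel, rpow_rpow_conj _ h1, rpow_rpow_conj _ h2] at h3
    linarith
  have hI : ∀ e, IntegrableOn (fun τ => (e - τ) ^ c) (Ioo 0 a) := fun e =>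
    ((intervalIntegrable_iff_integrableOn_Ioc_of_le ha).1
      (intervalIntegrable_sub_rpow (by linarith))).mono_set Ioo_subset_Ioc_self
  have hm := ((measurable_sub_rpow a (d - 1)).sub (measurable_sub_rpow b (d - 1)))
  have hint : IntegrableOn
      (fun τ => ((a - τ) ^ (d - 1) - (b - τ) ^ (d - 1)) ^ P.conjExponent) (Ioo 0 a) := by
    refine Integrable.mono' ((hI a).sub (hI b)) (hm.pow_const _).aestronglyMeasurable ?_
    refine (ae_restrict_mem measurableSet_Ioo).mono fun τ hτ => ?_
    rw [Real.norm_of_nonneg (Real.rpow_nonneg (hw0 τ hτ) _)]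
    exact hle τ hτ
  have h := integral_mul_norm_le hPQ le_rfl (hab.trans hb) hX hw0 hm.aestronglyMeasurable hint
  refine h.2.trans (mul_le_mul_of_nonneg_right ?_ ENNReal.toReal_nonneg)
  refine singularConst_bound hP hd (by linarith)
    (setIntegral_nonneg measurableSet_Ioo fun τ hτ => Real.rpow_nonneg (hw0 τ hτ) _) ?_
  refine (setIntegral_mono_on hint ((hI a).sub (hI b)) measurableSet_Ioo hle).trans ?_
  simp only [Pi.sub_apply]
  rw [integral_sub (hI a) (hI b), ← integral_Ioc_eq_integral_Ioo, ← integral_Ioc_eq_integral_Ioo,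
    ← intervalIntegral.integral_of_le ha, ← intervalIntegral.integral_of_le ha,
    integral_sub_rpow (by linarith), integral_sub_rpow (by linarith), sub_self,
    Real.zero_rpow hc.ne', ← sub_div]
  refine div_le_div_of_nonneg_right ?_ hc.le
  -- The integral equals (a^(c+1) - b^(c+1) + (b - a)^(c+1))/(c+1); dropping the nonpositive
  -- difference leaves the required power of b - a.
  have : a ^ (c + 1) ≤ b ^ (c + 1) := Real.rpow_le_rpow ha hab hc.le
  simp only [sub_zero]
  linarith

variable [NormedSpace ℝ E]

theorem integrableOn_sub_rpow_smul (hP : 1 < P) (hd : 1 / P < d) {t : ℝ} (ht : 0 ≤ t)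
    (htT : t ≤ T) (hX : MemLp X (ENNReal.ofReal P) (timeMeasure T)) :
    IntegrableOn (fun τ => (t - τ) ^ (d - 1) • X τ) (Ioc 0 t) := by
  rw [integrableOn_Ioc_iff_integrableOn_Ioo]
  have hXm := hX.1.mono_measure (restrict_Ioo_le_timeMeasure le_rfl htT)
  refine (integral_sub_rpow_mul_norm_le hP hd le_rfl ht htT hX).1.mono'
    ((measurable_sub_rpow t (d - 1)).aestronglyMeasurable.smul hXm) ?_
  refine (ae_restrict_mem measurableSet_Ioo).mono fun τ hτ => ?_
  rw [norm_smul, Real.norm_of_nonneg (Real.rpow_nonneg (by linarith [hτ.2]) _)]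

/-- The fractional integral of order `d` maps `L^P` to Hölder continuous functions. -/
theorem norm_fracIntegral_sub_le (hP : 1 < P) (hd : 1 / P < d) (hd1 : d ≤ 1) {a b : ℝ}
    (ha : 0 ≤ a) (hab : a ≤ b) (hb : b ≤ T) (hX : MemLp X (ENNReal.ofReal P) (timeMeasure T)) :
    ‖fracIntegral d X b - fracIntegral d X a‖ ≤
      2 * (Real.Gamma d)⁻¹ * singularConst P d * (b - a) ^ (d - 1 / P) *
        (eLpNorm X (ENNReal.ofReal P) (timeMeasure T)).toReal := by
  have hP0 : 0 < 1 / P := by positivity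
  have hd0 : 0 < d := by linarith
  have hG := Real.Gamma_pos_of_pos hd0
  set M := singularConst P d * (b - a) ^ (d - 1 / P) *
    (eLpNorm X (ENNReal.ofReal P) (timeMeasure T)).toReal with hM
  have hIb := integrableOn_sub_rpow_smul hP hd (ha.trans hab) hb hX
  have hIa := integrableOn_sub_rpow_smul hP hd ha (hab.trans hb) hX
  have hIb' := (intervalIntegrable_iff_integrableOn_Ioc_of_le (ha.trans hab)).2 hIb
  have hIa' := (intervalIntegrable_iff_integrableOn_Ioc_of_le ha).2 hIa
  have hI1 : IntervalIntegrable (fun τ => (b - τ) ^ (d - 1) • X τ) volume 0 a :=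
    hIb'.mono_set (by
      rw [uIcc_of_le ha, uIcc_of_le (ha.trans hab)]
      exact Icc_subset_Icc_right hab)
  have hI2 : IntervalIntegrable (fun τ => (b - τ) ^ (d - 1) • X τ) volume a b :=
    hI1.symm.trans hIb'
  -- The increment splits into the new piece over (a, b) and the loss of kernel mass over (0, a).
  -- Each is at most M, whence the factor 2.
  have e1 : fracIntegral d X b - fracIntegral d X a = (Real.Gamma d)⁻¹ •
      ((∫ τ in Ioo a b, (b - τ) ^ (d - 1) • X τ) -
        ∫ τ in Ioo 0 a, ((a - τ) ^ (d - 1) - (b - τ) ^ (d - 1)) • X τ) := by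
    rw [fracIntegral, fracIntegral, ← smul_sub,
      ← intervalIntegral.integral_add_adjacent_intervals hI1 hI2, add_comm, add_sub_assoc,
      ← intervalIntegral.integral_sub hI1 hIa', intervalIntegral.integral_of_le hab,
      intervalIntegral.integral_of_le ha, integral_Ioc_eq_integral_Ioo,
      integral_Ioc_eq_integral_Ioo]
    have e2 : (fun τ => ((a - τ) ^ (d - 1) - (b - τ) ^ (d - 1)) • X τ) =
        fun τ => -((b - τ) ^ (d - 1) • X τ - (a - τ) ^ (d - 1) • X τ) := by
      funext τ
      rw [sub_smul, neg_sub]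
    rw [e2, integral_neg, sub_neg_eq_add]
  have n1 : ‖∫ τ in Ioo a b, (b - τ) ^ (d - 1) • X τ‖ ≤ M := by
    have h := integral_sub_rpow_mul_norm_le hP hd ha hab hb hX
    refine (norm_integral_le_integral_norm _).trans (le_trans (le_of_eq ?_) h.2)
    refine setIntegral_congr_fun measurableSet_Ioo fun τ hτ => ?_
    simp only [norm_smul]
    rw [Real.norm_of_nonneg (Real.rpow_nonneg (by linarith [hτ.2]) _)]
  have n2 : ‖∫ τ in Ioo 0 a, ((a - τ) ^ (d - 1) - (b - τ) ^ (d - 1)) • X τ‖ ≤ M := by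
    have h := integral_sub_rpow_sub_mul_norm_le hP hd hd1 ha hab hb hX
    refine (norm_integral_le_integral_norm _).trans (le_trans (le_of_eq ?_) h)
    refine setIntegral_congr_fun measurableSet_Ioo fun τ hτ => ?_
    simp only [norm_smul]
    rw [Real.norm_of_nonneg (sub_nonneg.2 (Real.rpow_le_rpow_of_nonpos (by linarith [hτ.2])
      (by linarith) (by linarith)))]
  rw [e1, norm_smul, norm_inv, Real.norm_of_nonneg hG.le]
  calc (Real.Gamma d)⁻¹ * ‖_‖ ≤ (Real.Gamma d)⁻¹ * (M + M) :=
        mul_le_mul_of_nonneg_left ((norm_sub_le _ _).trans (add_le_add n1 n2)) (by positivity)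
    _ = _ := by
        rw [hM]
        ring

end WeaklySingularIntegrals

/-! ### Convolution on a bounded interval -/

section ScalarConvolution

variable {T : ℝ}

open scoped Convolution in
-- Cutting both factors off outside (0, T) makes them functions on the whole line without changing
-- the convolution at points x ≤ T, so results on the line can be used.
theorem convolution_indicator (f g : ℝ → ℝ) {x : ℝ} (hx : x ≤ T) :
    ((Ioo 0 T).indicator f ⋆[ContinuousLinearMap.mul ℝ ℝ, volume] (Ioo 0 T).indicator g) x =
      ∫ s in Ioo 0 x, f s * g (x - s) := by
  rw [convolution_def, ← integral_indicator measurableSet_Ioo]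
  congr 1
  funext s
  simp only [ContinuousLinearMap.mul_apply']
  by_cases hs : s ∈ Ioo 0 x
  · rw [indicator_of_mem hs, indicator_of_mem (show s ∈ Ioo 0 T from ⟨hs.1, hs.2.trans_le hx⟩),
      indicator_of_mem (show x - s ∈ Ioo 0 T from ⟨by linarith [hs.2], by linarith [hs.1]⟩)]
  · rw [indicator_of_notMem hs]
    by_cases hs0 : 0 < s
    · rw [indicator_of_notMem (s := Ioo 0 T) (a := x - s), mul_zero]
      exact fun h => hs ⟨hs0, by linarith [h.1]⟩
    · rw [indicator_of_notMem (s := Ioo 0 T) (a := s), zero_mul]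
      exact fun h => hs0 h.1

theorem aestronglyMeasurable_convolution {f k : ℝ → ℝ} (hf : IntegrableOn f (Ioo 0 T))
    (hk : IntegrableOn k (Ioo 0 T)) :
    AEStronglyMeasurable (fun t => ∫ τ in (0 : ℝ)..t, f τ * k (t - τ)) (timeMeasure T) := by
  have h := (((integrable_indicator_iff measurableSet_Ioo).2 hf).integrable_convolution
    (ContinuousLinearMap.mul ℝ ℝ) ((integrable_indicator_iff measurableSet_Ioo).2 hk)).1
  refine (h.mono_measure Measure.restrict_le_self).congr ?_
  refine (ae_restrict_mem measurableSet_Ioo).mono fun t ht => ?_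
  simp only [convolution_indicator f k ht.2.le]
  rw [intervalIntegral.integral_of_le ht.1.le,
    integral_Ioc_eq_integral_Ioo]

theorem integral_mul_comp_sub_comm (f g : ℝ → ℝ) (t : ℝ) :
    ∫ τ in (0 : ℝ)..t, f (t - τ) * g τ = ∫ τ in (0 : ℝ)..t, f τ * g (t - τ) := by
  have h := intervalIntegral.integral_comp_sub_left (a := 0) (b := t)
    (fun x => f x * g (t - x)) t
  simpa using h

theorem intervalIntegral_eq_Ioo {t : ℝ} (ht : 0 ≤ t) (f : ℝ → ℝ) :
    ∫ τ in (0 : ℝ)..t, f τ = ∫ τ in Ioo 0 t, f τ := by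
  rw [intervalIntegral.integral_of_le ht, integral_Ioc_eq_integral_Ioo]

/-- Associativity of the convolution on `(0, t)`. -/
theorem convolution_assoc_Ioo {a k f : ℝ → ℝ} (ha : IntegrableOn a (Ioo 0 T))
    (hk : IntegrableOn k (Ioo 0 T)) (hf : IntegrableOn f (Ioo 0 T)) {B : ℝ}
    (hB : ∀ x ∈ Ioo 0 T, ∫ τ in (0 : ℝ)..x, |f τ| * |k (x - τ)| ≤ B) {t : ℝ} (ht : 0 ≤ t)
    (htT : t ≤ T) :
    ∫ τ in (0 : ℝ)..t, a (t - τ) * (∫ σ in (0 : ℝ)..τ, f σ * k (τ - σ)) =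
      ∫ σ in (0 : ℝ)..t, f σ * (∫ ρ in (0 : ℝ)..(t - σ), a (t - σ - ρ) * k ρ) := by
  set A := (Ioo 0 T).indicator a with hA
  set K := (Ioo 0 T).indicator k with hK
  set F := (Ioo 0 T).indicator f with hF
  have iA : Integrable A := (integrable_indicator_iff measurableSet_Ioo).2 ha
  have iK : Integrable K := (integrable_indicator_iff measurableSet_Ioo).2 hk
  have iF : Integrable F := (integrable_indicator_iff measurableSet_Ioo).2 hf
  have nK : (fun x => ‖K x‖) = (Ioo 0 T).indicator fun x => ‖k x‖ :=
    funext fun x => norm_indicator_eq_indicator_norm _ _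
  have nF : (fun x => ‖F x‖) = (Ioo 0 T).indicator fun x => ‖f x‖ :=
    funext fun x => norm_indicator_eq_indicator_norm _ _
  have key := convolution_assoc (μ := volume) (ν := volume) (ContinuousLinearMap.mul ℝ ℝ)
    (ContinuousLinearMap.mul ℝ ℝ) (ContinuousLinearMap.mul ℝ ℝ) (ContinuousLinearMap.mul ℝ ℝ)
    (fun x y z => by simp [mul_assoc]) (x₀ := t) iA.1 iK.1 iF.1
    (iA.ae_convolution_exists _ iK) (iK.norm.ae_convolution_exists _ iF.norm) ?_
  · rw [convolution_def, convolution_def] at key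
    have hR : ∫ s, (ContinuousLinearMap.mul ℝ ℝ) (A s)
        (convolution K F (ContinuousLinearMap.mul ℝ ℝ) volume (t - s)) =
        ∫ s in Ioo 0 t, a s * ∫ σ in Ioo 0 (t - s), k σ * f (t - s - σ) := by
      rw [← integral_indicator measurableSet_Ioo]
      congr 1
      funext s
      simp only [ContinuousLinearMap.mul_apply']
      by_cases hs0 : 0 < s
      · rw [hK, hF, convolution_indicator k f (by linarith)]
        by_cases hs : s < t
        · rw [indicator_of_mem (show s ∈ Ioo 0 t from ⟨hs0, hs⟩), hA,
            indicator_of_mem (show s ∈ Ioo 0 T from ⟨hs0, by linarith⟩)]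
        · rw [indicator_of_notMem (fun h => hs h.2), Ioo_eq_empty (by linarith)]
          simp
      · rw [indicator_of_notMem (fun h => hs0 h.1), hA, indicator_of_notMem (fun h => hs0 h.1),
          zero_mul]
    have hL : ∫ s, (ContinuousLinearMap.mul ℝ ℝ)
        (convolution A K (ContinuousLinearMap.mul ℝ ℝ) volume s) (F (t - s)) =
        ∫ s in Ioo 0 t, (∫ ρ in Ioo 0 s, a ρ * k (s - ρ)) * f (t - s) := by
      rw [← integral_indicator measurableSet_Ioo]
      congr 1
      funext s
      simp only [ContinuousLinearMap.mul_apply']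
      by_cases hs : s < t
      · rw [hA, hK, convolution_indicator a k (by linarith)]
        by_cases hs0 : 0 < s
        · rw [indicator_of_mem (show s ∈ Ioo 0 t from ⟨hs0, hs⟩), hF,
            indicator_of_mem (show t - s ∈ Ioo 0 T from ⟨by linarith, by linarith⟩)]
        · rw [indicator_of_notMem (fun h => hs0 h.1), Ioo_eq_empty hs0]
          simp
      · rw [indicator_of_notMem (fun h => hs h.2), hF,
          indicator_of_notMem (fun h => hs (by linarith [h.1])), mul_zero]
    rw [hR, hL] at key
    rw [integral_mul_comp_sub_comm a (fun τ => ∫ σ in (0 : ℝ)..τ, f σ * k (τ - σ)) t,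
      ← integral_mul_comp_sub_comm f (fun x => ∫ ρ in (0 : ℝ)..x, a (x - ρ) * k ρ) t,
      intervalIntegral_eq_Ioo ht, intervalIntegral_eq_Ioo ht]
    · refine Eq.trans ?_ (key.symm.trans ?_)
      · refine setIntegral_congr_fun measurableSet_Ioo fun s hs => ?_
        have : 0 ≤ t - s := by linarith [hs.2]
        rw [← integral_mul_comp_sub_comm f k, intervalIntegral_eq_Ioo this]
        simp only [mul_comm]
      · refine setIntegral_congr_fun measurableSet_Ioo fun s hs => ?_
        rw [integral_mul_comp_sub_comm a k, intervalIntegral_eq_Ioo hs.1.le, mul_comm]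
  -- Associativity is wanted at every t, not merely almost every t, so the triple convolution of
  -- absolute values must converge at t. The uniform bound B on |f| * |k| reduces this to
  -- integrability of a.
  · have hm : AEStronglyMeasurable (convolution (fun x => ‖K x‖) (fun x => ‖F x‖)
        (ContinuousLinearMap.mul ℝ ℝ) volume) volume :=
      (iK.norm.integrable_convolution _ iF.norm).1
    refine (iA.norm.mul_const B).mono'
      (iA.norm.1.convolution_integrand_snd (ContinuousLinearMap.mul ℝ ℝ) hm t)
      (.of_forall fun s => ?_)
    simp only [ContinuousLinearMap.mul_apply', norm_mul, norm_norm]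
    by_cases hs : s ∈ Ioo 0 t
    · refine mul_le_mul_of_nonneg_left ?_ (norm_nonneg _)
      rw [nK, nF, convolution_indicator _ _ (by linarith [hs.1])]
      rw [Real.norm_of_nonneg (setIntegral_nonneg measurableSet_Ioo fun x _ => by positivity)]
      refine le_trans (le_of_eq ?_) (hB (t - s) ⟨by linarith [hs.2], by linarith [hs.1]⟩)
      rw [← intervalIntegral_eq_Ioo (by linarith [hs.2]),
        ← integral_mul_comp_sub_comm (fun τ => |f τ|) (fun τ => |k τ|)]
      simp only [Real.norm_eq_abs, mul_comm]
    · by_cases hs0 : s ∈ Ioo 0 T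
      · rw [nK, nF, convolution_indicator _ _ (by linarith [hs0.1]),
          Ioo_eq_empty (fun h => hs ⟨hs0.1, by linarith⟩)]
        simp only [Measure.restrict_empty, integral_zero_measure, norm_zero, mul_zero]
        -- Any point of (0, T) would do; this only shows that B is nonnegative.
        have h0 := hB (T / 2) ⟨by linarith [hs0.1.trans hs0.2], by linarith [hs0.1.trans hs0.2]⟩
        refine mul_nonneg (norm_nonneg _) (le_trans ?_ h0)
        rw [intervalIntegral_eq_Ioo (by linarith [hs0.1.trans hs0.2])]
        exact setIntegral_nonneg measurableSet_Ioo fun x _ => by positivity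
      · rw [hA, indicator_of_notMem hs0]
        simp

end ScalarConvolution

/-! ### Scalar Duhamel integrals and their fractional equations -/

section Duhamel

variable {α l t P T : ℝ} {f : ℝ → ℝ}

/-- The convolution of `f` with the kernel `t ^ (α - 1) E_{α,α}(-ℓ t ^ α)`. -/
noncomputable def duhamel (α l : ℝ) (f : ℝ → ℝ) (t : ℝ) : ℝ :=
  ∫ τ in (0 : ℝ)..t, f τ * resolvent α l (t - τ)

theorem integrableOn_Ioo_rl {a : ℝ} (ha : 0 < a) (hT : 0 ≤ T) : IntegrableOn (rl a) (Ioo 0 T) :=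
  (integrableOn_rl ha hT).mono_set Ioo_subset_Ioc_self

theorem integrableOn_resolvent (hα : 0 < α) (hT : 0 ≤ T) :
    IntegrableOn (resolvent α l) (Ioo 0 T) :=
  ((intervalIntegrable_iff_integrableOn_Ioc_of_le hT).1
    (intervalIntegrable_resolvent hα)).mono_set Ioo_subset_Ioc_self

theorem integrableOn_of_memLp_timeMeasure {E : Type*} [NormedAddCommGroup E] {f : ℝ → E}
    (hP : 1 < P) (hf : MemLp f (ENNReal.ofReal P) (timeMeasure T)) :
    IntegrableOn f (Ioo 0 T) := by
  have : IsFiniteMeasure (timeMeasure T) := by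
    unfold timeMeasure
    infer_instance
  exact hf.integrable (by simpa using hP.le)

/-- The kernel is dominated by a power, hence products with `L^P` functions are integrable. -/
theorem integrableOn_mul_resolvent (hα : 0 < α) (hα' : α ≤ 1) (hl : 0 ≤ l) (hP : 1 < P)
    (hPα : 1 / P < α) (hf : MemLp f (ENNReal.ofReal P) (timeMeasure T)) (ht : 0 ≤ t)
    (htT : t ≤ T) :
    IntegrableOn (fun τ => |f τ| * |resolvent α l (t - τ)|) (Ioo 0 t) ∧
      ∫ τ in (0 : ℝ)..t, |f τ| * |resolvent α l (t - τ)| ≤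
        (Real.Gamma α)⁻¹ * (singularConst P α * T ^ (α - 1 / P) *
          (eLpNorm f (ENNReal.ofReal P) (timeMeasure T)).toReal) := by
  have h := integral_sub_rpow_mul_norm_le hP hPα le_rfl ht htT hf
  have hG := Real.Gamma_pos_of_pos hα
  have hm : AEStronglyMeasurable (fun τ => |f τ| * |resolvent α l (t - τ)|)
      (volume.restrict (Ioo 0 t)) :=
    (hf.1.mono_measure (restrict_Ioo_le_timeMeasure le_rfl htT)).norm.mul
      ((measurable_resolvent hα).comp
        (measurable_const.sub measurable_id)).aestronglyMeasurable.norm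
  have hle : ∀ τ ∈ Ioo 0 t, |f τ| * |resolvent α l (t - τ)| ≤
      (Real.Gamma α)⁻¹ * ((t - τ) ^ (α - 1) * ‖f τ‖) := by
    intro τ hτ
    have h0 : 0 < t - τ := by linarith [hτ.2]
    have h1 := resolvent_le_rl hα hα' hl h0
    rw [abs_of_pos (resolvent_pos hα hα' hl h0), Real.norm_eq_abs]
    calc |f τ| * resolvent α l (t - τ) ≤ |f τ| * rl α (t - τ) := by gcongr
      _ = _ := by
        rw [rl]
        ring
  have hint : IntegrableOn (fun τ => |f τ| * |resolvent α l (t - τ)|) (Ioo 0 t) := by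
    refine (h.1.const_mul (Real.Gamma α)⁻¹).mono' hm ?_
    refine (ae_restrict_mem measurableSet_Ioo).mono fun τ hτ => ?_
    rw [Real.norm_of_nonneg (by positivity)]
    exact hle τ hτ
  refine ⟨hint, ?_⟩
  rw [intervalIntegral_eq_Ioo ht]
  refine (setIntegral_mono_on hint (h.1.const_mul _) measurableSet_Ioo hle).trans ?_
  rw [integral_const_mul]
  refine mul_le_mul_of_nonneg_left (h.2.trans ?_) (by positivity)
  have := singularConst_nonneg hP hPα
  have h2 : (t - 0) ^ (α - 1 / P) ≤ T ^ (α - 1 / P) :=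
    Real.rpow_le_rpow (by linarith) (by linarith) (by linarith)
  gcongr

theorem intervalIntegrable_mul_resolvent (hα : 0 < α) (hα' : α ≤ 1) (hl : 0 ≤ l) (hP : 1 < P)
    (hPα : 1 / P < α) (hf : MemLp f (ENNReal.ofReal P) (timeMeasure T)) (ht : 0 ≤ t)
    (htT : t ≤ T) :
    IntervalIntegrable (fun τ => f τ * resolvent α l (t - τ)) volume 0 t := by
  rw [intervalIntegrable_iff_integrableOn_Ioo_of_le ht]
  refine Integrable.mono (integrableOn_mul_resolvent hα hα' hl hP hPα hf ht htT).1
    ((hf.1.mono_measure (restrict_Ioo_le_timeMeasure le_rfl htT)).mul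
      ((measurable_resolvent hα).comp (measurable_const.sub measurable_id)).aestronglyMeasurable) ?_
  refine .of_forall fun τ => ?_
  simp

theorem aestronglyMeasurable_duhamel (hα : 0 < α) (hP : 1 < P)
    (hf : MemLp f (ENNReal.ofReal P) (timeMeasure T)) (hT : 0 ≤ T) :
    AEStronglyMeasurable (duhamel α l f) (timeMeasure T) :=
  aestronglyMeasurable_convolution (integrableOn_of_memLp_timeMeasure hP hf)
    (integrableOn_resolvent hα hT)

theorem abs_duhamel_le (hα : 0 < α) (hα' : α ≤ 1) (hl : 0 ≤ l) (hP : 1 < P)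
    (hPα : 1 / P < α) (hf : MemLp f (ENNReal.ofReal P) (timeMeasure T)) (ht : 0 ≤ t)
    (htT : t ≤ T) :
    |duhamel α l f t| ≤ (Real.Gamma α)⁻¹ * (singularConst P α * T ^ (α - 1 / P) *
          (eLpNorm f (ENNReal.ofReal P) (timeMeasure T)).toReal) := by
  refine le_trans ?_ (integrableOn_mul_resolvent hα hα' hl hP hPα hf ht htT).2
  refine (intervalIntegral.abs_integral_le_integral_abs ht).trans (le_of_eq ?_)
  simp only [abs_mul]

theorem integrable_duhamel (hα : 0 < α) (hα' : α ≤ 1) (hl : 0 ≤ l) (hP : 1 < P)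
    (hPα : 1 / P < α) (hf : MemLp f (ENNReal.ofReal P) (timeMeasure T)) (hT : 0 ≤ T) :
    IntegrableOn (duhamel α l f) (Ioo 0 T) := by
  refine Integrable.mono' (g := fun _ => (Real.Gamma α)⁻¹ * (singularConst P α *
    T ^ (α - 1 / P) * (eLpNorm f (ENNReal.ofReal P) (timeMeasure T)).toReal))
    (integrableOn_const (by simp)) (aestronglyMeasurable_duhamel hα hP hf hT) ?_
  exact (ae_restrict_mem measurableSet_Ioo).mono fun t ht =>
    abs_duhamel_le hα hα' hl hP hPα hf ht.1.le ht.2.le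

theorem integral_rl_mul_duhamel (hα : 0 < α) (hα' : α ≤ 1) (hl : 0 ≤ l) (hP : 1 < P)
    (hPα : 1 / P < α) (hf : MemLp f (ENNReal.ofReal P) (timeMeasure T)) (ht : 0 ≤ t)
    (htT : t ≤ T) {a : ℝ} (ha : 0 < a) :
    ∫ τ in (0 : ℝ)..t, rl a (t - τ) * duhamel α l f τ =
      ∫ σ in (0 : ℝ)..t, f σ * ∫ ρ in (0 : ℝ)..(t - σ), rl a (t - σ - ρ) * resolvent α l ρ :=
  convolution_assoc_Ioo (integrableOn_Ioo_rl ha (ht.trans htT))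
    (integrableOn_resolvent hα (ht.trans htT)) (integrableOn_of_memLp_timeMeasure hP hf)
    (fun _ hx => (integrableOn_mul_resolvent hα hα' hl hP hPα hf hx.1.le hx.2.le).2) ht htT

theorem intervalIntegrable_mul_relaxation (hα : 0 < α) (hP : 1 < P)
    (hf : MemLp f (ENNReal.ofReal P) (timeMeasure T)) (ht : 0 ≤ t) (htT : t ≤ T) :
    IntervalIntegrable (fun τ => f τ * relaxation α l (t - τ)) volume 0 t := by
  have h1 : IntervalIntegrable f volume 0 t := by
    rw [intervalIntegrable_iff_integrableOn_Ioo_of_le ht]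
    exact (integrableOn_of_memLp_timeMeasure hP hf).mono_set (Ioo_subset_Ioo_right htT)
  refine h1.mul_continuousOn ?_
  have := continuous_relaxation (l := l) hα
  fun_prop

/-- The Duhamel integral solves the fractional differential equation. -/
theorem fracIntegral_duhamel (hα : 0 < α) (hα' : α < 1) (hl : 0 ≤ l) (hP : 1 < P)
    (hPα : 1 / P < α) (hf : MemLp f (ENNReal.ofReal P) (timeMeasure T)) (ht : 0 ≤ t)
    (htT : t ≤ T) :
    ∫ τ in (0 : ℝ)..t, rl (1 - α) (t - τ) * duhamel α l f τ =
      ∫ τ in (0 : ℝ)..t, (f τ - l * duhamel α l f τ) := by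
  have h1 := integral_rl_mul_duhamel hα hα'.le hl hP hPα hf ht htT (sub_pos.2 hα')
  -- Associativity moves the fractional integral onto the kernel. There g_{1-α} * k = R and l(1 * k)
  -- = 1 - R, so the claim is f * R = 1 * f - f * (1 - R).
  have h2 := integral_rl_mul_duhamel hα hα'.le hl hP hPα hf ht htT one_pos
  have hfi : IntervalIntegrable f volume 0 t := by
    rw [intervalIntegrable_iff_integrableOn_Ioo_of_le ht]
    exact (integrableOn_of_memLp_timeMeasure hP hf).mono_set (Ioo_subset_Ioo_right htT)
  have hDi : IntervalIntegrable (duhamel α l f) volume 0 t := by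
    rw [intervalIntegrable_iff_integrableOn_Ioo_of_le ht]
    exact (integrable_duhamel hα hα'.le hl hP hPα hf (ht.trans htT)).mono_set
      (Ioo_subset_Ioo_right htT)
  have e1 : ∫ σ in (0 : ℝ)..t, f σ *
      (∫ ρ in (0 : ℝ)..(t - σ), rl (1 - α) (t - σ - ρ) * resolvent α l ρ) =
      ∫ σ in (0 : ℝ)..t, f σ * relaxation α l (t - σ) := by
    rw [intervalIntegral_eq_Ioo ht, intervalIntegral_eq_Ioo ht]
    refine setIntegral_congr_fun measurableSet_Ioo fun σ hσ => ?_
    rw [integral_rl_one_sub_mul_resolvent hα hα' hl (by linarith [hσ.2])]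
  have e2 : l * ∫ σ in (0 : ℝ)..t, f σ *
      (∫ ρ in (0 : ℝ)..(t - σ), rl 1 (t - σ - ρ) * resolvent α l ρ) =
      ∫ σ in (0 : ℝ)..t, (f σ - f σ * relaxation α l (t - σ)) := by
    rw [← intervalIntegral.integral_const_mul, intervalIntegral_eq_Ioo ht,
      intervalIntegral_eq_Ioo ht]
    refine setIntegral_congr_fun measurableSet_Ioo fun σ hσ => ?_
    have h3 := mul_integral_resolvent hα hl (t := t - σ) (by linarith [hσ.2])
    simp only [rl_one, one_mul]
    rw [mul_left_comm, h3]
    ring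
  rw [h1, e1, intervalIntegral.integral_sub hfi (hDi.const_mul l),
    intervalIntegral.integral_const_mul]
  simp only [rl_one, one_mul] at h2 e2
  rw [h2, e2, intervalIntegral.integral_sub hfi
    (intervalIntegrable_mul_relaxation hα hP hf ht htT)]
  ring

/-- The Duhamel integral solves the Volterra integral equation. -/
theorem duhamel_eq_fracIntegral (hα : 0 < α) (hα' : α ≤ 1) (hl : 0 ≤ l) (hP : 1 < P)
    (hPα : 1 / P < α) (hf : MemLp f (ENNReal.ofReal P) (timeMeasure T)) (ht : 0 ≤ t)
    (htT : t ≤ T) :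
    duhamel α l f t = ∫ τ in (0 : ℝ)..t, rl α (t - τ) * (f τ - l * duhamel α l f τ) := by
  have h1 := integral_rl_mul_duhamel hα hα' hl hP hPα hf ht htT hα
  have hG := Real.Gamma_pos_of_pos hα
  have hsing : ∀ g : ℝ → ℝ, MemLp g (ENNReal.ofReal P) (timeMeasure T) →
      IntervalIntegrable (fun τ => rl α (t - τ) * g τ) volume 0 t := by
    intro g hg
    rw [intervalIntegrable_iff_integrableOn_Ioc_of_le ht]
    refine ((integrableOn_sub_rpow_smul hP hPα ht htT hg).const_mul (Real.Gamma α)⁻¹).congr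
      (.of_forall fun τ => ?_)
    simp only [smul_eq_mul, rl]
    ring
  have hD : MemLp (duhamel α l f) (ENNReal.ofReal P) (timeMeasure T) := by
    have : IsFiniteMeasure (timeMeasure T) := by
      unfold timeMeasure
      infer_instance
    exact MemLp.of_bound (aestronglyMeasurable_duhamel hα hP hf (ht.trans htT)) _
      ((ae_restrict_mem measurableSet_Ioo).mono fun t ht =>
        abs_duhamel_le hα hα' hl hP hPα hf ht.1.le ht.2.le)
  -- The resolvent equation l(g_α * k) = g_α - k, convolved with f.
  have e1 : l * ∫ σ in (0 : ℝ)..t, f σ *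
      (∫ ρ in (0 : ℝ)..(t - σ), rl α (t - σ - ρ) * resolvent α l ρ) =
      ∫ σ in (0 : ℝ)..t, (rl α (t - σ) * f σ - f σ * resolvent α l (t - σ)) := by
    rw [← intervalIntegral.integral_const_mul, intervalIntegral_eq_Ioo ht,
      intervalIntegral_eq_Ioo ht]
    refine setIntegral_congr_fun measurableSet_Ioo fun σ hσ => ?_
    have h3 := integral_rl_self_mul_resolvent hα hl (t := t - σ) (by linarith [hσ.2])
    rw [mul_left_comm, h3]
    ring
  have e2 : ∫ τ in (0 : ℝ)..t, rl α (t - τ) * (f τ - l * duhamel α l f τ) =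
      (∫ τ in (0 : ℝ)..t, rl α (t - τ) * f τ) -
        l * ∫ τ in (0 : ℝ)..t, rl α (t - τ) * duhamel α l f τ := by
    rw [← intervalIntegral.integral_const_mul, ← intervalIntegral.integral_sub (hsing f hf)
      ((hsing _ hD).const_mul l)]
    congr 1
    funext τ
    ring
  rw [e2, h1, e1, intervalIntegral.integral_sub (hsing f hf)
    (intervalIntegrable_mul_resolvent hα hα' hl hP hPα hf ht htT), duhamel]
  ring

/-- The relaxation function solves the homogeneous fractional differential equation. -/
theorem fracIntegral_relaxation (hα : 0 < α) (hα' : α < 1) (hl : 0 ≤ l) (ht : 0 ≤ t) :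
    ∫ τ in (0 : ℝ)..t, rl (1 - α) (t - τ) * (relaxation α l τ - 1) =
      -(l * ∫ τ in (0 : ℝ)..t, relaxation α l τ) := by
  rcases ht.eq_or_lt with rfl | ht
  · simp
  have hα1 : 0 < 1 - α := sub_pos.2 hα'
  have hR : ∀ τ ∈ Ioo 0 t, HasSum (fun n : ℕ => (-l) ^ n * rl (α * n + 1) τ) (relaxation α l τ) :=
    fun τ hτ => hasSum_relaxation hα hτ.1
  have h1 := (hasSum_integral_rl_mul hα hl one_pos one_pos ht hR).mul_left (-l)
  -- Subtracting 1 from R deletes the term n = 0. After integration of order 1 - α, the term n+1 has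
  -- order αn + 2, as in the ordinary primitive of R.
  have h2 := (hasSum_nat_add_iff' 1).2 (hasSum_integral_rl_mul hα hl one_pos hα1 ht hR)
  have h3 := h1.unique (h2.congr_fun fun n => ?_)
  · have hi := intervalIntegrable_rl_sub hα1 ht.le
    simp only [mul_sub, mul_one]
    rw [intervalIntegral.integral_sub
      (hi.mul_continuousOn (continuous_relaxation hα).continuousOn) hi, integral_rl_sub hα1]
    simp only [rl_one, one_mul, Finset.range_one, Finset.sum_singleton, pow_zero, Nat.cast_zero,
      mul_zero, zero_add] at h3
    rw [add_comm (1 - α) 1]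
    linarith
  · push_cast
    rw [pow_succ]
    ring_nf

end Duhamel

/-! ### Orthogonal series and coefficient calculus -/

namespace EigenSystem

variable {k : ℕ} {D : TopologicalSpace.Opens (Euc k)} {L : EllipticOperator D}
  {bc : BoundaryCondition} (S : EigenSystem L bc)

open Classical in
/-- The element of `L²(D)` with the given square summable coefficients. -/
noncomputable def ofCoef (c : ℕ → ℝ) : L2 D :=
  if h : Memℓp c 2 then S.e.repr.symm ⟨c, h⟩ else 0

theorem inner_ofCoef {c : ℕ → ℝ} (h : Memℓp c 2) (j : ℕ) : ⟪S.e j, S.ofCoef c⟫_ℝ = c j := by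
  rw [ofCoef, dif_pos h, ← HilbertBasis.repr_apply_apply]
  simp

theorem memlp_inner (v : L2 D) : Memℓp (fun j => ⟪S.e j, v⟫_ℝ) 2 := by
  have h := (S.e.repr v).2
  have e1 : (fun j => ⟪S.e j, v⟫_ℝ) = (S.e.repr v : ℕ → ℝ) := by
    funext j
    rw [HilbertBasis.repr_apply_apply]
  rw [e1]
  exact h

theorem ext_inner {v w : L2 D} (h : ∀ j, ⟪S.e j, v⟫_ℝ = ⟪S.e j, w⟫_ℝ) : v = w := by
  apply S.e.repr.injective
  ext j
  rw [HilbertBasis.repr_apply_apply, HilbertBasis.repr_apply_apply, h]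

theorem ofCoef_inner (v : L2 D) : S.ofCoef (fun j => ⟪S.e j, v⟫_ℝ) = v :=
  S.ext_inner fun j => S.inner_ofCoef (S.memlp_inner v) j

theorem memlp_of_le {c d : ℕ → ℝ} {C : ℝ} (hd : Memℓp d 2) (h : ∀ j, |c j| ≤ C * |d j|) :
    Memℓp c 2 := by
  rw [memlp_iff] at hd ⊢
  refine Summable.of_nonneg_of_le (fun j => sq_nonneg _) (fun j => ?_) (hd.mul_left (C ^ 2))
  have h1 := pow_le_pow_left₀ (abs_nonneg _) (h j) 2
  rwa [mul_pow, sq_abs, sq_abs] at h1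

theorem norm_ofCoef_le {c d : ℕ → ℝ} {C : ℝ} (hC : 0 ≤ C) (hd : Memℓp d 2)
    (h : ∀ j, |c j| ≤ C * |d j|) : ‖S.ofCoef c‖ ≤ C * ‖S.ofCoef d‖ := by
  refine S.norm_le_of_inner_le hC fun j => ?_
  rw [S.inner_ofCoef (memlp_of_le hd h), S.inner_ofCoef hd]
  exact h j

theorem ofCoef_add {c d : ℕ → ℝ} (hc : Memℓp c 2) (hd : Memℓp d 2) :
    S.ofCoef (fun j => c j + d j) = S.ofCoef c + S.ofCoef d := by
  refine S.ext_inner fun j => ?_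
  rw [inner_add_right, S.inner_ofCoef hc, S.inner_ofCoef hd,
    S.inner_ofCoef (c := fun j => c j + d j) (hc.add hd)]

theorem ofCoef_sub {c d : ℕ → ℝ} (hc : Memℓp c 2) (hd : Memℓp d 2) :
    S.ofCoef (fun j => c j - d j) = S.ofCoef c - S.ofCoef d := by
  refine S.ext_inner fun j => ?_
  rw [inner_sub_right, S.inner_ofCoef hc, S.inner_ofCoef hd,
    S.inner_ofCoef (c := fun j => c j - d j) (hc.sub hd)]

theorem hasSum_ofCoef {c : ℕ → ℝ} (hc : Memℓp c 2) :
    HasSum (fun j => c j • S.e j) (S.ofCoef c) := by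
  have h := S.e.hasSum_repr (S.ofCoef c)
  refine h.congr_fun fun j => ?_
  rw [HilbertBasis.repr_apply_apply, S.inner_ofCoef hc]

theorem inner_sum_range (c : ℕ → ℝ) (n j : ℕ) :
    ⟪S.e j, ∑ i ∈ Finset.range n, c i • S.e i⟫_ℝ = if j < n then c j else 0 := by
  rw [inner_sum]
  simp_rw [inner_smul_right, orthonormal_iff_ite.1 S.e.orthonormal j]
  simp

theorem aestronglyMeasurable_of_coef {X : Type*} [MeasurableSpace X] {μ : Measure X}
    {f : X → L2 D} (h : ∀ j, AEStronglyMeasurable (fun t => ⟪S.e j, f t⟫_ℝ) μ) :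
    AEStronglyMeasurable f μ := by
  refine aestronglyMeasurable_of_tendsto_ae atTop
    (f := fun n t => ∑ j ∈ Finset.range n, ⟪S.e j, f t⟫_ℝ • S.e j) (fun n => ?_)
    (.of_forall fun t => ?_)
  · exact Finset.aestronglyMeasurable_fun_sum _ fun j _ => (h j).smul_const _
  · have h1 := (S.e.hasSum_repr (f t)).tendsto_sum_nat
    simpa only [HilbertBasis.repr_apply_apply] using h1

/-- The partial sums are continuous and converge uniformly at the rate δ. -/
theorem continuousOn_of_tail {f : ℝ → L2 D} {s : Set ℝ}
    (hc : ∀ j, ContinuousOn (fun t => ⟪S.e j, f t⟫_ℝ) s) {δ : ℕ → ℝ} (hδ : Tendsto δ atTop (𝓝 0))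
    (h : ∀ n, ∀ t ∈ s, ‖f t - ∑ j ∈ Finset.range n, ⟪S.e j, f t⟫_ℝ • S.e j‖ ≤ δ n) :
    ContinuousOn f s := by
  have hu : TendstoUniformlyOn
      (fun n t => ∑ j ∈ Finset.range n, ⟪S.e j, f t⟫_ℝ • S.e j) f atTop s := by
    rw [Metric.tendstoUniformlyOn_iff]
    intro ε hε
    filter_upwards [hδ.eventually (gt_mem_nhds hε)] with n hn t ht
    rw [dist_eq_norm]
    exact (h n t ht).trans_lt hn
  refine hu.continuousOn (Frequently.of_forall fun n => ?_)
  exact continuousOn_finsetSum _ fun j _ => (hc j).smul continuousOn_const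

/-- Dominated convergence of orthogonal series. -/
theorem continuousOn_of_dominated {f : ℝ → L2 D} {s : Set ℝ} (A : L2 D) {C : ℝ} (hC : 0 ≤ C)
    (hc : ∀ j, ContinuousOn (fun t => ⟪S.e j, f t⟫_ℝ) s)
    (h : ∀ t ∈ s, ∀ j, |⟪S.e j, f t⟫_ℝ| ≤ C * |⟪S.e j, A⟫_ℝ|) : ContinuousOn f s := by
  have h1 := (S.e.hasSum_repr A).tendsto_sum_nat
  simp only [HilbertBasis.repr_apply_apply] at h1
  have h2 := ((tendsto_const_nhds (x := A)).sub h1).norm.const_mul C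
  rw [sub_self, norm_zero, mul_zero] at h2
  refine S.continuousOn_of_tail hc h2 fun n t ht => S.norm_le_of_inner_le hC fun j => ?_
  rw [inner_sub_right, inner_sub_right, inner_sum_range, inner_sum_range]
  split_ifs
  · simp
  · simpa using h t ht j

/-! ### Powers of the eigenvalues -/

/-- The eigenvalues `m_j ^ β` of `𝓛 ^ β`. -/
noncomputable def lam (β : ℝ) (j : ℕ) : ℝ := S.m j ^ β

variable {β : ℝ}

theorem lam_pos (β : ℝ) (j : ℕ) : 0 < S.lam β j := Real.rpow_pos_of_pos (S.m_pos_all j) _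

theorem lam_zero_le (hβ : 0 ≤ β) (j : ℕ) : S.lam β 0 ≤ S.lam β j :=
  Real.rpow_le_rpow S.m_pos.le (S.m_mono (Nat.zero_le j)) hβ

theorem lam_mono (hβ : 0 ≤ β) : Monotone (S.lam β) := fun _ _ h =>
  Real.rpow_le_rpow (S.m_pos_all _).le (S.m_mono h) hβ

theorem lam_rpow (β θ : ℝ) (j : ℕ) : S.lam β j ^ θ = S.m j ^ (β * θ) :=
  (Real.rpow_mul (S.m_pos_all j).le _ _).symm

theorem lam_rpow_le (hβ : 0 ≤ β) {γ δ : ℝ} (h : γ ≤ δ) (j : ℕ) :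
    S.lam β j ^ γ ≤ S.lam β 0 ^ (γ - δ) * S.lam β j ^ δ := by
  have h1 : S.lam β j ^ γ = S.lam β j ^ (γ - δ) * S.lam β j ^ δ := by
    rw [← Real.rpow_add (S.lam_pos β j)]
    ring_nf
  rw [h1]
  exact mul_le_mul_of_nonneg_right (Real.rpow_le_rpow_of_nonpos (S.lam_pos β 0)
    (S.lam_zero_le hβ j) (by linarith)) (Real.rpow_nonneg (S.lam_pos β j).le _)

theorem tendsto_lam_rpow (hβ : 0 < β) {ε : ℝ} (hε : 0 < ε) :
    Tendsto (fun j => S.lam β j ^ (-ε)) atTop (𝓝 0) :=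
  (tendsto_rpow_neg_atTop hε).comp ((tendsto_rpow_atTop hβ).comp S.m_tendsto)

theorem abs_lam_rpow_mul_le (hβ : 0 ≤ β) {γ δ : ℝ} (h : γ ≤ δ) (c : ℕ → ℝ) (j : ℕ) :
    |S.lam β j ^ γ * c j| ≤ S.lam β 0 ^ (γ - δ) * |S.lam β j ^ δ * c j| := by
  rw [abs_mul, abs_mul, abs_of_pos (Real.rpow_pos_of_pos (S.lam_pos β j) _),
    abs_of_pos (Real.rpow_pos_of_pos (S.lam_pos β j) _), ← mul_assoc]
  exact mul_le_mul_of_nonneg_right (S.lam_rpow_le hβ h j) (abs_nonneg _)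

theorem memlp_lam_mono (hβ : 0 ≤ β) {γ δ : ℝ} (h : γ ≤ δ) {c : ℕ → ℝ}
    (hc : Memℓp (fun j => S.lam β j ^ δ * c j) 2) : Memℓp (fun j => S.lam β j ^ γ * c j) 2 :=
  memlp_of_le hc fun j => S.abs_lam_rpow_mul_le hβ h c j

theorem norm_ofCoef_lam_le (hβ : 0 ≤ β) {γ δ : ℝ} (h : γ ≤ δ) {c : ℕ → ℝ}
    (hc : Memℓp (fun j => S.lam β j ^ δ * c j) 2) :
    ‖S.ofCoef (fun j => S.lam β j ^ γ * c j)‖ ≤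
      S.lam β 0 ^ (γ - δ) * ‖S.ofCoef (fun j => S.lam β j ^ δ * c j)‖ :=
  S.norm_ofCoef_le (Real.rpow_nonneg (S.lam_pos β 0).le _) hc
    fun j => S.abs_lam_rpow_mul_le hβ h c j

/-- Boundedness in a stronger norm and continuity of the coefficients imply continuity. -/
theorem continuousOn_ofCoef_of_bounded (hβ : 0 < β) {γ δ : ℝ} (h : γ < δ) {c : ℝ → ℕ → ℝ}
    {s : Set ℝ} (hc : ∀ t ∈ s, Memℓp (fun j => S.lam β j ^ δ * c t j) 2)
    (hcont : ∀ j, ContinuousOn (fun t => c t j) s) {M : ℝ}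
    (hM : ∀ t ∈ s, ‖S.ofCoef (fun j => S.lam β j ^ δ * c t j)‖ ≤ M) :
    ContinuousOn (fun t => S.ofCoef (fun j => S.lam β j ^ γ * c t j)) s := by
  -- Since λ_n → ∞, the gap δ - γ makes the tail beyond n at most λ_n^(-(δ-γ)) M, uniformly in t.
  have hδ := (S.tendsto_lam_rpow hβ (sub_pos.2 h)).mul_const M
  rw [zero_mul] at hδ
  have hin : ∀ t ∈ s, ∀ j, ⟪S.e j, S.ofCoef (fun j => S.lam β j ^ γ * c t j)⟫_ℝ =
      S.lam β j ^ γ * c t j := fun t ht j =>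
    S.inner_ofCoef (S.memlp_lam_mono hβ.le h.le (hc t ht)) j
  refine S.continuousOn_of_tail (fun j => ?_) hδ fun n t ht => ?_
  · exact (continuousOn_const.mul (hcont j)).congr fun t ht => hin t ht j
  · refine (S.norm_le_of_inner_le (w := S.ofCoef (fun j => S.lam β j ^ δ * c t j))
      (C := S.lam β n ^ (-(δ - γ))) (Real.rpow_nonneg (S.lam_pos β n).le _) fun j => ?_).trans
      (mul_le_mul_of_nonneg_left (hM t ht) (Real.rpow_nonneg (S.lam_pos β n).le _))
    rw [inner_sub_right, inner_sum_range, S.inner_ofCoef (hc t ht), hin t ht]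
    split_ifs with hj
    · rw [sub_self, abs_zero]
      exact mul_nonneg (Real.rpow_nonneg (S.lam_pos β n).le _) (abs_nonneg _)
    · have e1 : S.lam β j ^ γ = S.lam β j ^ (-(δ - γ)) * S.lam β j ^ δ := by
        rw [← Real.rpow_add (S.lam_pos β j)]
        ring_nf
      rw [sub_zero, e1, mul_assoc, abs_mul, abs_of_pos (Real.rpow_pos_of_pos (S.lam_pos β j) _)]
      exact mul_le_mul_of_nonneg_right (Real.rpow_le_rpow_of_nonpos (S.lam_pos β n)
        (S.lam_mono hβ.le (not_lt.1 hj)) (by linarith)) (abs_nonneg _)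

/-! ### Identification with the spaces `V_γ` and their duals -/

variable {γ δ : ℝ}

theorem memlp_rpow_mul_inner (hγ : γ ≤ 0) (v : L2 D) :
    Memℓp (fun j => S.m j ^ γ * ⟪S.e j, v⟫_ℝ) 2 := by
  refine memlp_of_le (C := S.m 0 ^ γ) (S.memlp_inner v) fun j => ?_
  rw [abs_mul, abs_of_pos (Real.rpow_pos_of_pos (S.m_pos_all j) _)]
  exact mul_le_mul_of_nonneg_right (Real.rpow_le_rpow_of_nonpos S.m_pos
    (S.m_mono (Nat.zero_le j)) hγ) (abs_nonneg _)

theorem rpow_mul_inner_ofCoef (hγ : 0 ≤ γ) (v : L2 D) (j : ℕ) :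
    S.m j ^ γ * ⟪S.e j, S.ofCoef (fun j => S.m j ^ (-γ) * ⟪S.e j, v⟫_ℝ)⟫_ℝ = ⟪S.e j, v⟫_ℝ := by
  rw [S.inner_ofCoef (S.memlp_rpow_mul_inner (by linarith) v), ← mul_assoc,
    ← Real.rpow_add (S.m_pos_all j), add_neg_cancel, Real.rpow_zero, one_mul]

theorem ofCoef_mem_domain (hγ : 0 ≤ γ) (v : L2 D) :
    S.ofCoef (fun j => S.m j ^ (-γ) * ⟪S.e j, v⟫_ℝ) ∈ S.domain γ := by
  change Summable fun j => S.coef γ _ j ^ 2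
  simp only [coef, S.rpow_mul_inner_ofCoef hγ]
  exact (memlp_iff _).1 (S.memlp_inner v)

/-- The isometry `𝓛 ^ (-γ) : L²(D) → V_γ`, as a linear map. -/
noncomputable def toVLin (hγ : 0 ≤ γ) : L2 D →ₗ[ℝ] S.V γ where
  toFun v := S.mkV _ (S.ofCoef_mem_domain hγ v)
  map_add' v w := S.val_injective (by
    rw [map_add S.val (S.mkV _ _), val_mkV, val_mkV, val_mkV, ← S.ofCoef_add
      (S.memlp_rpow_mul_inner (by linarith) v) (S.memlp_rpow_mul_inner (by linarith) w)]
    simp only [inner_add_right, mul_add])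
  map_smul' c v := S.val_injective (by
    rw [RingHom.id_apply, map_smul S.val c (S.mkV _ _), val_mkV, val_mkV]
    refine S.ext_inner fun j => ?_
    rw [inner_smul_right, S.inner_ofCoef (S.memlp_rpow_mul_inner (by linarith) _),
      S.inner_ofCoef (S.memlp_rpow_mul_inner (by linarith) _), inner_smul_right]
    ring)

theorem val_toVLin (hγ : 0 ≤ γ) (v : L2 D) :
    S.val (S.toVLin hγ v) = S.ofCoef (fun j => S.m j ^ (-γ) * ⟪S.e j, v⟫_ℝ) := rfl

theorem fracPow_toVLin (hγ : 0 ≤ γ) (v : L2 D) : S.fracPow γ (S.toVLin hγ v) = v := by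
  refine S.ext_inner fun j => ?_
  rw [inner_fracPow, val_toVLin, S.rpow_mul_inner_ofCoef hγ]

/-- The isometry `𝓛 ^ (-γ) : L²(D) → V_γ`. -/
noncomputable def toV (hγ : 0 ≤ γ) : L2 D →L[ℝ] S.V γ :=
  (S.toVLin hγ).mkContinuous 1 fun v => by
    rw [norm_def, fracPow_toVLin, one_mul]

theorem val_toV (hγ : 0 ≤ γ) (v : L2 D) :
    S.val (S.toV hγ v) = S.ofCoef (fun j => S.m j ^ (-γ) * ⟪S.e j, v⟫_ℝ) := rfl

/-- The fractional power `𝓛 ^ γ : V_γ → L²(D)` as a continuous linear map. -/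
noncomputable def fracPowL (γ : ℝ) : S.V γ →L[ℝ] L2 D :=
  (S.fracPow γ).mkContinuous 1 fun v => by rw [norm_def, one_mul]

/-- The map `𝓛 ^ γ : L²(D) → V_{-γ}`. -/
noncomputable def toDual (γ : ℝ) : L2 D →L[ℝ] S.VDual γ :=
  ((ContinuousLinearMap.compL ℝ (S.V γ) (L2 D) ℝ).flip (S.fracPowL γ)).comp (innerSL ℝ)

theorem toDual_apply (g : L2 D) (v : S.V γ) : S.toDual γ g v = ⟪g, S.fracPow γ v⟫_ℝ := rfl

theorem norm_toDual_le (g : L2 D) : ‖S.toDual γ g‖ ≤ ‖g‖ :=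
  ContinuousLinearMap.opNorm_le_bound _ (norm_nonneg _) fun v => by
    rw [toDual_apply, norm_def]
    exact norm_inner_le_norm _ _

/-- On coefficients, the pairing is unchanged when m_j^(-γ) is moved to one side and m_j^γ to the
other. Dual norms are thereby controlled by L² norms of weighted coefficient sequences. -/
theorem embed_eq_toDual (hγ : 0 ≤ γ) (g : L2 D) :
    S.embed hγ g = S.toDual γ (S.ofCoef fun j => S.m j ^ (-γ) * ⟪S.e j, g⟫_ℝ) := by
  ext v
  rw [embed_apply, toDual_apply]
  refine (S.e.hasSum_inner_mul_inner g (S.val v)).unique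
    ((S.e.hasSum_inner_mul_inner _ (S.fracPow γ v)).congr_fun fun j => ?_)
  rw [real_inner_comm (S.e j), real_inner_comm (S.e j) (S.ofCoef _), inner_fracPow,
    S.inner_ofCoef (S.memlp_rpow_mul_inner (by linarith) g)]
  have : S.m j ^ (-γ) * S.m j ^ γ = 1 := by
    rw [← Real.rpow_add (S.m_pos_all j), neg_add_cancel, Real.rpow_zero]
  linear_combination -(⟪S.e j, g⟫_ℝ * ⟪S.e j, S.val v⟫_ℝ) * this

theorem restrict_toDual (h : γ ≤ δ) (g : L2 D) :
    S.restrict h (S.toDual γ g) =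
      S.toDual δ (S.ofCoef fun j => S.m j ^ (γ - δ) * ⟪S.e j, g⟫_ℝ) := by
  ext v
  change S.toDual γ g (S.inclusion h v) = _
  rw [toDual_apply, toDual_apply]
  refine (S.e.hasSum_inner_mul_inner g _).unique
    ((S.e.hasSum_inner_mul_inner _ (S.fracPow δ v)).congr_fun fun j => ?_)
  rw [real_inner_comm (S.e j), real_inner_comm (S.e j) (S.ofCoef _), inner_fracPow,
    inner_fracPow, val_inclusion,
    S.inner_ofCoef (S.memlp_rpow_mul_inner (by linarith) g)]
  have : S.m j ^ (γ - δ) * S.m j ^ δ = S.m j ^ γ := by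
    rw [← Real.rpow_add (S.m_pos_all j), sub_add_cancel]
  linear_combination -(⟪S.e j, g⟫_ℝ * ⟪S.e j, S.val v⟫_ℝ) * this

end EigenSystem

/-! ### The source term O₁ in weighted spaces -/

theorem inner_fracIntegral {H : Type*} [NormedAddCommGroup H] [InnerProductSpace ℝ H]
    [CompleteSpace H] {P T d t : ℝ} {X : ℝ → H} (hP : 1 < P) (hd : 1 / P < d) (ht : 0 ≤ t)
    (htT : t ≤ T) (hX : MemLp X (ENNReal.ofReal P) (timeMeasure T)) (v : H) :
    ⟪v, fracIntegral d X t⟫_ℝ = ∫ τ in (0 : ℝ)..t, rl d (t - τ) * ⟪v, X τ⟫_ℝ := by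
  rw [fracIntegral, inner_smul_right, intervalIntegral.integral_of_le ht,
    intervalIntegral.integral_of_le ht, ← integral_inner
      (integrableOn_sub_rpow_smul hP hd ht htT hX), ← integral_const_mul]
  congr 1
  funext τ
  rw [inner_smul_right, rl]
  ring

theorem isFiniteMeasure_timeMeasure (T : ℝ) : IsFiniteMeasure (timeMeasure T) := by
  unfold timeMeasure
  infer_instance

namespace EigenSystem

variable {k : ℕ} {D : TopologicalSpace.Opens (Euc k)} {L : EllipticOperator D}
  {bc : BoundaryCondition} (S : EigenSystem L bc)

variable {α β T P θ : ℝ} {F : ℝ → L2 D}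

/-- The coefficients of `O₁(t) F`. -/
noncomputable def duhCoef (α β : ℝ) (F : ℝ → L2 D) (t : ℝ) (j : ℕ) : ℝ :=
  duhamel α (S.lam β j) (fun τ => ⟪S.e j, F τ⟫_ℝ) t

theorem memLp_coef (hF : MemLp F (ENNReal.ofReal P) (timeMeasure T)) (j : ℕ) :
    MemLp (fun τ => ⟪S.e j, F τ⟫_ℝ) (ENNReal.ofReal P) (timeMeasure T) :=
  hF.const_inner _

/-- The constant in the smoothing estimate for `O₁`. -/
noncomputable def duhConst (α P T θ : ℝ) : ℝ :=
  ((Real.Gamma α)⁻¹ + α) * (singularConst P (α * (1 - θ)) * T ^ (α * (1 - θ) - 1 / P))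

theorem duhConst_nonneg (hα : 0 < α) (hP : 1 < P) (hT : 0 < T) (hθ : 1 / P < α * (1 - θ)) :
    0 ≤ duhConst α P T θ := by
  have := singularConst_nonneg hP hθ
  have := Real.Gamma_pos_of_pos hα
  unfold duhConst
  positivity

/-- Smoothing property of `O₁`. -/
theorem exists_duhCoef_bound (hα : 0 < α) (hα' : α ≤ 1) (hP : 1 < P)
    (h0 : 0 ≤ θ) (h1 : θ ≤ 1) (hθ : 1 / P < α * (1 - θ))
    (hF : MemLp F (ENNReal.ofReal P) (timeMeasure T)) {t : ℝ} (ht : 0 ≤ t) (htT : t ≤ T) :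
    Memℓp (fun j => S.lam β j ^ θ * S.duhCoef α β F t j) 2 ∧
      ‖S.ofCoef (fun j => S.lam β j ^ θ * S.duhCoef α β F t j)‖ ≤
        duhConst α P T θ * (eLpNorm F (ENNReal.ofReal P) (timeMeasure T)).toReal := by
  set d := α * (1 - θ) with hd
  set C := (Real.Gamma α)⁻¹ + α with hC
  have hC0 : 0 < C := by
    have := Real.Gamma_pos_of_pos hα
    positivity
  -- The weighted coefficients are assembled into an L²(D)-valued integrand of norm at most C
  -- (t-τ)^(d-1) ‖F(τ)‖. The norm of its Bochner integral is then estimated at once, without summing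
  -- bounds for separate coefficients.
  set c : ℝ → ℕ → ℝ := fun τ j =>
    S.lam β j ^ θ * (⟪S.e j, F τ⟫_ℝ * resolvent α (S.lam β j) (t - τ)) with hc
  have hcle : ∀ τ ∈ Ioo 0 t, ∀ j, |c τ j| ≤ C * (t - τ) ^ (d - 1) * |⟪S.e j, F τ⟫_ℝ| := by
    intro τ hτ j
    have hτ0 : 0 < t - τ := by linarith [hτ.2]
    have h2 := rpow_mul_resolvent_le hα hα' (S.lam_pos β j) hτ0 h0 h1
    have h3 : 0 < S.lam β j ^ θ := Real.rpow_pos_of_pos (S.lam_pos β j) _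
    rw [hc]
    simp only [abs_mul]
    rw [abs_of_pos h3, abs_of_pos (resolvent_pos hα hα' (S.lam_pos β j).le hτ0), mul_left_comm,
      mul_comm]
    exact mul_le_mul_of_nonneg_right h2 (abs_nonneg _)
  have hmem : ∀ τ ∈ Ioo 0 t, Memℓp (c τ) 2 := fun τ hτ =>
    memlp_of_le (S.memlp_inner (F τ)) (hcle τ hτ)
  have hG : ∀ τ ∈ Ioo 0 t, ‖S.ofCoef (c τ)‖ ≤ C * ((t - τ) ^ (d - 1) * ‖F τ‖) := by
    intro τ hτ
    have hτ0 : 0 ≤ t - τ := by linarith [hτ.2]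
    have h2 := S.norm_ofCoef_le (by positivity) (S.memlp_inner (F τ)) (hcle τ hτ)
    rwa [S.ofCoef_inner, mul_assoc] at h2
  have hFm := hF.1.mono_measure (restrict_Ioo_le_timeMeasure le_rfl htT)
  have hmeas : AEStronglyMeasurable (fun τ => S.ofCoef (c τ)) (volume.restrict (Ioo 0 t)) := by
    refine S.aestronglyMeasurable_of_coef fun j => ?_
    have hm : AEStronglyMeasurable (fun τ => c τ j) (volume.restrict (Ioo 0 t)) :=
      (((hFm.const_inner (c := S.e j)).mul ((measurable_resolvent hα).comp
        (measurable_const.sub measurable_id)).aestronglyMeasurable)).const_mul (S.lam β j ^ θ)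
    refine hm.congr ((ae_restrict_mem measurableSet_Ioo).mono fun τ hτ => ?_)
    exact (S.inner_ofCoef (hmem τ hτ) j).symm
  have hsing := integral_sub_rpow_mul_norm_le hP hθ le_rfl ht htT hF
  have hint : IntegrableOn (fun τ => S.ofCoef (c τ)) (Ioo 0 t) :=
    (hsing.1.const_mul C).mono' hmeas ((ae_restrict_mem measurableSet_Ioo).mono hG)
  have hcoef : ∀ j, ⟪S.e j, ∫ τ in Ioo 0 t, S.ofCoef (c τ)⟫_ℝ =
      S.lam β j ^ θ * S.duhCoef α β F t j := by
    intro j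
    rw [← integral_inner hint, duhCoef, duhamel, intervalIntegral_eq_Ioo ht, ← integral_const_mul]
    exact setIntegral_congr_fun measurableSet_Ioo fun τ hτ => S.inner_ofCoef (hmem τ hτ) j
  simp_rw [← hcoef]
  refine ⟨S.memlp_inner _, ?_⟩
  rw [S.ofCoef_inner]
  refine (norm_integral_le_integral_norm _).trans ?_
  refine (setIntegral_mono_on hint.norm (hsing.1.const_mul C) measurableSet_Ioo hG).trans ?_
  rw [integral_const_mul, duhConst, mul_assoc C]
  refine mul_le_mul_of_nonneg_left (hsing.2.trans ?_) hC0.le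
  have := singularConst_nonneg hP hθ
  have h5 : (t - 0) ^ (d - 1 / P) ≤ T ^ (d - 1 / P) :=
    Real.rpow_le_rpow (by linarith) (by linarith) (by linarith)
  gcongr

/-- By the Volterra equation each coefficient is the fractional integral of order α of an L^P
function, hence Hölder continuous with exponent α - 1/P, up to both endpoints. -/
theorem continuousOn_duhCoef (hα : 0 < α) (hα' : α ≤ 1) (hP : 1 < P) (hPα : 1 / P < α)
    (hF : MemLp F (ENNReal.ofReal P) (timeMeasure T)) (j : ℕ) :
    ContinuousOn (fun t => S.duhCoef α β F t j) (Icc 0 T) := by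
  rcases lt_or_ge T 0 with hT | hT
  · rw [Icc_eq_empty (by linarith)]
    exact continuousOn_empty _
  have hf := S.memLp_coef hF j
  have hl := (S.lam_pos β j).le
  have := isFiniteMeasure_timeMeasure T
  have hD : MemLp (duhamel α (S.lam β j) fun τ => ⟪S.e j, F τ⟫_ℝ) (ENNReal.ofReal P)
      (timeMeasure T) :=
    MemLp.of_bound (aestronglyMeasurable_duhamel hα hP hf hT) _
      ((ae_restrict_mem measurableSet_Ioo).mono fun t ht =>
        abs_duhamel_le hα hα' hl hP hPα hf ht.1.le ht.2.le)
  have hX := hf.sub (hD.const_mul (S.lam β j))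
  set X := (fun τ => ⟪S.e j, F τ⟫_ℝ) - fun τ => S.lam β j *
    duhamel α (S.lam β j) (fun τ => ⟪S.e j, F τ⟫_ℝ) τ with hXdef
  have heq : ∀ t ∈ Icc 0 T, S.duhCoef α β F t j = fracIntegral α X t := by
    intro t ht
    rw [duhCoef, duhamel_eq_fracIntegral hα hα' hl hP hPα hf ht.1 ht.2, fracIntegral,
      smul_eq_mul, ← intervalIntegral.integral_const_mul]
    congr 1
    funext τ
    simp only [rl, hXdef, Pi.sub_apply, smul_eq_mul]
    ring
  refine ContinuousOn.congr ?_ heq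
  have he : 0 < α - 1 / P := by linarith
  set K := 2 * (Real.Gamma α)⁻¹ * singularConst P α *
    (eLpNorm X (ENNReal.ofReal P) (timeMeasure T)).toReal with hK
  have hle : ∀ a ∈ Icc 0 T, ∀ b ∈ Icc 0 T, ‖fracIntegral α X b - fracIntegral α X a‖ ≤
      K * |b - a| ^ (α - 1 / P) := by
    intro a ha b hb
    rcases le_total a b with h | h
    · refine (norm_fracIntegral_sub_le hP hPα hα' ha.1 h hb.2 hX).trans (le_of_eq ?_)
      rw [abs_of_nonneg (by linarith), hK]
      ring
    · rw [norm_sub_rev]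
      refine (norm_fracIntegral_sub_le hP hPα hα' hb.1 h ha.2 hX).trans (le_of_eq ?_)
      rw [abs_sub_comm, abs_of_nonneg (by linarith), hK]
      ring
  intro a ha
  rw [ContinuousWithinAt, tendsto_iff_norm_sub_tendsto_zero]
  have hlim : Tendsto (fun b => K * |b - a| ^ (α - 1 / P)) (𝓝[Icc 0 T] a) (𝓝 0) := by
    have hc : Continuous fun b : ℝ => K * |b - a| ^ (α - 1 / P) :=
      continuous_const.mul ((Real.continuous_rpow_const he.le).comp (by fun_prop))
    have h2 := (hc.tendsto a).mono_left (nhdsWithin_le_nhds (s := Icc 0 T))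
    simp only [sub_self, abs_zero, Real.zero_rpow he.ne', mul_zero] at h2
    exact h2
  refine squeeze_zero' (.of_forall fun _ => norm_nonneg _) ?_ hlim
  filter_upwards [self_mem_nhdsWithin] with b hb
  exact hle a ha b hb

/-- Time regularity of `O₁` in a negative space. -/
theorem exists_holder_duhCoef (hα : 0 < α) (hα' : α ≤ 1) (hβ : 0 < β) (hP : 1 < P)
    {p q s : ℝ} (hp : 0 ≤ p) (hq : 0 ≤ q) (hpq : p + q = 1) (hPq : 1 / P < α * q)
    (hs : 0 < s) (hsP : s ≤ α - 1 / P) (hT : 0 ≤ T)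
    (hF : MemLp F (ENNReal.ofReal P) (timeMeasure T)) :
    ∃ K : ℝ, 0 ≤ K ∧ ∀ a b, 0 ≤ a → a ≤ b → b ≤ T →
      ‖S.ofCoef (fun j => S.lam β j ^ (-q) * S.duhCoef α β F b j) -
        S.ofCoef (fun j => S.lam β j ^ (-q) * S.duhCoef α β F a j)‖ ≤ K * (b - a) ^ s := by
  have hPα : 1 / P < α := by nlinarith
  have hp1 : p ≤ 1 := by linarith
  have hq1 : 1 / P < α * (1 - p) := by
    rwa [show 1 - p = q by linarith]
  have hbd := fun t (ht : t ∈ Icc 0 T) => S.exists_duhCoef_bound (β := β) hα hα' hP hp hp1 hq1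
    hF ht.1 ht.2
  have := isFiniteMeasure_timeMeasure T
  -- The weight λ^(-q) turns the Volterra equation into O₁ = I^α(Z - Y): Z is the weighted source,
  -- and Y carries λ^(1-q) = λ^p, for which the smoothing estimate gives boundedness.
  set Y : ℝ → L2 D := fun τ => S.ofCoef (fun j => S.lam β j ^ p * S.duhCoef α β F τ j) with hY
  set Z : ℝ → L2 D := fun τ => S.ofCoef (fun j => S.lam β j ^ (-q) * ⟪S.e j, F τ⟫_ℝ) with hZ
  have hYm : MemLp Y (ENNReal.ofReal P) (timeMeasure T) := by
    refine MemLp.of_bound (S.aestronglyMeasurable_of_coef fun j => ?_) _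
      ((ae_restrict_mem measurableSet_Ioo).mono fun t ht => (hbd t ⟨ht.1.le, ht.2.le⟩).2)
    refine ((aestronglyMeasurable_duhamel (l := S.lam β j) hα hP (S.memLp_coef hF j) hT).const_mul
      (S.lam β j ^ p)).congr ((ae_restrict_mem measurableSet_Ioo).mono fun t ht => ?_)
    exact (S.inner_ofCoef (hbd t ⟨ht.1.le, ht.2.le⟩).1 j).symm
  have hZc : ∀ τ, Memℓp (fun j => S.lam β j ^ (-q) * ⟪S.e j, F τ⟫_ℝ) 2 := fun τ =>
    S.memlp_lam_mono hβ.le (δ := 0) (by linarith) (by simpa using S.memlp_inner (F τ))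
  have hZm : MemLp Z (ENNReal.ofReal P) (timeMeasure T) := by
    refine hF.of_le_mul (c := S.lam β 0 ^ (-q - 0)) (S.aestronglyMeasurable_of_coef fun j => ?_)
      (.of_forall fun τ => ?_)
    · simp_rw [hZ, S.inner_ofCoef (hZc _)]
      exact ((S.memLp_coef hF j).1.const_mul _)
    · refine (S.norm_ofCoef_lam_le hβ.le (γ := -q) (δ := 0) (by linarith)
        (by simpa using S.memlp_inner (F τ))).trans (le_of_eq ?_)
      simp only [Real.rpow_zero, one_mul]
      rw [S.ofCoef_inner]
  have hX := hZm.sub hYm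
  have heq : ∀ t ∈ Icc 0 T, S.ofCoef (fun j => S.lam β j ^ (-q) * S.duhCoef α β F t j) =
      fracIntegral α (Z - Y) t := by
    intro t ht
    refine S.ext_inner fun j => ?_
    rw [inner_fracIntegral hP hPα ht.1 ht.2 hX,
      S.inner_ofCoef (S.memlp_lam_mono hβ.le (by linarith) (hbd t ht).1), duhCoef,
      duhamel_eq_fracIntegral hα hα' (S.lam_pos β j).le hP hPα (S.memLp_coef hF j) ht.1 ht.2,
      ← intervalIntegral.integral_const_mul, intervalIntegral.integral_of_le ht.1,
      intervalIntegral.integral_of_le ht.1]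
    refine setIntegral_congr_fun measurableSet_Ioc fun τ hτ => ?_
    have h1 : S.lam β j ^ p = S.lam β j ^ (-q) * S.lam β j := by
      rw [← Real.rpow_add_one (S.lam_pos β j).ne', ← hpq]
      ring_nf
    simp only [Pi.sub_apply, inner_sub_right, hZ, hY]
    rw [S.inner_ofCoef (hZc τ), S.inner_ofCoef (hbd τ ⟨hτ.1.le, hτ.2.trans ht.2⟩).1, h1, duhCoef]
    ring
  have hG := Real.Gamma_pos_of_pos hα
  have hsc := singularConst_nonneg hP hPα
  refine ⟨2 * (Real.Gamma α)⁻¹ * singularConst P α * T ^ (α - 1 / P - s) *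
    (eLpNorm (Z - Y) (ENNReal.ofReal P) (timeMeasure T)).toReal, by positivity, ?_⟩
  intro a b ha hab hb
  rw [heq a ⟨ha, hab.trans hb⟩, heq b ⟨ha.trans hab, hb⟩]
  refine (norm_fracIntegral_sub_le hP hPα hα' ha hab hb hX).trans ?_
  have h2 : (b - a) ^ (α - 1 / P) ≤ T ^ (α - 1 / P - s) * (b - a) ^ s := by
    have h0 : 0 ≤ b - a := by linarith
    calc (b - a) ^ (α - 1 / P) = (b - a) ^ (α - 1 / P - s) * (b - a) ^ s := by
          rw [← Real.rpow_add_of_nonneg h0 (by linarith) hs.le]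
          ring_nf
      _ ≤ _ := by
          gcongr
          linarith
  calc _ ≤ 2 * (Real.Gamma α)⁻¹ * singularConst P α * (T ^ (α - 1 / P - s) * (b - a) ^ s) *
        (eLpNorm (Z - Y) (ENNReal.ofReal P) (timeMeasure T)).toReal := by gcongr
    _ = _ := by ring

/-! ### The homogeneous part -/

/-- The coefficients of `O₂(t) ψ`. -/
noncomputable def relCoef (α β T : ℝ) (ψ : ℕ → ℝ) (t : ℝ) (j : ℕ) : ℝ :=
  relaxation α (S.lam β j) t / relaxation α (S.lam β j) T * ψ j

variable {ψ : ℕ → ℝ}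

theorem continuous_relCoef (hα : 0 < α) (j : ℕ) : Continuous fun t => S.relCoef α β T ψ t j :=
  ((continuous_relaxation hα).div_const _).mul_const _

/-- Bookkeeping of powers: dividing by R(T) costs one power of λ and x contributes λ^(τ-1), so the
weight λ^θ needs λ^(θ+τ) on the data. The choices τ = 1-σ, 1 and 1+s/α give decay, boundedness and
Hölder continuity of O₂. -/
theorem exists_abs_div_relaxation_le (hα : 0 < α) (hα' : α < 1) (hβ : 0 < β) (hT : 0 < T)
    {θ τ ρ : ℝ} (h : θ + τ ≤ ρ) :
    ∃ C : ℝ, 0 ≤ C ∧ ∀ (x A : ℝ) (ψ : ℕ → ℝ) (j : ℕ), 0 ≤ A →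
      |x| ≤ A * S.lam β j ^ (τ - 1) →
      |S.lam β j ^ θ * (x / relaxation α (S.lam β j) T * ψ j)| ≤
        C * A * |S.lam β j ^ ρ * ψ j| := by
  set c := (S.lam β 0)⁻¹ + Real.Gamma (1 - α) * T ^ α with hc
  have hc0 : 0 < c := by
    have := S.lam_pos β 0
    have := Real.Gamma_pos_of_pos (sub_pos.2 hα')
    positivity
  have hl0 := S.lam_pos β 0
  refine ⟨c * S.lam β 0 ^ (θ + τ - ρ), by positivity, fun x A ψ j hA hx => ?_⟩
  have hl := S.lam_pos β j
  have hR := relaxation_pos hα hα'.le hl.le hT.le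
  have h1 := inv_relaxation_le hα hα' hl0 (S.lam_zero_le hβ.le j) hT
  have h2 := S.abs_lam_rpow_mul_le hβ.le h ψ j
  have hp : 0 < S.lam β j ^ θ := Real.rpow_pos_of_pos hl _
  have hp' : 0 < S.lam β j ^ (τ - 1) := Real.rpow_pos_of_pos hl _
  rw [abs_mul, abs_mul, abs_div, abs_of_pos hp, abs_of_pos hR, div_eq_mul_inv]
  calc S.lam β j ^ θ * (|x| * (relaxation α (S.lam β j) T)⁻¹ * |ψ j|)
      ≤ S.lam β j ^ θ * (A * S.lam β j ^ (τ - 1) * (c * S.lam β j) * |ψ j|) := by gcongr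
    _ = c * A * (S.lam β j ^ θ * (S.lam β j ^ (τ - 1) * S.lam β j) * |ψ j|) := by ring
    _ = c * A * |S.lam β j ^ (θ + τ) * ψ j| := by
        rw [← Real.rpow_add_one hl.ne', sub_add_cancel, ← Real.rpow_add hl, abs_mul,
          abs_of_pos (Real.rpow_pos_of_pos hl (θ + τ))]
    _ ≤ c * A * (S.lam β 0 ^ (θ + τ - ρ) * |S.lam β j ^ ρ * ψ j|) := by gcongr
    _ = _ := by ring

/-- Smoothing property of `O₂`. -/
theorem exists_relCoef_bound (hα : 0 < α) (hα' : α < 1) (hβ : 0 < β) (hT : 0 < T)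
    {θ σ ρ : ℝ} (h0 : 0 ≤ σ) (h1 : σ ≤ 1) (h : θ + (1 - σ) ≤ ρ) :
    ∃ C : ℝ, 0 ≤ C ∧ ∀ (ψ : ℕ → ℝ) (t : ℝ) (j : ℕ), 0 < t →
      |S.lam β j ^ θ * S.relCoef α β T ψ t j| ≤
        C * t ^ (-(α * σ)) * |S.lam β j ^ ρ * ψ j| := by
  obtain ⟨C, hC, hb⟩ := S.exists_abs_div_relaxation_le hα hα' hβ hT h
  have hG : 0 < Real.Gamma (α + 1) := Real.Gamma_pos_of_pos (by linarith)
  refine ⟨C * (1 + Real.Gamma (α + 1)), by positivity, fun ψ t j ht => ?_⟩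
  have hl := S.lam_pos β j
  have h2 := rpow_mul_relaxation_le hα hα'.le hl ht h0 h1
  refine (hb _ ((1 + Real.Gamma (α + 1)) * t ^ (-(α * σ))) ψ j (by positivity) ?_).trans
    (le_of_eq (by ring))
  rw [abs_of_pos (relaxation_pos hα hα'.le hl.le ht.le), sub_sub_cancel_left, Real.rpow_neg hl.le,
    ← div_eq_mul_inv, le_div_iff₀ (Real.rpow_pos_of_pos hl _), mul_comm]
  exact h2

/-- No decay of R is used, only R ≤ 1, so the estimate includes t = 0. -/
theorem exists_relCoef_bound_zero (hα : 0 < α) (hα' : α < 1) (hβ : 0 < β) (hT : 0 < T)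
    {θ ρ : ℝ} (h : θ + 1 ≤ ρ) :
    ∃ C : ℝ, 0 ≤ C ∧ ∀ (ψ : ℕ → ℝ) (t : ℝ) (j : ℕ), 0 ≤ t →
      |S.lam β j ^ θ * S.relCoef α β T ψ t j| ≤ C * |S.lam β j ^ ρ * ψ j| := by
  obtain ⟨C, hC, hb⟩ := S.exists_abs_div_relaxation_le hα hα' hβ hT h
  refine ⟨C, hC, fun ψ t j ht => ?_⟩
  have hl := S.lam_pos β j
  refine (hb _ 1 ψ j zero_le_one ?_).trans (le_of_eq (by ring))
  rw [abs_of_pos (relaxation_pos hα hα'.le hl.le ht), sub_self, Real.rpow_zero, one_mul]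
  exact relaxation_le_one hα hα'.le hl.le ht

theorem exists_relCoef_holder (hα : 0 < α) (hα' : α < 1) (hβ : 0 < β) (hT : 0 < T)
    {θ s ρ : ℝ} (hs : 0 < s) (hsα : s ≤ α) (h : θ + (1 + s / α) ≤ ρ) :
    ∃ C : ℝ, 0 ≤ C ∧ ∀ (ψ : ℕ → ℝ) (a b : ℝ) (j : ℕ), 0 ≤ a → a ≤ b →
      |S.lam β j ^ θ * (S.relCoef α β T ψ b j - S.relCoef α β T ψ a j)| ≤
        C * (b - a) ^ s * |S.lam β j ^ ρ * ψ j| := by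
  obtain ⟨C, hC, hb⟩ := S.exists_abs_div_relaxation_le hα hα' hβ hT h
  have hG := Real.Gamma_pos_of_pos hα
  refine ⟨C * (((Real.Gamma α)⁻¹ + α) / s), by positivity, fun ψ a b j ha hab => ?_⟩
  have hl := S.lam_pos β j
  have h0 : 0 ≤ b - a := by linarith
  have h2 := hb (relaxation α (S.lam β j) b - relaxation α (S.lam β j) a)
    (((Real.Gamma α)⁻¹ + α) / s * (b - a) ^ s) ψ j (by positivity) ?_
  · refine le_trans (le_of_eq ?_) (h2.trans (le_of_eq (by ring)))
    rw [relCoef, relCoef]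
    congr 1
    ring
  · refine (abs_relaxation_sub_le hα hα'.le hl hs hsα ha hab).trans (le_of_eq ?_)
    rw [add_sub_cancel_left]
    ring

end EigenSystem

/-! ### Admissible exponents -/

/-- The exponents for which the final value problem is considered: the source is in
`L^P(0, T; L²(D))` and the final value is in `V_{β (p + qh)}`. -/
structure AdmissibleExponents (α β T P p q s p' q' qh : ℝ) : Prop where
  α_pos : 0 < α
  α_lt_one : α < 1
  β_pos : 0 < β
  T_pos : 0 < T
  one_lt_P : 1 < P
  one_div_P_lt : 1 / P < α * q - s
  p_pos : 0 < p
  q_pos : 0 < q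
  p_add_q : p + q = 1
  s_pos : 0 < s
  p'_pos : 0 < p'
  p'_le : p' ≤ p - s / α
  q'_eq : q' = 1 - p'
  qh_nonneg : 0 ≤ qh
  qh_le_q : qh ≤ q
  qh_le : qh ≤ s / α

namespace AdmissibleExponents

variable {α β T P p q s p' q' qh : ℝ} (h : AdmissibleExponents α β T P p q s p' q' qh)
include h

theorem s_div_pos : 0 < s / α := div_pos h.s_pos h.α_pos

theorem s_lt : s < α * q := by
  have h1 : 0 < 1 / P := one_div_pos.2 (by linarith [h.one_lt_P])
  linarith [h.one_div_P_lt]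

theorem s_lt_α : s < α := by
  have h1 := h.s_lt
  have h2 : q < 1 := by linarith [h.p_pos, h.p_add_q]
  nlinarith [h.α_pos]

/-- Identifies p + s/α as the smoothing exponent of O₁ for which the condition 1/P < α(1-θ) is the
assumption on P. -/
theorem mul_one_sub : α * (1 - (p + s / α)) = α * q - s := by
  have h1 := mul_div_cancel₀ s h.α_pos.ne'
  linear_combination (-α) * h.p_add_q - h1

theorem add_le_one : p + s / α ≤ 1 := by
  have h1 := h.mul_one_sub
  have h2 := h.s_lt
  by_contra hc
  have h3 : 1 - (p + s / α) < 0 := by linarith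
  nlinarith [h.α_pos]

theorem one_div_P_lt_α : 1 / P < α := by
  have h2 : q < 1 := by linarith [h.p_pos, h.p_add_q]
  nlinarith [h.α_pos, h.one_div_P_lt, h.s_pos]

end AdmissibleExponents

/-! ### Coefficients of the solution: bounds, continuity and the equation -/

namespace EigenSystem

variable {k : ℕ} {D : TopologicalSpace.Opens (Euc k)} {L : EllipticOperator D}
  {bc : BoundaryCondition} (S : EigenSystem L bc)

variable {α β T P p q s p' q' qh : ℝ}

/-- The coefficients of the solution at the final time, without the source term. -/
noncomputable def finalCoef (α β T : ℝ) (φ : L2 D) (F : ℝ → L2 D) (j : ℕ) : ℝ :=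
  ⟪S.e j, φ⟫_ℝ - S.duhCoef α β F T j

/-- The coefficients of the solution of the final value problem. -/
noncomputable def solCoef (α β T : ℝ) (φ : L2 D) (F : ℝ → L2 D) (t : ℝ) (j : ℕ) : ℝ :=
  S.duhCoef α β F t j + S.relCoef α β T (S.finalCoef α β T φ F) t j

variable {φ : L2 D} {F : ℝ → L2 D} (h : AdmissibleExponents α β T P p q s p' q' qh)
include h

theorem memlp_duhCoef (hF : MemLp F (ENNReal.ofReal P) (timeMeasure T)) {θ t : ℝ}
    (hθ : θ ≤ p + s / α) (ht : t ∈ Icc 0 T) :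
    Memℓp (fun j => S.lam β j ^ θ * S.duhCoef α β F t j) 2 :=
  S.memlp_lam_mono h.β_pos.le hθ (S.exists_duhCoef_bound h.α_pos h.α_lt_one.le h.one_lt_P
    (by linarith [h.p_pos, h.s_div_pos]) h.add_le_one (by rw [h.mul_one_sub]; exact h.one_div_P_lt)
    hF ht.1 ht.2).1

theorem exists_norm_duhCoef_le {θ : ℝ} (hθ : θ ≤ p + s / α) :
    ∃ C : ℝ, 0 ≤ C ∧ ∀ F : ℝ → L2 D, MemLp F (ENNReal.ofReal P) (timeMeasure T) →
      ∀ t ∈ Icc 0 T, ‖S.ofCoef (fun j => S.lam β j ^ θ * S.duhCoef α β F t j)‖ ≤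
        C * (eLpNorm F (ENNReal.ofReal P) (timeMeasure T)).toReal := by
  have hlt : 1 / P < α * (1 - (p + s / α)) := by
    rw [h.mul_one_sub]
    exact h.one_div_P_lt
  have h0 : 0 ≤ p + s / α := by linarith [h.p_pos, h.s_div_pos]
  have hl : 0 ≤ S.lam β 0 ^ (θ - (p + s / α)) := Real.rpow_nonneg (S.lam_pos β 0).le _
  refine ⟨S.lam β 0 ^ (θ - (p + s / α)) * duhConst α P T (p + s / α),
    mul_nonneg hl (duhConst_nonneg h.α_pos h.one_lt_P h.T_pos hlt), fun F hF t ht => ?_⟩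
  have hb := S.exists_duhCoef_bound (β := β) h.α_pos h.α_lt_one.le h.one_lt_P h0 h.add_le_one hlt
    hF ht.1 ht.2
  refine (S.norm_ofCoef_lam_le h.β_pos.le hθ hb.1).trans ?_
  rw [mul_assoc]
  exact mul_le_mul_of_nonneg_left hb.2 hl

/-- Since q̂ ≤ s/α, the correction O₁(T)F is at least as regular as φ, so both may be sent back in
time by O₂ together. -/
theorem memlp_finalCoef (hF : MemLp F (ENNReal.ofReal P) (timeMeasure T))
    (hφ : Memℓp (fun j => S.lam β j ^ (p + qh) * ⟪S.e j, φ⟫_ℝ) 2) :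
    Memℓp (fun j => S.lam β j ^ (p + qh) * S.finalCoef α β T φ F j) 2 := by
  have h1 := hφ.sub (S.memlp_duhCoef h hF (θ := p + qh) (by linarith [h.qh_le])
    (right_mem_Icc.2 h.T_pos.le))
  refine memlp_of_le (C := 1) h1 fun j => le_of_eq ?_
  simp only [finalCoef, Pi.sub_apply, mul_sub, one_mul]

theorem exists_norm_finalCoef_le :
    ∃ C : ℝ, 0 ≤ C ∧ ∀ (φ : L2 D) (F : ℝ → L2 D), MemLp F (ENNReal.ofReal P) (timeMeasure T) →
      Memℓp (fun j => S.lam β j ^ (p + qh) * ⟪S.e j, φ⟫_ℝ) 2 →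
      ‖S.ofCoef (fun j => S.lam β j ^ (p + qh) * S.finalCoef α β T φ F j)‖ ≤
        ‖S.ofCoef (fun j => S.lam β j ^ (p + qh) * ⟪S.e j, φ⟫_ℝ)‖ +
          C * (eLpNorm F (ENNReal.ofReal P) (timeMeasure T)).toReal := by
  have hle : p + qh ≤ p + s / α := by linarith [h.qh_le]
  obtain ⟨C, hC, hb⟩ := S.exists_norm_duhCoef_le h hle
  refine ⟨C, hC, fun φ F hF hφ => ?_⟩
  have hT := right_mem_Icc.2 h.T_pos.le
  simp only [finalCoef, mul_sub]
  rw [S.ofCoef_sub hφ (S.memlp_duhCoef h hF hle hT)]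
  exact (norm_sub_le _ _).trans (add_le_add_right (hb F hF T hT) _)

omit h in
theorem memlp_relCoef (hα : 0 < α) (hα' : α < 1) (hβ : 0 < β) (hT : 0 < T) {ψ : ℕ → ℝ} {ρ θ : ℝ}
    (hψ : Memℓp (fun j => S.lam β j ^ ρ * ψ j) 2) (hθ : θ ≤ ρ) {t : ℝ} (ht : 0 < t) :
    Memℓp (fun j => S.lam β j ^ θ * S.relCoef α β T ψ t j) 2 := by
  obtain ⟨C, hC, hb⟩ := S.exists_relCoef_bound hα hα' hβ hT zero_le_one le_rfl
    (θ := θ) (ρ := ρ) (by linarith)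
  exact memlp_of_le hψ fun j => hb ψ t j ht

theorem memlp_solCoef (hF : MemLp F (ENNReal.ofReal P) (timeMeasure T))
    (hφ : Memℓp (fun j => S.lam β j ^ (p + qh) * ⟪S.e j, φ⟫_ℝ) 2) {θ t : ℝ}
    (hθ : θ ≤ p + qh) (ht : t ∈ Ioc 0 T) :
    Memℓp (fun j => S.lam β j ^ θ * S.solCoef α β T φ F t j) 2 := by
  have h1 := (S.memlp_duhCoef h hF (θ := θ) (by linarith [h.qh_le]) ⟨ht.1.le, ht.2⟩).add
    (S.memlp_relCoef h.α_pos h.α_lt_one h.β_pos h.T_pos (S.memlp_finalCoef h hF hφ) hθ ht.1)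
  refine memlp_of_le (C := 1) h1 fun j => le_of_eq ?_
  simp only [solCoef, Pi.add_apply, mul_add, one_mul]

/-- Smoothing estimates for the solution. -/
theorem exists_norm_solCoef_le {θ σ : ℝ} (hθ : θ ≤ p + qh) (h0 : 0 ≤ σ) (h1 : σ ≤ 1)
    (hθσ : θ + (1 - σ) ≤ p + qh) :
    ∃ C : ℝ, 0 ≤ C ∧ ∀ (φ : L2 D) (F : ℝ → L2 D), MemLp F (ENNReal.ofReal P) (timeMeasure T) →
      Memℓp (fun j => S.lam β j ^ (p + qh) * ⟪S.e j, φ⟫_ℝ) 2 → ∀ t ∈ Ioc 0 T,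
      ‖S.ofCoef (fun j => S.lam β j ^ θ * S.solCoef α β T φ F t j)‖ ≤
        C * t ^ (-(α * σ)) * (‖S.ofCoef (fun j => S.lam β j ^ (p + qh) * ⟪S.e j, φ⟫_ℝ)‖ +
          (eLpNorm F (ENNReal.ofReal P) (timeMeasure T)).toReal) := by
  have hle : θ ≤ p + s / α := by linarith [h.qh_le]
  obtain ⟨C₁, hC₁, hb₁⟩ := S.exists_norm_duhCoef_le h hle
  obtain ⟨C₂, hC₂, hb₂⟩ := S.exists_norm_finalCoef_le h
  obtain ⟨C₃, hC₃, hb₃⟩ := S.exists_relCoef_bound h.α_pos h.α_lt_one h.β_pos h.T_pos h0 h1 hθσ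
  have hT := h.T_pos
  refine ⟨C₁ * T ^ (α * σ) + C₃ * (1 + C₂), by positivity, fun φ F hF hφ t ht => ?_⟩
  have hψ := S.memlp_finalCoef h hF hφ
  have m1 := S.memlp_duhCoef h hF hle ⟨ht.1.le, ht.2⟩
  have m2 := S.memlp_relCoef h.α_pos h.α_lt_one h.β_pos h.T_pos hψ hθ ht.1
  set N := (eLpNorm F (ENNReal.ofReal P) (timeMeasure T)).toReal with hN
  set M := ‖S.ofCoef (fun j => S.lam β j ^ (p + qh) * ⟪S.e j, φ⟫_ℝ)‖ with hM
  have hN0 : 0 ≤ N := ENNReal.toReal_nonneg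
  have hM0 : 0 ≤ M := norm_nonneg _
  have ht0 := ht.1
  have htσ : 0 < t ^ (-(α * σ)) := Real.rpow_pos_of_pos ht.1 _
  -- The source part is bounded near t = 0; this inequality absorbs it into the singular weight of
  -- the homogeneous part.
  have htT : 1 ≤ T ^ (α * σ) * t ^ (-(α * σ)) := by
    rw [Real.rpow_neg ht.1.le, ← div_eq_mul_inv, one_le_div (by positivity)]
    exact Real.rpow_le_rpow ht.1.le ht.2 (mul_nonneg h.α_pos.le h0)
  have n2 : ‖S.ofCoef (fun j => S.lam β j ^ θ *
      S.relCoef α β T (S.finalCoef α β T φ F) t j)‖ ≤ C₃ * t ^ (-(α * σ)) * (M + C₂ * N) :=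
    (S.norm_ofCoef_le (by positivity) hψ fun j => hb₃ _ t j ht.1).trans
      (mul_le_mul_of_nonneg_left (hb₂ φ F hF hφ) (by positivity))
  have n1 : ‖S.ofCoef (fun j => S.lam β j ^ θ * S.duhCoef α β F t j)‖ ≤
      C₁ * (T ^ (α * σ) * t ^ (-(α * σ))) * N :=
    (hb₁ F hF t ⟨ht.1.le, ht.2⟩).trans (by
      have : C₁ * N ≤ C₁ * N * (T ^ (α * σ) * t ^ (-(α * σ))) :=
        le_mul_of_one_le_right (by positivity) htT
      linarith)
  simp only [solCoef, mul_add]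
  rw [S.ofCoef_add m1 m2]
  refine (norm_add_le _ _).trans ((add_le_add n1 n2).trans ?_)
  have e1 : 0 ≤ C₁ * T ^ (α * σ) * t ^ (-(α * σ)) * M := by positivity
  have e2 : 0 ≤ C₃ * t ^ (-(α * σ)) * (C₂ * M + N) := by positivity
  nlinarith

theorem continuousOn_solCoef_apply (hF : MemLp F (ENNReal.ofReal P) (timeMeasure T)) (j : ℕ) :
    ContinuousOn (fun t => S.solCoef α β T φ F t j) (Icc 0 T) :=
  (S.continuousOn_duhCoef h.α_pos h.α_lt_one.le h.one_lt_P h.one_div_P_lt_α hF j).add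
    (S.continuous_relCoef h.α_pos j).continuousOn

theorem aestronglyMeasurable_solCoef (hF : MemLp F (ENNReal.ofReal P) (timeMeasure T))
    (hφ : Memℓp (fun j => S.lam β j ^ (p + qh) * ⟪S.e j, φ⟫_ℝ) 2) {θ : ℝ}
    (hθ : θ ≤ p + qh) :
    AEStronglyMeasurable (fun t => S.ofCoef (fun j => S.lam β j ^ θ * S.solCoef α β T φ F t j))
      (timeMeasure T) := by
  refine S.aestronglyMeasurable_of_coef fun j => ?_
  refine (((S.continuousOn_solCoef_apply (φ := φ) h hF j).mono
    Ioo_subset_Icc_self).aestronglyMeasurable measurableSet_Ioo |>.const_mul (S.lam β j ^ θ)).congr ?_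
  refine (ae_restrict_mem measurableSet_Ioo).mono fun t ht => ?_
  exact (S.inner_ofCoef (S.memlp_solCoef h hF hφ hθ ⟨ht.1, ht.2.le⟩) j).symm

/-- The source part is bounded with the strictly larger weight p + s/α, so its tails are uniformly
small. The homogeneous part has no such margin when q̂ = 0 and θ = p; it is treated by dominated
convergence after removing its singularity. -/
theorem continuousOn_solCoef (hF : MemLp F (ENNReal.ofReal P) (timeMeasure T))
    (hφ : Memℓp (fun j => S.lam β j ^ (p + qh) * ⟪S.e j, φ⟫_ℝ) 2) {θ : ℝ}
    (hθ : θ ≤ p) :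
    ContinuousOn (fun t => S.ofCoef (fun j => S.lam β j ^ θ * S.solCoef α β T φ F t j))
      (Ioc 0 T) := by
  have hle : θ ≤ p + qh := by linarith [h.qh_nonneg]
  have hψ := S.memlp_finalCoef h hF hφ
  obtain ⟨C₁, hC₁, hb₁⟩ := S.exists_norm_duhCoef_le h le_rfl
  have c1 : ContinuousOn (fun t => S.ofCoef (fun j => S.lam β j ^ θ * S.duhCoef α β F t j))
      (Ioc 0 T) := by
    refine (S.continuousOn_ofCoef_of_bounded h.β_pos (δ := p + s / α)
      (by linarith [h.s_div_pos]) (s := Icc 0 T) (fun t ht => S.memlp_duhCoef h hF le_rfl ht)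
      (S.continuousOn_duhCoef h.α_pos h.α_lt_one.le h.one_lt_P h.one_div_P_lt_α hF)
      (hb₁ F hF)).mono Ioc_subset_Icc_self
  obtain ⟨C₃, hC₃, hb₃⟩ := S.exists_relCoef_bound h.α_pos h.α_lt_one h.β_pos h.T_pos
    zero_le_one le_rfl (θ := θ) (ρ := p + qh) (by linarith)
  set ψ := S.finalCoef α β T φ F
  -- The factor t^α cancels the singularity, so a single element of L²(D) dominates the coefficients
  -- on all of (0, T]; the factor is divided out afterwards.
  have hm : ∀ t ∈ Ioc 0 T, Memℓp (fun j => S.lam β j ^ θ * (t ^ α * S.relCoef α β T ψ t j)) 2 ∧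
      ∀ j, |S.lam β j ^ θ * (t ^ α * S.relCoef α β T ψ t j)| ≤
        C₃ * |S.lam β j ^ (p + qh) * ψ j| := by
    intro t ht
    have hb : ∀ j, |S.lam β j ^ θ * (t ^ α * S.relCoef α β T ψ t j)| ≤
        C₃ * |S.lam β j ^ (p + qh) * ψ j| := by
      intro j
      have hta : 0 < t ^ α := Real.rpow_pos_of_pos ht.1 _
      rw [mul_left_comm, abs_mul, abs_of_pos hta]
      refine (mul_le_mul_of_nonneg_left (hb₃ ψ t j ht.1) hta.le).trans (le_of_eq ?_)
      rw [mul_one, Real.rpow_neg ht.1.le]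
      field_simp
    exact ⟨memlp_of_le hψ hb, hb⟩
  have c2 : ContinuousOn (fun t => S.ofCoef (fun j => S.lam β j ^ θ *
      (t ^ α * S.relCoef α β T ψ t j))) (Ioc 0 T) := by
    refine S.continuousOn_of_dominated (S.ofCoef fun j => S.lam β j ^ (p + qh) * ψ j) hC₃
      (fun j => ?_) fun t ht j => ?_
    · have hc : Continuous fun t => S.lam β j ^ θ * (t ^ α * S.relCoef α β T ψ t j) :=
        continuous_const.mul ((Real.continuous_rpow_const h.α_pos.le).mul
          (S.continuous_relCoef h.α_pos j))
      exact hc.continuousOn.congr fun t ht => S.inner_ofCoef (hm t ht).1 j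
    · rw [S.inner_ofCoef (hm t ht).1, S.inner_ofCoef hψ]
      exact (hm t ht).2 j
  have c3 : ContinuousOn (fun t : ℝ => (t ^ α)⁻¹) (Ioc 0 T) :=
    ((Real.continuous_rpow_const h.α_pos.le).continuousOn).inv₀
      fun t ht => (Real.rpow_pos_of_pos ht.1 _).ne'
  refine (c1.add (c3.smul c2)).congr fun t ht => ?_
  have hta := (Real.rpow_pos_of_pos ht.1 α).ne'
  refine S.ext_inner fun j => ?_
  simp only [Pi.add_apply, Pi.smul_apply']
  rw [S.inner_ofCoef (S.memlp_solCoef h hF hφ hle ht), inner_add_right, inner_smul_right,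
    S.inner_ofCoef (S.memlp_duhCoef h hF (by linarith [h.s_div_pos]) ⟨ht.1.le, ht.2⟩),
    S.inner_ofCoef (hm t ht).1, solCoef]
  field_simp
  rfl

/-! ### The solution in the negative space -/

/-- In V_{-βq'} the solution also has a value at t = 0: the lost power of λ raises -q' to p', which
is below p + q̂. -/
theorem memlp_solCoef_neg (hF : MemLp F (ENNReal.ofReal P) (timeMeasure T))
    (hφ : Memℓp (fun j => S.lam β j ^ (p + qh) * ⟪S.e j, φ⟫_ℝ) 2) {t : ℝ} (ht : t ∈ Icc 0 T) :
    Memℓp (fun j => S.lam β j ^ (-q') * S.solCoef α β T φ F t j) 2 := by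
  obtain ⟨C, hC, hb⟩ := S.exists_relCoef_bound_zero h.α_pos h.α_lt_one h.β_pos h.T_pos
    (θ := -q') (ρ := p + qh) (by linarith [h.q'_eq, h.p'_le, h.qh_nonneg, h.s_div_pos])
  have h1 := (S.memlp_duhCoef h hF (θ := -q') (by linarith [h.q'_eq, h.p'_le, h.p_add_q, h.q_pos,
    h.s_div_pos]) ht).add
    (memlp_of_le (S.memlp_finalCoef h hF hφ) fun j => hb _ t j ht.1)
  refine memlp_of_le (C := 1) h1 fun j => le_of_eq ?_
  simp only [solCoef, Pi.add_apply, mul_add, one_mul]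

/-- Hölder continuity of R costs s/α further powers beyond the one lost at T, and -q' + 1 + s/α = p'
+ s/α ≤ p is the condition on p'. The source part uses the pair (p', q') in its Hölder estimate. -/
theorem exists_holder_solCoef (hF : MemLp F (ENNReal.ofReal P) (timeMeasure T))
    (hφ : Memℓp (fun j => S.lam β j ^ (p + qh) * ⟪S.e j, φ⟫_ℝ) 2) :
    ∃ K : ℝ, 0 ≤ K ∧ ∀ a b, 0 ≤ a → a ≤ b → b ≤ T →
      ‖S.ofCoef (fun j => S.lam β j ^ (-q') * S.solCoef α β T φ F b j) -
        S.ofCoef (fun j => S.lam β j ^ (-q') * S.solCoef α β T φ F a j)‖ ≤ K * (b - a) ^ s := by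
  have hq' := h.q'_eq
  have hp' := h.p'_le
  have hpq := h.p_add_q
  have hsα := h.s_div_pos
  have hqh := h.qh_nonneg
  have hqq' : q + s / α ≤ q' := by linarith
  have hPq' : 1 / P < α * q' := by
    have h1 : α * (q + s / α) ≤ α * q' := mul_le_mul_of_nonneg_left hqq' h.α_pos.le
    rw [mul_add, mul_div_cancel₀ _ h.α_pos.ne'] at h1
    linarith [h.one_div_P_lt, h.s_pos]
  have hsP : s ≤ α - 1 / P := by
    have h1 : α * q ≤ α := mul_le_of_le_one_right h.α_pos.le (by linarith [h.p_pos])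
    linarith [h.one_div_P_lt]
  obtain ⟨K₁, hK₁, hb₁⟩ := S.exists_holder_duhCoef h.α_pos h.α_lt_one.le h.β_pos h.one_lt_P
    h.p'_pos.le (by linarith [h.q_pos]) (by linarith) hPq' h.s_pos hsP h.T_pos.le hF
  obtain ⟨C, hC, hb⟩ := S.exists_relCoef_holder h.α_pos h.α_lt_one h.β_pos h.T_pos
    (θ := -q') (ρ := p + qh) h.s_pos h.s_lt_α.le (by linarith)
  have hψ := S.memlp_finalCoef h hF hφ
  set A := ‖S.ofCoef (fun j => S.lam β j ^ (p + qh) * S.finalCoef α β T φ F j)‖ with hA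
  refine ⟨K₁ + C * A, by positivity, fun a b ha hab hbT => ?_⟩
  have hba : 0 ≤ b - a := by linarith
  have ma : a ∈ Icc 0 T := ⟨ha, hab.trans hbT⟩
  have mb : b ∈ Icc 0 T := ⟨ha.trans hab, hbT⟩
  have hθ : -q' ≤ p + s / α := by linarith [h.p_pos, h.q_pos]
  have m1a := S.memlp_duhCoef h hF hθ ma
  have m1b := S.memlp_duhCoef h hF hθ mb
  have m2 : Memℓp (fun j => S.lam β j ^ (-q') * (S.relCoef α β T (S.finalCoef α β T φ F) b j -
      S.relCoef α β T (S.finalCoef α β T φ F) a j)) 2 := memlp_of_le hψ fun j => hb _ a b j ha hab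
  have e1 : S.ofCoef (fun j => S.lam β j ^ (-q') * S.solCoef α β T φ F b j) -
      S.ofCoef (fun j => S.lam β j ^ (-q') * S.solCoef α β T φ F a j) =
      (S.ofCoef (fun j => S.lam β j ^ (-q') * S.duhCoef α β F b j) -
        S.ofCoef (fun j => S.lam β j ^ (-q') * S.duhCoef α β F a j)) +
      S.ofCoef (fun j => S.lam β j ^ (-q') * (S.relCoef α β T (S.finalCoef α β T φ F) b j -
        S.relCoef α β T (S.finalCoef α β T φ F) a j)) := by
    refine S.ext_inner fun j => ?_
    rw [inner_add_right, inner_sub_right, inner_sub_right,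
      S.inner_ofCoef (S.memlp_solCoef_neg h hF hφ ma),
      S.inner_ofCoef (S.memlp_solCoef_neg h hF hφ mb), S.inner_ofCoef m1a, S.inner_ofCoef m1b,
      S.inner_ofCoef m2, solCoef, solCoef]
    ring
  rw [e1]
  have n2 := S.norm_ofCoef_le (by positivity) hψ fun j =>
    hb (S.finalCoef α β T φ F) a b j ha hab
  refine (norm_add_le _ _).trans ((add_le_add (hb₁ a b ha hab hbT) n2).trans (le_of_eq ?_))
  rw [hA]
  ring

theorem continuousOn_solCoef_neg (hF : MemLp F (ENNReal.ofReal P) (timeMeasure T))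
    (hφ : Memℓp (fun j => S.lam β j ^ (p + qh) * ⟪S.e j, φ⟫_ℝ) 2) :
    ContinuousOn (fun t => S.ofCoef (fun j => S.lam β j ^ (-q') * S.solCoef α β T φ F t j))
      (Icc 0 T) := by
  obtain ⟨K, hK, hb⟩ := S.exists_holder_solCoef h hF hφ
  intro a ha
  rw [ContinuousWithinAt, tendsto_iff_norm_sub_tendsto_zero]
  have hlim : Tendsto (fun b => K * |b - a| ^ s) (𝓝[Icc 0 T] a) (𝓝 0) := by
    have hc : Continuous fun b : ℝ => K * |b - a| ^ s :=
      continuous_const.mul ((Real.continuous_rpow_const h.s_pos.le).comp (by fun_prop))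
    have h2 := (hc.tendsto a).mono_left (nhdsWithin_le_nhds (s := Icc 0 T))
    simp only [sub_self, abs_zero, Real.zero_rpow h.s_pos.ne', mul_zero] at h2
    exact h2
  refine squeeze_zero' (.of_forall fun _ => norm_nonneg _) ?_ hlim
  filter_upwards [self_mem_nhdsWithin] with b hb'
  rcases le_total a b with hab | hab
  · have := hb a b ha.1 hab hb'.2
    rwa [abs_of_nonneg (by linarith)]
  · have := hb b a hb'.1 hab ha.2
    rw [norm_sub_rev, abs_sub_comm]
    rwa [abs_of_nonneg (by linarith)]

/-- The right-hand side `-𝓛 ^ β u + F` in a negative space. -/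
theorem integrable_rhs (hF : MemLp F (ENNReal.ofReal P) (timeMeasure T))
    (hφ : Memℓp (fun j => S.lam β j ^ (p + qh) * ⟪S.e j, φ⟫_ℝ) 2) :
    IntegrableOn (fun t => S.ofCoef (fun j => S.lam β j ^ (-q') * ⟪S.e j, F t⟫_ℝ) -
      S.ofCoef (fun j => S.lam β j ^ p' * S.solCoef α β T φ F t j)) (Ioo 0 T) := by
  have hq'0 : 0 ≤ q' := by linarith [h.q'_eq, h.p'_le, h.p_add_q, h.q_pos, h.s_div_pos]
  have hFc : ∀ t, Memℓp (fun j => S.lam β j ^ (-q') * ⟪S.e j, F t⟫_ℝ) 2 := fun t =>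
    S.memlp_lam_mono h.β_pos.le (δ := 0) (by linarith) (by simpa using S.memlp_inner (F t))
  have hle : p' ≤ p + qh := by linarith [h.p'_le, h.qh_nonneg, h.s_div_pos]
  refine Integrable.sub ?_ ?_
  · refine ((integrableOn_of_memLp_timeMeasure h.one_lt_P hF).norm.const_mul
      (S.lam β 0 ^ (-q' - 0))).mono' (S.aestronglyMeasurable_of_coef fun j => ?_)
      (.of_forall fun t => ?_)
    · simp_rw [S.inner_ofCoef (hFc _)]
      exact (S.memLp_coef hF j).1.const_mul _
    · refine (S.norm_ofCoef_lam_le h.β_pos.le (γ := -q') (δ := 0) (by linarith)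
        (by simpa using S.memlp_inner (F t))).trans (le_of_eq ?_)
      simp only [Real.rpow_zero, one_mul]
      rw [S.ofCoef_inner]
  -- In V_{-βq'} the term 𝓛^β u carries the weight 1 - q' = p'. The choice σ = 1 bounds it by
  -- t^(-α), which is integrable because α < 1.
  · obtain ⟨C, hC, hb⟩ := S.exists_norm_solCoef_le h hle zero_le_one le_rfl (by linarith)
    have hi : IntegrableOn (fun t : ℝ => C * t ^ (-(α * 1)) *
        (‖S.ofCoef (fun j => S.lam β j ^ (p + qh) * ⟪S.e j, φ⟫_ℝ)‖ +
          (eLpNorm F (ENNReal.ofReal P) (timeMeasure T)).toReal)) (Ioo 0 T) := by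
      have h1 : IntervalIntegrable (fun t : ℝ => t ^ (-(α * 1))) volume 0 T :=
        intervalIntegral.intervalIntegrable_rpow' (by linarith [h.α_lt_one])
      rw [intervalIntegrable_iff_integrableOn_Ioo_of_le h.T_pos.le] at h1
      exact (h1.const_mul C).mul_const _
    refine hi.mono' (S.aestronglyMeasurable_solCoef h hF hφ hle)
      ((ae_restrict_mem measurableSet_Ioo).mono fun t ht => ?_)
    exact hb φ F hF hφ t ⟨ht.1, ht.2.le⟩

/-- The equation `ᶜD_t^α u = -𝓛 ^ β u + F` in integrated form. -/
theorem fracIntegral_solCoef (hF : MemLp F (ENNReal.ofReal P) (timeMeasure T))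
    (hφ : Memℓp (fun j => S.lam β j ^ (p + qh) * ⟪S.e j, φ⟫_ℝ) 2) {t : ℝ} (ht : t ∈ Icc 0 T) :
    fracIntegral (1 - α) (fun τ =>
      S.ofCoef (fun j => S.lam β j ^ (-q') * S.solCoef α β T φ F τ j) -
        S.ofCoef (fun j => S.lam β j ^ (-q') * S.solCoef α β T φ F 0 j)) t =
    ∫ τ in (0 : ℝ)..t, (S.ofCoef (fun j => S.lam β j ^ (-q') * ⟪S.e j, F τ⟫_ℝ) -
      S.ofCoef (fun j => S.lam β j ^ p' * S.solCoef α β T φ F τ j)) := by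
  have hα1 : 0 < 1 - α := by linarith [h.α_lt_one]
  -- The integrated function is continuous, hence in every L^P; this exponent satisfies 1/P < 1 - α,
  -- as the fractional integral requires.
  have hP : 1 < 2 / (1 - α) := by
    rw [one_lt_div hα1]
    linarith [h.α_pos]
  have hPd : 1 / (2 / (1 - α)) < 1 - α := by
    rw [one_div_div]
    linarith
  have h0T : (0 : ℝ) ∈ Icc 0 T := left_mem_Icc.2 h.T_pos.le
  have hcont : ContinuousOn (fun τ =>
      S.ofCoef (fun j => S.lam β j ^ (-q') * S.solCoef α β T φ F τ j) -
        S.ofCoef (fun j => S.lam β j ^ (-q') * S.solCoef α β T φ F 0 j)) (Icc 0 T) :=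
    (S.continuousOn_solCoef_neg h hF hφ).sub
    (continuousOn_const (c := S.ofCoef (fun j => S.lam β j ^ (-q') * S.solCoef α β T φ F 0 j)))
  have := isFiniteMeasure_timeMeasure T
  obtain ⟨B, hB⟩ := isCompact_Icc.exists_bound_of_continuousOn hcont
  have hX := MemLp.of_bound (μ := timeMeasure T) (p := ENNReal.ofReal (2 / (1 - α)))
    ((hcont.mono Ioo_subset_Icc_self).aestronglyMeasurable measurableSet_Ioo) B
    ((ae_restrict_mem measurableSet_Ioo).mono fun t ht => hB t (Ioo_subset_Icc_self ht))
  have hint := (S.integrable_rhs h hF hφ).mono_set (Ioo_subset_Ioo_right ht.2)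
  have hq'0 : 0 ≤ q' := by linarith [h.q'_eq, h.p'_le, h.p_add_q, h.q_pos, h.s_div_pos]
  have hFc : ∀ t, Memℓp (fun j => S.lam β j ^ (-q') * ⟪S.e j, F t⟫_ℝ) 2 := fun t =>
    S.memlp_lam_mono h.β_pos.le (δ := 0) (by linarith) (by simpa using S.memlp_inner (F t))
  have hle : p' ≤ p + qh := by linarith [h.p'_le, h.qh_nonneg, h.s_div_pos]
  refine S.ext_inner fun j => ?_
  have hl := S.lam_pos β j
  rw [inner_fracIntegral hP hPd ht.1 ht.2 hX, intervalIntegral.integral_of_le ht.1 (f := fun τ =>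
      S.ofCoef (fun j => S.lam β j ^ (-q') * ⟪S.e j, F τ⟫_ℝ) -
        S.ofCoef (fun j => S.lam β j ^ p' * S.solCoef α β T φ F τ j)),
    integral_Ioc_eq_integral_Ioo, ← integral_inner hint, intervalIntegral_eq_Ioo ht.1]
  set c := S.finalCoef α β T φ F j / relaxation α (S.lam β j) T with hc
  set f : ℝ → ℝ := fun τ => ⟪S.e j, F τ⟫_ℝ with hf
  have hfm := S.memLp_coef hF j
  have hcK : ContinuousOn (duhamel α (S.lam β j) f) (uIcc 0 t) := by
    rw [uIcc_of_le ht.1]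
    exact (S.continuousOn_duhCoef h.α_pos h.α_lt_one.le h.one_lt_P h.one_div_P_lt_α hF j).mono
      (Icc_subset_Icc_right ht.2)
  have hrl := intervalIntegrable_rl_sub hα1 ht.1
  have i1 : IntervalIntegrable (fun τ => rl (1 - α) (t - τ) * duhamel α (S.lam β j) f τ)
      volume 0 t := hrl.mul_continuousOn hcK
  have i2 : IntervalIntegrable (fun τ => rl (1 - α) (t - τ) * (relaxation α (S.lam β j) τ - 1))
      volume 0 t := hrl.mul_continuousOn
    ((continuous_relaxation h.α_pos).sub continuous_const).continuousOn
  have i3 : IntervalIntegrable (relaxation α (S.lam β j)) volume 0 t :=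
    (continuous_relaxation h.α_pos).intervalIntegrable _ _
  have i4 : IntervalIntegrable f volume 0 t := by
    rw [intervalIntegrable_iff_integrableOn_Ioo_of_le ht.1]
    exact (integrableOn_of_memLp_timeMeasure h.one_lt_P hfm).mono_set (Ioo_subset_Ioo_right ht.2)
  -- At time 0 the Duhamel integral vanishes and R = 1, so u_j(τ) - u_j(0) is the Duhamel integral
  -- plus c(R - 1).
  have e1 : ∫ τ in Ioo 0 t, rl (1 - α) (t - τ) * ⟪S.e j,
      S.ofCoef (fun j => S.lam β j ^ (-q') * S.solCoef α β T φ F τ j) -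
        S.ofCoef (fun j => S.lam β j ^ (-q') * S.solCoef α β T φ F 0 j)⟫_ℝ =
      ∫ τ in (0 : ℝ)..t, S.lam β j ^ (-q') * (rl (1 - α) (t - τ) * duhamel α (S.lam β j) f τ +
        c * (rl (1 - α) (t - τ) * (relaxation α (S.lam β j) τ - 1))) := by
    rw [intervalIntegral_eq_Ioo ht.1]
    refine setIntegral_congr_fun measurableSet_Ioo fun τ hτ => ?_
    have hτ' : τ ∈ Icc 0 T := ⟨hτ.1.le, hτ.2.le.trans ht.2⟩
    simp only [inner_sub_right]
    rw [S.inner_ofCoef (S.memlp_solCoef_neg h hF hφ hτ'),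
      S.inner_ofCoef (S.memlp_solCoef_neg h hF hφ h0T), solCoef, solCoef, relCoef, relCoef,
      relaxation_zero h.α_pos, duhCoef, duhCoef,
      show duhamel α (S.lam β j) (fun τ => ⟪S.e j, F τ⟫_ℝ) 0 = 0 by simp [duhamel], hc]
    ring
  have e2 : ∫ τ in Ioo 0 t, ⟪S.e j, S.ofCoef (fun j => S.lam β j ^ (-q') * ⟪S.e j, F τ⟫_ℝ) -
      S.ofCoef (fun j => S.lam β j ^ p' * S.solCoef α β T φ F τ j)⟫_ℝ =
      ∫ τ in (0 : ℝ)..t, S.lam β j ^ (-q') * ((f τ - S.lam β j * duhamel α (S.lam β j) f τ) -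
        c * (S.lam β j * relaxation α (S.lam β j) τ)) := by
    rw [intervalIntegral_eq_Ioo ht.1]
    refine setIntegral_congr_fun measurableSet_Ioo fun τ hτ => ?_
    have h1 : S.lam β j ^ p' = S.lam β j ^ (-q') * S.lam β j := by
      rw [← Real.rpow_add_one hl.ne', h.q'_eq]
      ring_nf
    simp only [inner_sub_right]
    rw [S.inner_ofCoef (hFc τ), S.inner_ofCoef (S.memlp_solCoef h hF hφ hle
      ⟨hτ.1, hτ.2.le.trans ht.2⟩), h1, solCoef, relCoef, duhCoef, hc]
    ring
  rw [e1, e2, intervalIntegral.integral_const_mul, intervalIntegral.integral_const_mul,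
    intervalIntegral.integral_add i1 (i2.const_mul c), intervalIntegral.integral_const_mul,
    intervalIntegral.integral_sub (i4.sub (hcK.intervalIntegrable.const_mul _))
      ((i3.const_mul _).const_mul c), intervalIntegral.integral_const_mul,
    intervalIntegral.integral_const_mul,
    fracIntegral_duhamel h.α_pos h.α_lt_one hl.le h.one_lt_P h.one_div_P_lt_α hfm ht.1 ht.2,
    fracIntegral_relaxation h.α_pos h.α_lt_one hl.le ht.1]
  ring

end EigenSystem

/-! ### Power weights and weighted suprema in time -/

theorem memLp_rpow_neg {a Q T : ℝ} (hQ : 0 < Q) (haQ : a * Q < 1) (hT : 0 ≤ T) :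
    MemLp (fun t : ℝ => t ^ (-a)) (ENNReal.ofReal Q) (timeMeasure T) := by
  have hm : AEStronglyMeasurable (fun t : ℝ => t ^ (-a)) (timeMeasure T) :=
    (measurable_id.pow_const _).aestronglyMeasurable
  rw [← integrable_norm_rpow_iff hm (by simpa using hQ) ENNReal.ofReal_ne_top,
    ENNReal.toReal_ofReal hQ.le]
  have h1 : IntervalIntegrable (fun t : ℝ => t ^ (-(a * Q))) volume 0 T :=
    intervalIntegral.intervalIntegrable_rpow' (by linarith)
  rw [intervalIntegrable_iff_integrableOn_Ioo_of_le hT] at h1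
  refine Integrable.congr h1 ((ae_restrict_mem measurableSet_Ioo).mono fun t ht => ?_)
  change t ^ (-(a * Q)) = ‖t ^ (-a)‖ ^ Q
  rw [Real.norm_of_nonneg (Real.rpow_nonneg ht.1.le _), ← Real.rpow_mul ht.1.le, neg_mul]

theorem ofReal_rpow_mul_enorm_le {X : Type*} [NormedAddCommGroup X] {ρ K t : ℝ} {x : X}
    (ht : 0 < t) (hx : ‖x‖ ≤ K * t ^ (-ρ)) : ENNReal.ofReal (t ^ ρ) * ‖x‖ₑ ≤ ENNReal.ofReal K := by
  have htρ : 0 < t ^ ρ := Real.rpow_pos_of_pos ht _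
  rw [← ofReal_norm, ← ENNReal.ofReal_mul htρ.le]
  refine ENNReal.ofReal_le_ofReal ?_
  rw [Real.rpow_neg ht.le, ← div_eq_mul_inv, le_div_iff₀ htρ] at hx
  linarith

theorem weightedSup_le {X : Type*} [NormedAddCommGroup X] {ρ T K : ℝ} {v : ℝ → X}
    (hv : ∀ t ∈ Ioc 0 T, ‖v t‖ ≤ K * t ^ (-ρ)) : weightedSup ρ T v ≤ ENNReal.ofReal K :=
  iSup₂_le fun t ht => ofReal_rpow_mul_enorm_le ht.1 (hv t ht)

theorem weightedSup_sub_le {X : Type*} [NormedAddCommGroup X] {ρ T K : ℝ} {v w : ℝ → X}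
    (hw : ∀ t ∈ Ioc 0 T, ‖w t‖ ≤ K * t ^ (-ρ)) :
    weightedSup ρ T (fun t => v t - w t) ≤ weightedSup ρ T v + ENNReal.ofReal K := by
  refine iSup₂_le fun t ht => ?_
  calc ENNReal.ofReal (t ^ ρ) * ‖v t - w t‖ₑ ≤ ENNReal.ofReal (t ^ ρ) * (‖v t‖ₑ + ‖w t‖ₑ) := by
        gcongr
        exact enorm_sub_le
    _ = ENNReal.ofReal (t ^ ρ) * ‖v t‖ₑ + ENNReal.ofReal (t ^ ρ) * ‖w t‖ₑ := mul_add _ _ _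
    _ ≤ _ := add_le_add
        (le_iSup₂ (f := fun t (_ : t ∈ Ioc (0 : ℝ) T) => ENNReal.ofReal (t ^ ρ) * ‖v t‖ₑ) t ht)
        (ofReal_rpow_mul_enorm_le ht.1 (hw t ht))

/-! ### From coefficients to `V_γ`, its dual and mild solutions -/

namespace EigenSystem

variable {k : ℕ} {D : TopologicalSpace.Opens (Euc k)} {L : EllipticOperator D}
  {bc : BoundaryCondition} (S : EigenSystem L bc)

variable {α β T P p q s p' q' qh : ℝ}

/-- The total weight is preserved: x at level a becomes x + a - b at level b. -/
theorem restrict_toDual_lam {a b x : ℝ} (hab : β * a ≤ β * b) {c : ℕ → ℝ}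
    (hc : Memℓp (fun j => S.lam β j ^ x * c j) 2) :
    S.restrict hab (S.toDual (β * a) (S.ofCoef fun j => S.lam β j ^ x * c j)) =
      S.toDual (β * b) (S.ofCoef fun j => S.lam β j ^ (x + a - b) * c j) := by
  rw [restrict_toDual]
  congr 2
  funext j
  rw [S.inner_ofCoef hc, ← mul_sub, ← lam_rpow, ← mul_assoc, ← Real.rpow_add (S.lam_pos β j)]
  ring_nf

theorem embed_eq_toDual_lam {b : ℝ} (hb : 0 ≤ β * b) (g : L2 D) :
    S.embed hb g = S.toDual (β * b) (S.ofCoef fun j => S.lam β j ^ (-b) * ⟪S.e j, g⟫_ℝ) := by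
  rw [embed_eq_toDual]
  congr 2
  funext j
  rw [lam_rpow, mul_neg]

theorem val_toV_lam {a : ℝ} (ha : 0 ≤ β * a) {c : ℕ → ℝ}
    (hc : Memℓp (fun j => S.lam β j ^ a * c j) 2) :
    S.val (S.toV ha (S.ofCoef fun j => S.lam β j ^ a * c j)) = S.ofCoef c := by
  rw [val_toV]
  congr 1
  funext j
  rw [S.inner_ofCoef hc, ← mul_neg, ← lam_rpow, ← mul_assoc, ← Real.rpow_add (S.lam_pos β j),
    neg_add_cancel, Real.rpow_zero, one_mul]

theorem memlp_val {a : ℝ} (φ : S.V (β * a)) :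
    Memℓp (fun j => S.lam β j ^ a * ⟪S.e j, S.val φ⟫_ℝ) 2 := by
  have h1 := (memlp_iff _).2 (S.val_mem φ)
  simp only [lam_rpow]
  exact h1

theorem norm_eq_norm_ofCoef {a : ℝ} (φ : S.V (β * a)) :
    ‖φ‖ = ‖S.ofCoef (fun j => S.lam β j ^ a * ⟪S.e j, S.val φ⟫_ℝ)‖ := by
  rw [norm_def]
  congr 1
  refine S.ext_inner fun j => ?_
  rw [inner_fracPow, S.inner_ofCoef (S.memlp_val φ), lam_rpow]

/-! ### Mild solutions -/

variable {φ : L2 D} {F : ℝ → L2 D}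

/-- Every constituent is the sum of a prescribed series, and sums are unique; in particular O₁(T)F
is the same for both representations. -/
theorem MildFormula.unique {t : ℝ} {x y : L2 D} (hx : S.MildFormula α β T φ F t x)
    (hy : S.MildFormula α β T φ F t y) : x = y := by
  obtain ⟨a₁, a₂, a₃, z, ha₁, ha₂, hz, ha₃, rfl⟩ := hx
  obtain ⟨b₁, b₂, b₃, z', hb₁, hb₂, hz', hb₃, rfl⟩ := hy
  obtain rfl := hz.2.unique hz'.2
  rw [ha₁.2.unique hb₁.2, HasSum.unique ha₂ hb₂, HasSum.unique ha₃ hb₃]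

variable (h : AdmissibleExponents α β T P p q s p' q' qh)
include h

theorem isO1_ofCoef (hF : MemLp F (ENNReal.ofReal P) (timeMeasure T)) {t : ℝ}
    (ht : t ∈ Icc 0 T) : S.IsO1 α β F t (S.ofCoef (S.duhCoef α β F t)) := by
  refine ⟨fun j => intervalIntegrable_mul_resolvent h.α_pos h.α_lt_one.le (S.lam_pos β j).le
    h.one_lt_P h.one_div_P_lt_α (S.memLp_coef hF j) ht.1 ht.2, ?_⟩
  have h1 := S.memlp_duhCoef h hF (θ := 0) (by linarith [h.p_pos, h.s_div_pos]) ht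
  simp only [Real.rpow_zero, one_mul] at h1
  exact S.hasSum_ofCoef h1

omit h in
theorem isO2_of_coef {t : ℝ} {v w : L2 D} {ψ : ℕ → ℝ} (hv : ∀ j, ⟪S.e j, v⟫_ℝ = ψ j)
    (hw : ∀ j, ⟪S.e j, w⟫_ℝ = S.relCoef α β T ψ t j) : S.IsO2 α β T v t w := by
  have h1 := S.e.hasSum_repr w
  refine h1.congr_fun fun j => ?_
  rw [HilbertBasis.repr_apply_apply, hw, hv, relCoef, mul_comm (ψ j)]
  rfl

theorem mildFormula_ofCoef (hF : MemLp F (ENNReal.ofReal P) (timeMeasure T))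
    (hφ : Memℓp (fun j => S.lam β j ^ (p + qh) * ⟪S.e j, φ⟫_ℝ) 2) {t : ℝ} (ht : t ∈ Ioc 0 T) :
    S.MildFormula α β T φ F t (S.ofCoef (S.solCoef α β T φ F t)) := by
  have hT : T ∈ Icc 0 T := right_mem_Icc.2 h.T_pos.le
  have ht' : t ∈ Icc 0 T := ⟨ht.1.le, ht.2⟩
  have hρ : 0 ≤ p + qh := by linarith [h.p_pos, h.qh_nonneg]
  have hρ' : p + qh ≤ p + s / α := by linarith [h.qh_le]
  have m1 := S.memlp_duhCoef h hF (hρ.trans hρ') ht'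
  have mT := S.memlp_duhCoef h hF (hρ.trans hρ') hT
  have m2 := S.memlp_relCoef h.α_pos h.α_lt_one h.β_pos h.T_pos hφ hρ ht.1
  have m3 := S.memlp_relCoef h.α_pos h.α_lt_one h.β_pos h.T_pos
    (S.memlp_duhCoef h hF hρ' hT) hρ ht.1
  have ms := S.memlp_solCoef h hF hφ hρ ht
  simp only [Real.rpow_zero, one_mul] at m1 mT m2 m3 ms
  refine ⟨_, S.ofCoef (fun j => S.relCoef α β T (fun j => ⟪S.e j, φ⟫_ℝ) t j),
    S.ofCoef (fun j => S.relCoef α β T (S.duhCoef α β F T) t j), _, S.isO1_ofCoef h hF ht',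
    S.isO2_of_coef (fun j => rfl) (S.inner_ofCoef m2), S.isO1_ofCoef h hF hT,
    S.isO2_of_coef (S.inner_ofCoef mT) (S.inner_ofCoef m3), ?_⟩
  -- O₂ is linear in its data, so the terms from φ and from O₁(T)F combine into the one built on
  -- `finalCoef`.
  refine S.ext_inner fun j => ?_
  rw [inner_sub_right, inner_add_right, S.inner_ofCoef ms, S.inner_ofCoef m1, S.inner_ofCoef m2,
    S.inner_ofCoef m3, solCoef, relCoef, relCoef, relCoef, finalCoef]
  ring

theorem ofCoef_solCoef_final : S.ofCoef (S.solCoef α β T φ F T) = φ := by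
  rw [← S.ofCoef_inner φ]
  congr 1
  funext j
  have hR := (relaxation_pos h.α_pos h.α_lt_one.le (S.lam_pos β j).le h.T_pos.le).ne'
  rw [solCoef, relCoef, finalCoef, div_self hR, S.ofCoef_inner]
  ring

/-- With θ = p - p' and σ = q', θ + 1 - σ = p. The resulting singularity t^(-αq') lies in L^Q
because αq'Q < 1. -/
theorem memLpV_ofCoef (hF : MemLp F (ENNReal.ofReal P) (timeMeasure T))
    (hφ : Memℓp (fun j => S.lam β j ^ (p + qh) * ⟪S.e j, φ⟫_ℝ) 2) {Q : ℝ} (hQ : 0 < Q)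
    (hQ' : α * q' * Q < 1) :
    S.MemLpV (β * (p - p')) Q T (fun t => S.ofCoef (S.solCoef α β T φ F t)) := by
  have hpp : 0 ≤ p - p' := by linarith [h.p'_le, h.s_div_pos]
  have hq := h.q'_eq
  have hle : p - p' ≤ p + qh := by linarith [h.p'_pos, h.qh_nonneg]
  obtain ⟨C, hC, hb⟩ := S.exists_norm_solCoef_le h hle (σ := q')
    (by linarith [h.p_add_q, h.q_pos]) (by linarith [h.p'_pos]) (by linarith [h.qh_nonneg])
  refine ⟨fun t => S.toV (mul_nonneg h.β_pos.le hpp)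
    (S.ofCoef fun j => S.lam β j ^ (p - p') * S.solCoef α β T φ F t j), ?_, ?_⟩
  · refine ContinuousLinearMap.comp_memLp' (S.toV (mul_nonneg h.β_pos.le hpp)) ?_
    refine (memLp_rpow_neg hQ hQ' h.T_pos.le).of_le_mul
      (c := C * (‖S.ofCoef (fun j => S.lam β j ^ (p + qh) * ⟪S.e j, φ⟫_ℝ)‖ +
          (eLpNorm F (ENNReal.ofReal P) (timeMeasure T)).toReal))
      (S.aestronglyMeasurable_solCoef h hF hφ hle)
      ((ae_restrict_mem measurableSet_Ioo).mono fun t ht => ?_)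
    refine (hb φ F hF hφ t ⟨ht.1, ht.2.le⟩).trans (le_of_eq ?_)
    rw [Real.norm_of_nonneg (Real.rpow_nonneg ht.1.le _)]
    ring
  · exact (ae_restrict_mem measurableSet_Ioo).mono fun t ht =>
      S.val_toV_lam _ (S.memlp_solCoef h hF hφ hle ⟨ht.1, ht.2.le⟩)

theorem isUniqueMildSolution_ofCoef (hF : MemLp F (ENNReal.ofReal P) (timeMeasure T))
    (hφ : Memℓp (fun j => S.lam β j ^ (p + qh) * ⟪S.e j, φ⟫_ℝ) 2) :
    S.IsUniqueMildSolution α β T φ F (fun t => S.ofCoef (S.solCoef α β T φ F t)) := by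
  have hf : ∀ᵐ t ∂timeMeasure T,
      S.MildFormula α β T φ F t (S.ofCoef (S.solCoef α β T φ F t)) :=
    (ae_restrict_mem measurableSet_Ioo).mono fun t ht =>
      S.mildFormula_ofCoef h hF hφ ⟨ht.1, ht.2.le⟩
  refine ⟨⟨?_, hf⟩, S.ofCoef_solCoef_final h, fun v hv => ?_⟩
  · have hpp : 0 ≤ p - p' := by linarith [h.p'_le, h.s_div_pos]
    have hq' : α * q' * 1 < 1 := by
      have h1 : q' < 1 := by linarith [h.q'_eq, h.p'_pos]
      nlinarith [h.α_pos, h.α_lt_one]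
    -- Time exponent 1 is admissible since αq' < 1. Including the positive-order space into L²(D)
    -- gives the integrability class with a = 1, b = 2.
    obtain ⟨w, hw, hwu⟩ := S.memLpV_ofCoef h hF hφ one_pos hq'
    refine ⟨1, 2, le_rfl, ⟨one_le_two⟩, fun t => S.ofCoef (S.solCoef α β T φ F t), ?_,
      .of_forall fun t => .rfl⟩
    rw [ENNReal.ofReal_one] at hw
    exact ((S.toL2 (mul_nonneg h.β_pos.le hpp)).comp_memLp' hw).ae_eq hwu
  · filter_upwards [hf, hv.2] with t h1 h2
    exact MildFormula.unique S h2 h1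

theorem memWeightedC_ofCoef (hF : MemLp F (ENNReal.ofReal P) (timeMeasure T))
    (hφ : Memℓp (fun j => S.lam β j ^ (p + qh) * ⟪S.e j, φ⟫_ℝ) 2) :
    MemWeightedC (α * q) T (fun t => S.ofCoef (S.solCoef α β T φ F t)) := by
  have h1 := S.continuousOn_solCoef h hF hφ h.p_pos.le
  obtain ⟨C, hC, hb⟩ := S.exists_norm_solCoef_le h (θ := 0) (σ := q)
    (by linarith [h.p_pos, h.qh_nonneg]) h.q_pos.le (by linarith [h.p_pos, h.p_add_q])
    (by linarith [h.p_add_q, h.qh_nonneg])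
  have hb' := hb φ F hF hφ
  simp only [Real.rpow_zero, one_mul] at h1 hb'
  refine ⟨h1, (weightedSup_le (K := C * (‖S.ofCoef (fun j => S.lam β j ^ (p + qh) * ⟪S.e j, φ⟫_ℝ)‖ +
    (eLpNorm F (ENNReal.ofReal P) (timeMeasure T)).toReal)) fun t ht =>
    (hb' t ht).trans (le_of_eq ?_)).trans_lt ENNReal.ofReal_lt_top⟩
  ring

theorem embed_ofCoef_solCoef (hF : MemLp F (ENNReal.ofReal P) (timeMeasure T))
    (hφ : Memℓp (fun j => S.lam β j ^ (p + qh) * ⟪S.e j, φ⟫_ℝ) 2) {b : ℝ} (hb : 0 ≤ β * b)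
    {t : ℝ} (ht : t ∈ Ioc 0 T) :
    S.toDual (β * b) (S.ofCoef fun j => S.lam β j ^ (-b) * S.solCoef α β T φ F t j) =
      S.embed hb (S.ofCoef (S.solCoef α β T φ F t)) := by
  have ms := S.memlp_solCoef h hF hφ (θ := 0) (by linarith [h.p_pos, h.qh_nonneg]) ht
  simp only [Real.rpow_zero, one_mul] at ms
  rw [embed_eq_toDual_lam]
  simp only [S.inner_ofCoef ms]

theorem memHolderDual_ofCoef (hF : MemLp F (ENNReal.ofReal P) (timeMeasure T))
    (hφ : Memℓp (fun j => S.lam β j ^ (p + qh) * ⟪S.e j, φ⟫_ℝ) 2) :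
    S.MemHolderDual (β * q') s T (fun t => S.ofCoef (S.solCoef α β T φ F t)) := by
  have hq' : 0 ≤ β * q' := mul_nonneg h.β_pos.le
    (by linarith [h.q'_eq, h.p'_le, h.p_add_q, h.q_pos, h.s_div_pos])
  obtain ⟨K, hK, hb⟩ := S.exists_holder_solCoef h hF hφ
  refine ⟨hq', fun t => S.toDual (β * q')
    (S.ofCoef fun j => S.lam β j ^ (-q') * S.solCoef α β T φ F t j),
    fun t ht => S.embed_ofCoef_solCoef h hF hφ hq' ht,
    (S.toDual (β * q')).continuous.comp_continuousOn (S.continuousOn_solCoef_neg h hF hφ),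
    K, fun t₁ t₂ h₁ h₂ h₃ => ?_⟩
  rw [← map_sub]
  exact (S.norm_toDual_le _).trans (hb t₁ t₂ h₁ h₂.le h₃)

/-- The Caputo derivative `-𝓛 ^ β u + F` of the solution, in `V_{-β (q - qh)}`. -/
theorem isCaputoDeriv_ofCoef (hF : MemLp F (ENNReal.ofReal P) (timeMeasure T))
    (hφ : Memℓp (fun j => S.lam β j ^ (p + qh) * ⟪S.e j, φ⟫_ℝ) 2) :
    S.IsCaputoDeriv α T (β * q') (fun t => S.ofCoef (S.solCoef α β T φ F t))
      (fun t => S.toDual (β * (q - qh))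
        (S.ofCoef (fun j => S.lam β j ^ (-(q - qh)) * ⟪S.e j, F t⟫_ℝ) -
          S.ofCoef (fun j => S.lam β j ^ (p + qh) * S.solCoef α β T φ F t j))) := by
  have hq'0 : 0 ≤ q' := by linarith [h.q'_eq, h.p'_le, h.p_add_q, h.q_pos, h.s_div_pos]
  have hqq' : q - qh ≤ q' := by
    linarith [h.q'_eq, h.p'_le, h.p_add_q, h.qh_nonneg, h.s_div_pos]
  have hq' : 0 ≤ β * q' := mul_nonneg h.β_pos.le hq'0
  have hγδ : β * (q - qh) ≤ β * q' := mul_le_mul_of_nonneg_left hqq' h.β_pos.le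
  have hFc : ∀ t, Memℓp (fun j => S.lam β j ^ (-(q - qh)) * ⟪S.e j, F t⟫_ℝ) 2 := fun t =>
    S.memlp_lam_mono h.β_pos.le (δ := 0) (by linarith [h.qh_le_q])
      (by simpa using S.memlp_inner (F t))
  -- Restriction to V_{-βq'} changes the weights -(q - q̂) and p + q̂ into -q' and p', those of the
  -- integrated equation.
  have hrestr : ∀ t ∈ Ioo 0 T, S.restrict hγδ (S.toDual (β * (q - qh))
      (S.ofCoef (fun j => S.lam β j ^ (-(q - qh)) * ⟪S.e j, F t⟫_ℝ) -
        S.ofCoef (fun j => S.lam β j ^ (p + qh) * S.solCoef α β T φ F t j))) =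
      S.toDual (β * q') (S.ofCoef (fun j => S.lam β j ^ (-q') * ⟪S.e j, F t⟫_ℝ) -
        S.ofCoef (fun j => S.lam β j ^ p' * S.solCoef α β T φ F t j)) := by
    intro t ht
    have e1 := S.restrict_toDual_lam hγδ (hFc t)
    have e2 := S.restrict_toDual_lam hγδ (S.memlp_solCoef h hF hφ le_rfl ⟨ht.1, ht.2.le⟩)
    rw [show -(q - qh) + (q - qh) - q' = -q' by ring] at e1
    rw [show p + qh + (q - qh) - q' = p' by linarith [h.p_add_q, h.q'_eq]] at e2
    rw [map_sub, map_sub, ← e1, ← e2]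
    rfl
  have hint := (S.toDual (β * q')).integrable_comp (S.integrable_rhs h hF hφ)
  refine ⟨hq', hγδ, fun t => S.toDual (β * q')
    (S.ofCoef fun j => S.lam β j ^ (-q') * S.solCoef α β T φ F t j),
    fun t ht => S.embed_ofCoef_solCoef h hF hφ hq' ht,
    (S.toDual (β * q')).continuous.comp_continuousOn (S.continuousOn_solCoef_neg h hF hφ),
    ?_, fun t ht => ?_⟩
  · exact Integrable.congr hint
      ((ae_restrict_mem measurableSet_Ioo).mono fun t ht => (hrestr t ht).symm)
  · have hsub : Ioo 0 t ⊆ Ioo 0 T := Ioo_subset_Ioo_right ht.2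
    have e1 : ∫ τ in (0 : ℝ)..t, S.restrict hγδ (S.toDual (β * (q - qh))
        (S.ofCoef (fun j => S.lam β j ^ (-(q - qh)) * ⟪S.e j, F τ⟫_ℝ) -
          S.ofCoef (fun j => S.lam β j ^ (p + qh) * S.solCoef α β T φ F τ j))) =
        S.toDual (β * q') (∫ τ in (0 : ℝ)..t,
          (S.ofCoef (fun j => S.lam β j ^ (-q') * ⟪S.e j, F τ⟫_ℝ) -
            S.ofCoef (fun j => S.lam β j ^ p' * S.solCoef α β T φ F τ j))) := by
      rw [intervalIntegral.integral_of_le ht.1, intervalIntegral.integral_of_le ht.1,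
        integral_Ioc_eq_integral_Ioo, integral_Ioc_eq_integral_Ioo,
        ← ContinuousLinearMap.integral_comp_comm _ ((S.integrable_rhs h hF hφ).mono_set hsub)]
      exact setIntegral_congr_fun measurableSet_Ioo fun τ hτ => hrestr τ (hsub hτ)
    -- The equation holds in L²(D) for the weighted coefficients. It remains to pull the continuous
    -- linear map `toDual` out of the fractional integral.
    rw [e1, ← S.fracIntegral_solCoef h hF hφ ht, fracIntegral, fracIntegral, map_smul]
    congr 1
    rw [intervalIntegral.integral_of_le ht.1, intervalIntegral.integral_of_le ht.1,
      ← ContinuousLinearMap.integral_comp_comm]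
    · congr 1
      funext τ
      rw [map_smul, map_sub]
    · have hcont : ContinuousOn (fun τ =>
          S.ofCoef (fun j => S.lam β j ^ (-q') * S.solCoef α β T φ F τ j) -
            S.ofCoef (fun j => S.lam β j ^ (-q') * S.solCoef α β T φ F 0 j)) (uIcc 0 t) := by
        rw [uIcc_of_le ht.1]
        exact ((S.continuousOn_solCoef_neg h hF hφ).sub continuousOn_const).mono
          (Icc_subset_Icc_right ht.2)
      have hk : IntervalIntegrable (fun τ => (t - τ) ^ (1 - α - 1)) volume 0 t :=
        intervalIntegrable_sub_rpow (by linarith [h.α_lt_one])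
      exact (intervalIntegrable_iff_integrableOn_Ioc_of_le ht.1).1 (hk.smul_continuousOn hcont)

end EigenSystem

/-! ### Estimates of the Caputo derivative -/

theorem exists_eLpNorm_le_eLpNorm {X : Type*} [NormedAddCommGroup X] {Q P : ℝ} (T : ℝ)
    (hQP : Q ≤ P) : ∃ C : ℝ, 0 ≤ C ∧ ∀ F : ℝ → X, MemLp F (ENNReal.ofReal P) (timeMeasure T) →
      eLpNorm F (ENNReal.ofReal Q) (timeMeasure T) ≤
        ENNReal.ofReal C * eLpNorm F (ENNReal.ofReal P) (timeMeasure T) := by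
  have := isFiniteMeasure_timeMeasure T
  set μ := timeMeasure T
  set x := 1 / (ENNReal.ofReal Q).toReal - 1 / (ENNReal.ofReal P).toReal
  by_cases hQ : 0 < Q
  · have hx : 0 ≤ x := by
      have hP : 0 < P := hQ.trans_le hQP
      simp only [x, ENNReal.toReal_ofReal hQ.le, ENNReal.toReal_ofReal hP.le]
      exact sub_nonneg.2 (one_div_le_one_div_of_le hQ hQP)
    have hfin : μ univ ^ x ≠ ∞ := ENNReal.rpow_ne_top_of_nonneg hx (measure_ne_top _ _)
    refine ⟨(μ univ ^ x).toReal, ENNReal.toReal_nonneg, fun F hF => ?_⟩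
    rw [ENNReal.ofReal_toReal hfin, mul_comm]
    exact eLpNorm_le_eLpNorm_mul_rpow_measure_univ (ENNReal.ofReal_le_ofReal hQP) hF.1
  -- For Q ≤ 0 the exponent `ENNReal.ofReal Q` is 0, where `eLpNorm` vanishes.
  · refine ⟨0, le_rfl, fun F hF => ?_⟩
    rw [ENNReal.ofReal_of_nonpos (not_lt.1 hQ), eLpNorm_exponent_zero]
    exact zero_le

namespace EigenSystem

variable {k : ℕ} {D : TopologicalSpace.Opens (Euc k)} {L : EllipticOperator D}
  {bc : BoundaryCondition} (S : EigenSystem L bc)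

variable {α β T P p q s p' q' qh : ℝ} (h : AdmissibleExponents α β T P p q s p' q' qh)
include h

theorem exists_eLpNorm_source_le {Q : ℝ} (hQP : Q ≤ P) : ∃ C : ℝ, 0 ≤ C ∧ ∀ F : ℝ → L2 D,
    MemLp F (ENNReal.ofReal P) (timeMeasure T) →
    MemLp (fun t => S.ofCoef fun j => S.lam β j ^ (-(q - qh)) * ⟪S.e j, F t⟫_ℝ)
      (ENNReal.ofReal Q) (timeMeasure T) ∧
    eLpNorm (fun t => S.ofCoef fun j => S.lam β j ^ (-(q - qh)) * ⟪S.e j, F t⟫_ℝ)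
      (ENNReal.ofReal Q) (timeMeasure T) ≤
        ENNReal.ofReal C * eLpNorm F (ENNReal.ofReal P) (timeMeasure T) := by
  have := isFiniteMeasure_timeMeasure T
  obtain ⟨C, hC, hb⟩ := exists_eLpNorm_le_eLpNorm (X := L2 D) T hQP
  set c := S.lam β 0 ^ (-(q - qh) - 0)
  have hc : 0 ≤ c := Real.rpow_nonneg (S.lam_pos β 0).le _
  have hle : -(q - qh) ≤ 0 := by linarith [h.qh_le_q]
  have hm : ∀ v : L2 D, Memℓp (fun j => S.lam β j ^ (0 : ℝ) * ⟪S.e j, v⟫_ℝ) 2 := fun v => by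
    simpa using S.memlp_inner v
  have hn : ∀ v : L2 D, ‖S.ofCoef fun j => S.lam β j ^ (-(q - qh)) * ⟪S.e j, v⟫_ℝ‖ ≤ c * ‖v‖ :=
    fun v => (S.norm_ofCoef_lam_le h.β_pos.le hle (hm v)).trans (le_of_eq (by
      simp only [Real.rpow_zero, one_mul]
      rw [S.ofCoef_inner]))
  refine ⟨c * C, mul_nonneg hc hC, fun F hF => ⟨?_, ?_⟩⟩
  · refine (hF.mono_exponent (ENNReal.ofReal_le_ofReal hQP)).of_le_mul
      (S.aestronglyMeasurable_of_coef fun j => ?_) (.of_forall fun t => hn (F t))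
    simp_rw [S.inner_ofCoef (S.memlp_lam_mono h.β_pos.le hle (hm _))]
    exact (S.memLp_coef hF j).1.const_mul _
  · refine (eLpNorm_le_mul_eLpNorm_of_ae_le_mul (.of_forall fun t => hn (F t)) _).trans ?_
    rw [ENNReal.ofReal_mul hc, mul_assoc]
    gcongr
    exact hb F hF

/-- At the full weight p + q̂ the lost power of λ must be recovered entirely from time, σ = 1; the
singularity t^(-α) dictates αQ < 1. -/
theorem exists_eLpNorm_solCoef_le {Q : ℝ} (hQ : 0 < Q) (hαQ : α * Q < 1) :
    ∃ C : ℝ, 0 ≤ C ∧ ∀ (φ : L2 D) (F : ℝ → L2 D), MemLp F (ENNReal.ofReal P) (timeMeasure T) →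
      Memℓp (fun j => S.lam β j ^ (p + qh) * ⟪S.e j, φ⟫_ℝ) 2 →
      MemLp (fun t => S.ofCoef fun j => S.lam β j ^ (p + qh) * S.solCoef α β T φ F t j)
        (ENNReal.ofReal Q) (timeMeasure T) ∧
      eLpNorm (fun t => S.ofCoef fun j => S.lam β j ^ (p + qh) * S.solCoef α β T φ F t j)
        (ENNReal.ofReal Q) (timeMeasure T) ≤
        ENNReal.ofReal C * (‖S.ofCoef fun j => S.lam β j ^ (p + qh) * ⟪S.e j, φ⟫_ℝ‖ₑ +
          eLpNorm F (ENNReal.ofReal P) (timeMeasure T)) := by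
  obtain ⟨C, hC, hb⟩ := S.exists_norm_solCoef_le h (θ := p + qh) le_rfl zero_le_one le_rfl
    (by linarith)
  have hr := memLp_rpow_neg (a := α * 1) hQ (by rwa [mul_one]) h.T_pos.le
  refine ⟨C * (eLpNorm (fun t : ℝ => t ^ (-(α * 1))) (ENNReal.ofReal Q) (timeMeasure T)).toReal,
    mul_nonneg hC ENNReal.toReal_nonneg, fun φ F hF hφ => ?_⟩
  set M := ‖S.ofCoef (fun j => S.lam β j ^ (p + qh) * ⟪S.e j, φ⟫_ℝ)‖
  set N := (eLpNorm F (ENNReal.ofReal P) (timeMeasure T)).toReal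
  have hle : ∀ᵐ t ∂timeMeasure T,
      ‖S.ofCoef (fun j => S.lam β j ^ (p + qh) * S.solCoef α β T φ F t j)‖ ≤
        C * (M + N) * ‖t ^ (-(α * 1))‖ :=
    (ae_restrict_mem measurableSet_Ioo).mono fun t ht => by
      refine (hb φ F hF hφ t ⟨ht.1, ht.2.le⟩).trans (le_of_eq ?_)
      rw [Real.norm_of_nonneg (Real.rpow_nonneg ht.1.le _)]
      ring
  refine ⟨hr.of_le_mul (S.aestronglyMeasurable_solCoef h hF hφ le_rfl) hle,
    (eLpNorm_le_mul_eLpNorm_of_ae_le_mul hle _).trans (le_of_eq ?_)⟩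
  rw [ENNReal.ofReal_mul hC, ENNReal.ofReal_mul hC, ENNReal.ofReal_add (norm_nonneg _)
    ENNReal.toReal_nonneg, ENNReal.ofReal_toReal hr.2.ne, ENNReal.ofReal_toReal hF.2.ne,
    ofReal_norm]
  ring

/-- The estimate of the Caputo derivative in `L^Q(0, T; V_{-β (q - qh)})`. -/
theorem exists_eLpNorm_caputo_le {Q : ℝ} (hQ : 1 ≤ Q) (hQP : Q ≤ P) (hαQ : α * Q < 1) :
    ∃ C : ℝ, 0 < C ∧ ∀ (φ : L2 D) (F : ℝ → L2 D), MemLp F (ENNReal.ofReal P) (timeMeasure T) →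
      Memℓp (fun j => S.lam β j ^ (p + qh) * ⟪S.e j, φ⟫_ℝ) 2 →
      MemLp (fun t => S.toDual (β * (q - qh))
        (S.ofCoef (fun j => S.lam β j ^ (-(q - qh)) * ⟪S.e j, F t⟫_ℝ) -
          S.ofCoef (fun j => S.lam β j ^ (p + qh) * S.solCoef α β T φ F t j)))
        (ENNReal.ofReal Q) (timeMeasure T) ∧
      eLpNorm (fun t => S.toDual (β * (q - qh))
        (S.ofCoef (fun j => S.lam β j ^ (-(q - qh)) * ⟪S.e j, F t⟫_ℝ) -
          S.ofCoef (fun j => S.lam β j ^ (p + qh) * S.solCoef α β T φ F t j)))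
        (ENNReal.ofReal Q) (timeMeasure T) ≤
        ENNReal.ofReal C * eLpNorm F (ENNReal.ofReal P) (timeMeasure T) +
          ENNReal.ofReal C * ‖S.ofCoef fun j => S.lam β j ^ (p + qh) * ⟪S.e j, φ⟫_ℝ‖ₑ := by
  obtain ⟨C₁, hC₁, hb₁⟩ := S.exists_eLpNorm_source_le h hQP
  obtain ⟨C₂, hC₂, hb₂⟩ := S.exists_eLpNorm_solCoef_le h (zero_lt_one.trans_le hQ) hαQ
  refine ⟨C₁ + C₂ + 1, by positivity, fun φ F hF hφ => ?_⟩
  obtain ⟨m₁, n₁⟩ := hb₁ F hF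
  obtain ⟨m₂, n₂⟩ := hb₂ φ F hF hφ
  refine ⟨(S.toDual (β * (q - qh))).comp_memLp' (m₁.sub m₂), ?_⟩
  refine (eLpNorm_mono (g := (fun t => S.ofCoef fun j => S.lam β j ^ (-(q - qh)) * ⟪S.e j, F t⟫_ℝ) -
    fun t => S.ofCoef fun j => S.lam β j ^ (p + qh) * S.solCoef α β T φ F t j)
    fun t => S.norm_toDual_le _).trans ?_
  refine (eLpNorm_sub_le m₁.1 m₂.1 (ENNReal.one_le_ofReal.2 hQ)).trans
    ((add_le_add n₁ n₂).trans ?_)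
  rw [ENNReal.ofReal_add (add_nonneg hC₁ hC₂) zero_le_one, ENNReal.ofReal_add hC₁ hC₂,
    ENNReal.ofReal_one]
  set M := ‖S.ofCoef fun j => S.lam β j ^ (p + qh) * ⟪S.e j, φ⟫_ℝ‖ₑ
  set N := eLpNorm F (ENNReal.ofReal P) (timeMeasure T)
  refine (le_self_add (b := N + (ENNReal.ofReal C₁ + 1) * M)).trans (le_of_eq ?_)
  ring

/-- The estimate of the Caputo derivative in `C^α((0, T]; V_{-β q})`. -/
theorem exists_weightedSup_caputo_le :
    ∃ C : ℝ, 0 < C ∧ ∀ (φ : L2 D) (F : ℝ → L2 D) (G : ℝ → S.VDual (β * q)),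
      MemLp F (ENNReal.ofReal P) (timeMeasure T) →
      Memℓp (fun j => S.lam β j ^ (p + qh) * ⟪S.e j, φ⟫_ℝ) 2 →
      S.Represents T F G → MemWeightedC α T G →
      ∃ W₂ : ℝ → S.VDual (β * q),
        S.RepresentsDual T (fun t => S.toDual (β * (q - qh))
          (S.ofCoef (fun j => S.lam β j ^ (-(q - qh)) * ⟪S.e j, F t⟫_ℝ) -
            S.ofCoef (fun j => S.lam β j ^ (p + qh) * S.solCoef α β T φ F t j))) W₂ ∧
        MemWeightedC α T W₂ ∧
        weightedSup α T W₂ ≤ weightedSup α T G +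
          ENNReal.ofReal C * (‖S.ofCoef fun j => S.lam β j ^ (p + qh) * ⟪S.e j, φ⟫_ℝ‖ₑ +
            eLpNorm F (ENNReal.ofReal P) (timeMeasure T)) := by
  obtain ⟨C, hC, hb⟩ := S.exists_norm_solCoef_le h (θ := p) (σ := 1)
    (by linarith [h.qh_nonneg]) zero_le_one le_rfl (by linarith [h.qh_nonneg])
  refine ⟨C + 1, by positivity, fun φ F G hF hφ hFG hG => ?_⟩
  have hle : p ≤ p + qh := by linarith [h.qh_nonneg]
  have hγδ : β * (q - qh) ≤ β * q :=
    mul_le_mul_of_nonneg_left (by linarith [h.qh_nonneg]) h.β_pos.le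
  have hsup : weightedSup α T (fun t => G t - S.toDual (β * q)
      (S.ofCoef fun j => S.lam β j ^ p * S.solCoef α β T φ F t j)) ≤ weightedSup α T G +
      ENNReal.ofReal (C + 1) * (‖S.ofCoef fun j => S.lam β j ^ (p + qh) * ⟪S.e j, φ⟫_ℝ‖ₑ +
            eLpNorm F (ENNReal.ofReal P) (timeMeasure T)) := by
    refine (weightedSup_sub_le (K := (C + 1) *
      (‖S.ofCoef fun j => S.lam β j ^ (p + qh) * ⟪S.e j, φ⟫_ℝ‖ +
        (eLpNorm F (ENNReal.ofReal P) (timeMeasure T)).toReal)) fun t ht => ?_).trans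
      (le_of_eq ?_)
    · refine (S.norm_toDual_le _).trans ((hb φ F hF hφ t ht).trans ?_)
      rw [mul_one, mul_right_comm]
      have := Real.rpow_nonneg ht.1.le (-α)
      gcongr
      linarith
    · rw [ENNReal.ofReal_mul (by positivity), ENNReal.ofReal_add (norm_nonneg _)
        ENNReal.toReal_nonneg, ENNReal.ofReal_toReal hF.2.ne, ofReal_norm]
  -- The witness is G - 𝓛^β u, where 𝓛^β u has weight 1 - q = p. The representative G replaces F
  -- because continuity is required at every t, while F matters only almost everywhere.
  refine ⟨fun t => G t - S.toDual (β * q)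
    (S.ofCoef fun j => S.lam β j ^ p * S.solCoef α β T φ F t j), ⟨hγδ, ?_⟩, ⟨?_, ?_⟩, hsup⟩
  · obtain ⟨hq, hG'⟩ := hFG
    filter_upwards [hG', ae_restrict_mem measurableSet_Ioo] with t h1 ht
    have e1 := S.restrict_toDual_lam hγδ (S.memlp_lam_mono h.β_pos.le (γ := -(q - qh)) (δ := 0)
      (by linarith [h.qh_le_q]) (by simpa using S.memlp_inner (F t)))
    have e2 := S.restrict_toDual_lam hγδ (S.memlp_solCoef h hF hφ le_rfl ⟨ht.1, ht.2.le⟩)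
    rw [show -(q - qh) + (q - qh) - q = -q by ring] at e1
    rw [show p + qh + (q - qh) - q = p by ring] at e2
    rw [h1, embed_eq_toDual_lam, map_sub, ← e1, ← e2]
    rfl
  · exact hG.1.sub ((S.toDual (β * q)).continuous.comp_continuousOn
      (S.continuousOn_solCoef h hF hφ le_rfl))
  · refine hsup.trans_lt (ENNReal.add_lt_top.2 ⟨hG.2, ENNReal.mul_lt_top ENNReal.ofReal_lt_top
      (ENNReal.add_lt_top.2 ⟨enorm_lt_top, hF.2⟩)⟩)

end EigenSystem

end FinalValue

/-! ### The theorem -/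

theorem theorem3p2 {k : ℕ} (hk : 1 ≤ k)
    (D : TopologicalSpace.Opens (Euc k)) (hD : Bornology.IsBounded (D : Set (Euc k)))
    (L : EllipticOperator D) (bc : BoundaryCondition) (S : EigenSystem L bc)
    (α β T : ℝ) (hα₀ : 0 < α) (hα₁ : α < 1) (hβ₀ : 0 < β) (hβ₁ : β ≤ 1) (hT : 0 < T)
    (p q s p' q' p_hat q_hat r r_hat : ℝ)
    (hp₀ : 0 < p) (hp₁ : p < 1) (hq₀ : 0 < q) (hq₁ : q < 1) (hpq : p + q = 1)
    (hs₀ : 0 < s) (hs₁ : s < min (α * q) (1 - α * q))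
    (hp'₀ : 0 < p') (hp'₁ : p' ≤ p - s / α) (hq' : q' = 1 - p')
    (hr₀ : 0 < r) (hr₁ : r ≤ (1 - α * q') / (α * q'))
    (hqh₀ : 0 ≤ q_hat) (hqh₁ : q_hat ≤ min (min p q) (s / α)) (hph : p_hat = 1 - q_hat)
    (hrh₀ : 0 < r_hat) (hrh₁ : r_hat ≤ (1 - α) / α) :
    (∃ C₃ : ℝ, 0 < C₃ ∧
      ∀ (φ : S.V (β * (p + q_hat))) (F : ℝ → L2 D),
        MemLp F (ENNReal.ofReal (1 / (α * q - s) + r_hat)) (timeMeasure T) →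
        ∃ u : ℝ → L2 D,
          S.IsUniqueMildSolution α β T (S.val φ) F u ∧
          S.MemLpV (β * (p - p')) (1 / (α * q') - r) T u ∧
          MemWeightedC (α * q) T u ∧
          S.MemHolderDual (β * q') s T u ∧
          ∃ W : ℝ → S.VDual (β * (q - q_hat)),
            S.IsCaputoDeriv α T (β * q') u W ∧
            MemLp W (ENNReal.ofReal (1 / α - r_hat)) (timeMeasure T) ∧
            eLpNorm W (ENNReal.ofReal (1 / α - r_hat)) (timeMeasure T) ≤
              ENNReal.ofReal C₃ *
                  eLpNorm F (ENNReal.ofReal (1 / (α * q - s) + r_hat)) (timeMeasure T) +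
                ENNReal.ofReal C₃ * ‖φ‖ₑ) ∧
    (∃ C₄ : ℝ, 0 < C₄ ∧
      ∀ (φ : S.V (β * (p + q_hat))) (F : ℝ → L2 D) (G : ℝ → S.VDual (β * q)),
        MemLp F (ENNReal.ofReal (1 / (α * q - s) + r_hat)) (timeMeasure T) →
        S.Represents T F G → MemWeightedC α T G →
        ∃ u : ℝ → L2 D,
          S.IsUniqueMildSolution α β T (S.val φ) F u ∧
          S.MemLpV (β * (p - p')) (1 / (α * q') - r) T u ∧
          MemWeightedC (α * q) T u ∧
          S.MemHolderDual (β * q') s T u ∧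
          ∃ (W : ℝ → S.VDual (β * (q - q_hat))) (W₂ : ℝ → S.VDual (β * q)),
            S.IsCaputoDeriv α T (β * q') u W ∧
            MemLp W (ENNReal.ofReal (1 / α - r_hat)) (timeMeasure T) ∧
            S.RepresentsDual T W W₂ ∧ MemWeightedC α T W₂ ∧
            eLpNorm W (ENNReal.ofReal (1 / α - r_hat)) (timeMeasure T) + weightedSup α T W₂ ≤
              ENNReal.ofReal C₄ * ‖φ‖ₑ +
                ENNReal.ofReal C₄ *
                  eLpNorm F (ENNReal.ofReal (1 / (α * q - s) + r_hat)) (timeMeasure T) +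
                ENNReal.ofReal C₄ * weightedSup α T G) := by
  have hq'1 : q' < 1 := by linarith
  have hsα : 0 < s / α := div_pos hs₀ hα₀
  have hq'0 : 0 < q' := by linarith
  have hs : s < α * q := hs₁.trans_le (min_le_left _ _)
  have hαs : 0 < α * q - s := by linarith
  have hαs1 : α * q - s < α := by nlinarith
  have hP : 1 < 1 / (α * q - s) + r_hat := by
    have : 1 < 1 / (α * q - s) := (one_lt_div hαs).2 (by linarith)
    linarith
  -- The margin r̂ > 0 makes the inequality strict, as the weakly singular integrals require.
  have hPd : 1 / (1 / (α * q - s) + r_hat) < α * q - s := by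
    rw [div_lt_iff₀ (by linarith), mul_add, mul_one_div_cancel hαs.ne']
    have := mul_pos hαs hrh₀
    linarith
  have h : AdmissibleExponents α β T (1 / (α * q - s) + r_hat) p q s p' q' q_hat :=
    ⟨hα₀, hα₁, hβ₀, hT, hP, hPd, hp₀, hq₀, hpq, hs₀, hp'₀, hp'₁, hq', hqh₀,
      hqh₁.trans ((min_le_left _ _).trans (min_le_right _ _)), hqh₁.trans (min_le_right _ _)⟩
  have hαq' : 0 < α * q' := mul_pos hα₀ hq'0
  have hQ₂ : 0 < 1 / (α * q') - r := by
    rw [sub_div, div_self hαq'.ne'] at hr₁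
    linarith
  have hQ₂' : α * q' * (1 / (α * q') - r) < 1 := by
    rw [mul_sub, mul_one_div_cancel hαq'.ne']
    have := mul_pos hαq' hr₀
    linarith
  have hQ₃ : 1 ≤ 1 / α - r_hat := by
    rw [sub_div, div_self hα₀.ne'] at hrh₁
    linarith
  have hQ₃' : α * (1 / α - r_hat) < 1 := by
    rw [mul_sub, mul_one_div_cancel hα₀.ne']
    have := mul_pos hα₀ hrh₀
    linarith
  -- As αq - s < α, the source exponent exceeds that of the derivative, so F itself lies in the
  -- target space in time.
  have hQP : 1 / α - r_hat ≤ 1 / (α * q - s) + r_hat := by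
    have := one_div_le_one_div_of_le hαs hαs1.le
    linarith
  obtain ⟨C₁, hC₁, hb₁⟩ := S.exists_eLpNorm_caputo_le h hQ₃ hQP hQ₃'
  obtain ⟨C₂, hC₂, hb₂⟩ := S.exists_weightedSup_caputo_le h
  have hφn : ∀ φ : S.V (β * (p + q_hat)),
      ‖S.ofCoef fun j => S.lam β j ^ (p + q_hat) * ⟪S.e j, S.val φ⟫_ℝ‖ₑ = ‖φ‖ₑ := fun φ => by
    rw [← ofReal_norm, ← ofReal_norm, ← S.norm_eq_norm_ofCoef]
  -- In (b) the summand 1 accounts for the norm of G, which enters with coefficient one.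
  refine ⟨⟨C₁, hC₁, fun φ F hF => ?_⟩, ⟨C₁ + C₂ + 1, by positivity, fun φ F G hF hFG hG => ?_⟩⟩
  · have hφ := S.memlp_val φ
    obtain ⟨hW, hWn⟩ := hb₁ (S.val φ) F hF hφ
    rw [hφn] at hWn
    exact ⟨_, S.isUniqueMildSolution_ofCoef h hF hφ, S.memLpV_ofCoef h hF hφ hQ₂ hQ₂',
      S.memWeightedC_ofCoef h hF hφ, S.memHolderDual_ofCoef h hF hφ, _,
      S.isCaputoDeriv_ofCoef h hF hφ, hW, hWn⟩
  · have hφ := S.memlp_val φ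
    obtain ⟨hW, hWn⟩ := hb₁ (S.val φ) F hF hφ
    obtain ⟨W₂, hWW, hW₂, hW₂n⟩ := hb₂ (S.val φ) F G hF hφ hFG hG
    rw [hφn] at hWn hW₂n
    refine ⟨_, S.isUniqueMildSolution_ofCoef h hF hφ, S.memLpV_ofCoef h hF hφ hQ₂ hQ₂',
      S.memWeightedC_ofCoef h hF hφ, S.memHolderDual_ofCoef h hF hφ, _, W₂,
      S.isCaputoDeriv_ofCoef h hF hφ, hW, hWW, hW₂, (add_le_add hWn hW₂n).trans ?_⟩
    rw [ENNReal.ofReal_add (by positivity) zero_le_one, ENNReal.ofReal_add hC₁.le hC₂.le,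
      ENNReal.ofReal_one]
    set M := ‖φ‖ₑ
    set N := eLpNorm F (ENNReal.ofReal (1 / (α * q - s) + r_hat)) (timeMeasure T)
    refine (le_self_add (b := M + N +
      (ENNReal.ofReal C₁ + ENNReal.ofReal C₂) * weightedSup α T G)).trans (le_of_eq ?_)
    ring
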